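/- Let $\mathcal K$ be a differential field of characteristic zero (one derivation $\partial$) whose field of constants $\mathcal C$ is algebraically closed. Let $G$ be an algebraic group over $\mathcal C$ (a group scheme that is reduced, separated and of finite type over $\mathcal C$; not necessarily affine or connected), let $\mathcal R(G)$ be the Lie algebra of regular vector fields on $G$ that are invariant under right translations by $G(\mathcal C)$, let $\vec A=\sum_i \vec A_i\otimes f_i\in\mathcal R(G)\otimes_{\mathcal C}\mathcal K$, and let $\partial_{\vec A}$ be the derivation of the structure sheaf of $G_{\mathcal K}=G\times_{\mathcal C}\mathrm{Spec}(\mathcal K)$ given by $a\otimes h\mapsto \partial a\otimes h+\sum_i a f_i\otimes \vec A_i h$. Let $\mathrm{Diff}(G_{\mathcal K},\partial_{\vec A})$ be the set of points of $G_{\mathcal K}$ that correspond to differential prime ideals in affine open subsets, with the subspace (Kolchin) topology; for such a point $\mathfrak x$, the derivation induces the structure of a differential extension of $\mathcal K$ on the residue field $\kappa(\mathfrak x)$. For a differential extension $\mathcal K\subset\mathcal S$ with field of constants $C_{\mathcal S}$, say that $\mathcal S$ is a splitting extension if $(G_{\mathcal S},\partial_{\vec A})$ is isomorphic, as an $\mathcal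 S$-scheme with derivation, to $Y\times_{C_{\mathcal S}}(\mathrm{Spec}(\mathcal S),\partial)$ for some $C_{\mathcal S}$-scheme $Y$ (with zero derivation). Then: 1. $\mathrm{Diff}(G_{\mathcal K},\partial_{\vec A})$ has a closed point. 2. For each closed point $\mathfrak x$ of $\mathrm{Diff}(G_{\mathcal K},\partial_{\vec A})$, the field of constants of $\kappa(\mathfrak x)$ is $\mathcal C$, and $\kappa(\mathfrak x)$ is a splitting extension. 3. Right translations by elements of $G(\mathcal C)$ map closed points of $\mathrm{Diff}(G_{\mathcal K},\partial_{\vec A})$ to closed points, and this action of $G(\mathcal C)$ on the set of closed points is transitive. 4. For any two closed points $\mathfrak x,\mathfrak y$ of $\mathrm{Diff}(G_{\mathcal K},\partial_{\vec A})$ there is a $\mathcal K$-isomorphism of differential fields $\kappa(\mathfrak x)\simeq\kappa(\mathfrak y)$. 5. If $\mathfrak x$ is a closed point of $\mathrm{Diff}(G_{\mathcal K},\partial_{\vec A})$ and $\mathcal S$ is a splitting extension whose field of constants is algebraically closed, then there is a $\mathcal K$-embedding of differential fields $\kappa(\mathfrak x)\hookrightarrow\mathcal S$. -/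

import Mathlib

open CategoryTheory AlgebraicGeometry Limits MonoidalCategory TensorProduct
open scoped Differential
universe u
namespace LieVessiot

/-! ### Extension of derivations to localizations of tensor products -/

/-- A map `d` that is additive and satisfies the Leibniz rule along `ρ` gives a ring homomorphism
to the dual numbers. -/
noncomputable def dualHom {A T : Type*} [CommRing A] [CommRing T] (ρ : A →+* T) (d : A →+ T)
    (hd : ∀ a b, d (a * b) = ρ a * d b + ρ b * d a) : A →+* DualNumber T where
  toFun a := (ρ a, d a)
  map_one' := by
    have h := hd 1 1
    simp only [mul_one, map_one, one_mul] at h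
    have h' : d 1 = 0 := by simpa using h
    exact TrivSqZeroExt.ext (map_one ρ) h'
  map_mul' a b := TrivSqZeroExt.ext (map_mul ρ a b) (by
    change d (a * b) = ρ a • d b + MulOpposite.op (ρ b) • d a
    rw [hd]; simp [mul_comm])
  map_zero' := TrivSqZeroExt.ext (map_zero ρ) (map_zero d)
  map_add' a b := TrivSqZeroExt.ext (map_add ρ a b) (map_add d a b)

theorem dualHom_fst {A T : Type*} [CommRing A] [CommRing T] (ρ : A →+* T) (d : A →+ T)
    (hd : ∀ a b, d (a * b) = ρ a * d b + ρ b * d a) (a : A) : (dualHom ρ d hd a).fst = ρ a := rfl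

theorem dualHom_snd {A T : Type*} [CommRing A] [CommRing T] (ρ : A →+* T) (d : A →+ T)
    (hd : ∀ a b, d (a * b) = ρ a * d b + ρ b * d a) (a : A) : (dualHom ρ d hd a).snd = d a := rfl

section Core

variable {Z B F R : CommRingCat.{u}} {i : Z ⟶ B} {j : Z ⟶ F} {inl : B ⟶ R} {inr : F ⟶ R}

theorem ringHom_ext_of_isPushout (h : IsPushout i j inl inr) {Q : Type u} [CommRing Q]
    {f g : R →+* Q} (hl : ∀ b, f (inl b) = g (inl b)) (hr : ∀ k, f (inr k) = g (inr k)) :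
    f = g := by
  have : CommRingCat.ofHom f = CommRingCat.ofHom g := by
    apply h.hom_ext <;> ext x
    · exact hl x
    · exact hr x
  exact congrArg CommRingCat.Hom.hom this

/-- On a localization of `B ⊗ F`, additive maps with the Leibniz rule are determined by their
values on `B` and `F`. -/
theorem leibniz_ext (h : IsPushout i j inl inr) {T T' : Type u} [CommRing T] [CommRing T']
    [Algebra R T] (M : Submonoid R) [IsLocalization M T] (ρ : T →+* T') {d₁ d₂ : T →+ T'}
    (h₁ : ∀ a b, d₁ (a * b) = ρ a * d₁ b + ρ b * d₁ a)
    (h₂ : ∀ a b, d₂ (a * b) = ρ a * d₂ b + ρ b * d₂ a)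
    (hl : ∀ b, d₁ (algebraMap R T (inl b)) = d₂ (algebraMap R T (inl b)))
    (hr : ∀ k, d₁ (algebraMap R T (inr k)) = d₂ (algebraMap R T (inr k))) : d₁ = d₂ := by
  have : dualHom ρ d₁ h₁ = dualHom ρ d₂ h₂ := by
    apply IsLocalization.ringHom_ext M
    apply ringHom_ext_of_isPushout h
    · exact fun b => TrivSqZeroExt.ext rfl (hl b)
    · exact fun b => TrivSqZeroExt.ext rfl (hr b)
  ext t
  exact congrArg TrivSqZeroExt.snd (DFunLike.congr_fun this t)

/-- Derivations of `B` and of `F` with values in a localization `T` of `B ⊗ F` that agree on `Z`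
extend to a derivation of `T`. -/
theorem exists_derivation (h : IsPushout i j inl inr) {T : Type u} [CommRing T]
    [Algebra R T] (M : Submonoid R) [IsLocalization M T] (dB : B →+ T) (dF : F →+ T)
    (hB : ∀ a b, dB (a * b) = algebraMap R T (inl a) * dB b + algebraMap R T (inl b) * dB a)
    (hF : ∀ a b, dF (a * b) = algebraMap R T (inr a) * dF b + algebraMap R T (inr b) * dF a)
    (hZ : ∀ z, dB (i z) = dF (j z)) :
    ∃ δ : Derivation ℤ T T, (∀ b, δ (algebraMap R T (inl b)) = dB b) ∧
      ∀ k, δ (algebraMap R T (inr k)) = dF k := by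
  let φB : B →+* DualNumber T := dualHom ((algebraMap R T).comp inl.hom) dB hB
  let φF : F →+* DualNumber T := dualHom ((algebraMap R T).comp inr.hom) dF hF
  have hcomm : i ≫ CommRingCat.ofHom φB = j ≫ CommRingCat.ofHom φF := by
    ext1
    refine RingHom.ext fun z => ?_
    change φB (i z) = φF (j z)
    refine TrivSqZeroExt.ext ?_ (hZ z)
    change algebraMap R T (inl (i z)) = algebraMap R T (inr (j z))
    have := congr(($h.w).hom z)
    exact congrArg _ this
  let φR : R →+* DualNumber T := (h.desc _ _ hcomm).hom
  have φR_inl (b) : φR (inl b) = φB b := congr(($(h.inl_desc _ _ hcomm)).hom b)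
  have φR_inr (k) : φR (inr k) = φF k := congr(($(h.inr_desc _ _ hcomm)).hom k)
  have hfst : (TrivSqZeroExt.fstHom T T T : DualNumber T →+* T).comp φR = algebraMap R T := by
    apply ringHom_ext_of_isPushout h
    · intro b
      change (φR (inl b)).fst = _
      rw [φR_inl]; rfl
    · intro b
      change (φR (inr b)).fst = _
      rw [φR_inr]; rfl
  have hunit (m : M) : IsUnit (φR m) := by
    rw [TrivSqZeroExt.isUnit_iff_isUnit_fst]
    have : (φR m).fst = algebraMap R T m := congr($hfst m)
    rw [this]
    exact IsLocalization.map_units T m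
  let φ : T →+* DualNumber T := IsLocalization.lift hunit
  have hφ (r : R) : φ (algebraMap R T r) = φR r := IsLocalization.lift_eq hunit r
  have hφ' : (TrivSqZeroExt.fstHom T T T : DualNumber T →+* T).comp φ = RingHom.id T := by
    apply IsLocalization.ringHom_ext M
    ext r
    change (φ (algebraMap R T r)).fst = algebraMap R T r
    rw [hφ, ← hfst]; rfl
  have hφ'' (t : T) : (φ t).fst = t := congr($hφ' t)
  refine ⟨Derivation.mk' (AddMonoidHom.toIntLinearMap
    { toFun := fun t => (φ t).snd, map_zero' := by simp, map_add' := by simp }) ?_, ?_, ?_⟩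
  · intro a b
    change (φ (a * b)).snd = a • (φ b).snd + b • (φ a).snd
    rw [map_mul, TrivSqZeroExt.snd_mul, hφ'', hφ'']
    simp [mul_comm]
  · intro b
    change (φ (algebraMap R T (inl b))).snd = _
    rw [hφ, φR_inl]; rfl
  · intro b
    change (φ (algebraMap R T (inr b))).snd = _
    rw [hφ, φR_inr]; rfl
end Core

/-! ### Derivations of the structure sheaf -/

/-- A derivation of the structure sheaf of a scheme. -/
structure SchemeDerivation (X : Scheme.{u}) where
  /-- The derivation of the ring of sections over each open subset. -/
  app (U : X.Opens) : Derivation ℤ Γ(X, U) Γ(X, U)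
  /-- Compatibility with restriction. -/
  app_res (U V : X.Opens) (h : V ≤ U) (s : Γ(X, U)) :
    app V (X.presheaf.map (homOfLE h).op s) = X.presheaf.map (homOfLE h).op (app U s)

theorem SchemeDerivation.germ_congr {X : Scheme.{u}} (D : SchemeDerivation X) (x : X)
    {U V : X.Opens} (hU : x ∈ U) (hV : x ∈ V) (s : Γ(X, U)) (t : Γ(X, V))
    (h : X.presheaf.germ U x hU s = X.presheaf.germ V x hV t) :
    X.presheaf.germ U x hU (D.app U s) = X.presheaf.germ V x hV (D.app V t) := by
  obtain ⟨W, hW, iU, iV, e⟩ := X.presheaf.germ_eq x hU hV s t h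
  rw [← X.presheaf.germ_res_apply iU x hW, ← X.presheaf.germ_res_apply iV x hW]
  have h1 := D.app_res U W iU.le s
  have h2 := D.app_res V W iV.le t
  have e' : X.presheaf.map (homOfLE iU.le).op s = X.presheaf.map (homOfLE iV.le).op t := e
  rw [e', h2] at h1
  exact congrArg _ h1.symm

/-- The derivation of the local ring at a point that is induced by a derivation of the structure
sheaf. -/
theorem SchemeDerivation.exists_stalk {X : Scheme.{u}} (D : SchemeDerivation X) (x : X) :
    ∃! δ : Derivation ℤ (X.presheaf.stalk x) (X.presheaf.stalk x),
      ∀ (U : X.Opens) (hx : x ∈ U) (s : Γ(X, U)),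
        δ (X.presheaf.germ U x hx s) = X.presheaf.germ U x hx (D.app U s) := by
  choose U hU s hs using fun t : X.presheaf.stalk x => X.presheaf.exists_germ_eq t
  let f : X.presheaf.stalk x → X.presheaf.stalk x :=
    fun t => X.presheaf.germ (U t) x (hU t) (D.app (U t) (s t))
  have hf (V : X.Opens) (hx : x ∈ V) (a : Γ(X, V)) :
      f (X.presheaf.germ V x hx a) = X.presheaf.germ V x hx (D.app V a) :=
    D.germ_congr x _ _ _ _ (hs _)
  have two (a b : X.presheaf.stalk x) : ∃ (V : X.Opens) (hx : x ∈ V) (a' b' : Γ(X, V)),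
      X.presheaf.germ V x hx a' = a ∧ X.presheaf.germ V x hx b' = b := by
    have hab : x ∈ U a ⊓ U b := TopologicalSpace.Opens.mem_inf.mpr ⟨hU a, hU b⟩
    refine ⟨U a ⊓ U b, hab, X.presheaf.map (homOfLE inf_le_left).op (s a),
      X.presheaf.map (homOfLE inf_le_right).op (s b), ?_, ?_⟩
    · rw [X.presheaf.germ_res_apply, hs]
    · rw [X.presheaf.germ_res_apply, hs]
  have hadd (a b) : f (a + b) = f a + f b := by
    obtain ⟨V, hx, a, b, rfl, rfl⟩ := two a b
    rw [← map_add, hf, hf, hf, map_add, map_add]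
  have hmul (a b) : f (a * b) = a • f b + b • f a := by
    obtain ⟨V, hx, a, b, rfl, rfl⟩ := two a b
    rw [← map_mul, hf, hf, hf, Derivation.leibniz]
    simp
  refine ⟨Derivation.mk' (AddMonoidHom.toIntLinearMap (AddMonoidHom.mk' f hadd)) hmul, hf, ?_⟩
  intro δ hδ
  ext t
  obtain ⟨V, hx, a, rfl⟩ := X.presheaf.exists_germ_eq t
  exact (hδ V hx a).trans (hf V hx a).symm

theorem exists_schemeDerivation_of_stalks {X : Scheme.{u}}
    (δ : ∀ x : X, Derivation ℤ (X.presheaf.stalk x) (X.presheaf.stalk x))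
    (h : ∀ (W : X.Opens) (s : Γ(X, W)) (x : X), x ∈ W → ∃ (W' : X.Opens) (hW : W' ≤ W),
      x ∈ W' ∧ ∃ t : Γ(X, W'), ∀ (y : X) (hy : y ∈ W'),
        X.presheaf.germ W' y hy t = δ y (X.presheaf.germ W y (hW hy) s)) :
    ∃ D : SchemeDerivation X, ∀ (W : X.Opens) (s : Γ(X, W)) (x : X) (hx : x ∈ W),
      X.presheaf.germ W x hx (D.app W s) = δ x (X.presheaf.germ W x hx s) := by
  have key (W : X.Opens) (s : Γ(X, W)) : ∃ t : Γ(X, W), ∀ (x : X) (hx : x ∈ W),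
      X.presheaf.germ W x hx t = δ x (X.presheaf.germ W x hx s) := by
    choose U hU hxU t ht using fun x : W => h W s x.1 x.2
    obtain ⟨gl, hgl, -⟩ := X.sheaf.existsUnique_gluing' U W (fun x => homOfLE (hU x))
      (fun x hx => TopologicalSpace.Opens.mem_iSup.mpr ⟨⟨x, hx⟩, hxU ⟨x, hx⟩⟩) t (by
        intro x y
        apply TopCat.Presheaf.section_ext X.sheaf
        intro z hz
        erw [X.presheaf.germ_res_apply, X.presheaf.germ_res_apply]
        rw [ht, ht])
    refine ⟨gl, fun x hx => ?_⟩
    rw [← ht ⟨x, hx⟩ x (hxU ⟨x, hx⟩), ← hgl ⟨x, hx⟩]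
    erw [X.presheaf.germ_res_apply]
  choose f hf using key
  have ext' (W : X.Opens) (a b : Γ(X, W)) (h : ∀ (x : X) (hx : x ∈ W),
      X.presheaf.germ W x hx a = X.presheaf.germ W x hx b) : a = b :=
    TopCat.Presheaf.section_ext X.sheaf W a b h
  refine ⟨⟨fun W => Derivation.mk' (AddMonoidHom.toIntLinearMap (AddMonoidHom.mk' (f W) ?_)) ?_,
    ?_⟩, hf⟩
  · intro a b
    apply ext'
    intro x hx
    rw [hf, map_add, map_add, map_add, hf, hf]
  · intro a b
    apply ext'
    intro x hx
    change X.presheaf.germ W x hx (f W (a * b)) =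
      X.presheaf.germ W x hx (a * (f W b) + b * (f W a))
    rw [hf, map_mul, Derivation.leibniz, map_add, map_mul, map_mul, hf, hf, smul_eq_mul,
      smul_eq_mul]
  · intro U V hUV s
    apply ext'
    intro x hx
    change X.presheaf.germ V x hx (f V _) = X.presheaf.germ V x hx
      (X.presheaf.map (homOfLE hUV).op (f U s))
    rw [hf, X.presheaf.germ_res_apply, X.presheaf.germ_res_apply, hf]

theorem le_preimage_top {X Y : Scheme.{u}} (f : X ⟶ Y) (U : X.Opens) : U ≤ f ⁻¹ᵁ ⊤ :=
  fun _ _ => TopologicalSpace.Opens.mem_top _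

section Extension

variable {X Y S : Scheme.{u}} {F : CommRingCat.{u}} {g : X ⟶ Y} {q : X ⟶ Spec F} {p : Y ⟶ S}
  {f : Spec F ⟶ S}

theorem isPushout_sections [IsAffine S] (H : IsPullback g q p f) (V : Y.Opens)
    (hV : IsAffineOpen V) :
    IsPushout (p.appLE ⊤ V (le_preimage_top p V)) (f.appLE ⊤ ⊤ (le_preimage_top f ⊤)) (g.app V)
      (q.appLE ⊤ (g ⁻¹ᵁ V) (le_preimage_top q _)) := by
  have hUY : g ⁻¹ᵁ V = g ⁻¹ᵁ V ⊓ q ⁻¹ᵁ ⊤ := by simp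
  have := (isIso_pushoutSection_iff H (US := ⊤) (UT := ⊤) (UX := V) le_top le_top hUY).mp
    (isIso_pushoutSection_of_isAffineOpen H (US := ⊤) (UT := ⊤) (UX := V) le_top le_top hUY
      (isAffineOpen_top S) (isAffineOpen_top _) hV)
  rw [← Scheme.Hom.appLE_eq_app]
  exact this

/-- A derivation of the sections of `Y` with values in the sections of `X = Y ×_S Spec F` and a
derivation of `F` that agree on `S` extend uniquely to a derivation of the structure sheaf. -/
theorem existsUnique_schemeDerivation [IsAffine S] (H : IsPullback g q p f)
    (dY : ∀ V : Y.Opens, Γ(Y, V) →+ Γ(X, g ⁻¹ᵁ V))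
    (dF : Γ(Spec F, ⊤) →+ Γ(Spec F, ⊤))
    (hY : ∀ V a b, dY V (a * b) = g.app V a * dY V b + g.app V b * dY V a)
    (hres : ∀ (U V : Y.Opens) (h : V ≤ U) (s : Γ(Y, U)),
      dY V (Y.presheaf.map (homOfLE h).op s) =
        X.presheaf.map (homOfLE (g.preimage_mono h)).op (dY U s))
    (hF : ∀ a b, dF (a * b) = a * dF b + b * dF a)
    (hSY : ∀ V z, dY V (p.appLE ⊤ V (le_preimage_top p V) z) = 0)
    (hSF : ∀ z, dF (f.appLE ⊤ ⊤ (le_preimage_top f ⊤) z) = 0) :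
    ∃! D : SchemeDerivation X,
      (∀ V s, D.app (g ⁻¹ᵁ V) (g.app V s) = dY V s) ∧
      ∀ U a, D.app U (q.appLE ⊤ U (le_preimage_top q _) a) = q.appLE ⊤ U (le_preimage_top q _) (dF a) := by
  have hgaff : IsAffineHom g := MorphismProperty.of_isPullback H.flip inferInstance
  -- germs of pulled back sections and of scalars
  have germ_app {x : X} {V V' : Y.Opens} (h : V' ≤ V) (hx : g x ∈ V') (b : Γ(Y, V)) :
      X.presheaf.germ (g ⁻¹ᵁ V') x hx (g.app V' (Y.presheaf.map (homOfLE h).op b)) =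
        X.presheaf.germ (g ⁻¹ᵁ V) x (h hx) (g.app V b) := by
    have := congr($(g.naturality (homOfLE h).op) b)
    change g.app V' (Y.presheaf.map (homOfLE h).op b) =
      X.presheaf.map ((TopologicalSpace.Opens.map g.base).map (homOfLE h)).op (g.app V b) at this
    rw [this]
    exact X.presheaf.germ_res_apply _ x hx _
  have germ_dY {x : X} {V V' : Y.Opens} (h : V' ≤ V) (hx : g x ∈ V') (b : Γ(Y, V)) :
      X.presheaf.germ (g ⁻¹ᵁ V') x hx (dY V' (Y.presheaf.map (homOfLE h).op b)) =
        X.presheaf.germ (g ⁻¹ᵁ V) x (h hx) (dY V b) := by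
    rw [hres _ _ h]
    exact X.presheaf.germ_res_apply _ x hx _
  have res_q {U U' : X.Opens} (h : U' ≤ U) (a : Γ(Spec F, ⊤)) :
      X.presheaf.map (homOfLE h).op (q.appLE ⊤ U (le_preimage_top q _) a) = q.appLE ⊤ U' (le_preimage_top q _) a :=
    congr($(q.appLE_map (le_preimage_top q _) (homOfLE h).op) a)
  have germ_q {x : X} {U U' : X.Opens} (hU : x ∈ U) (hU' : x ∈ U') (a : Γ(Spec F, ⊤)) :
      X.presheaf.germ U x hU (q.appLE ⊤ U (le_preimage_top q _) a) =
        X.presheaf.germ U' x hU' (q.appLE ⊤ U' (le_preimage_top q _) a) := by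
    rw [← res_q (le_top : U ≤ ⊤), ← res_q (le_top : U' ≤ ⊤), X.presheaf.germ_res_apply,
      X.presheaf.germ_res_apply]
  -- the derivation data with values in a localization
  have ex {V : Y.Opens} (hV : IsAffineOpen V) (T : Type u) [CommRing T]
      [Algebra Γ(X, g ⁻¹ᵁ V) T] (M : Submonoid Γ(X, g ⁻¹ᵁ V)) [IsLocalization M T] :
      ∃ δ : Derivation ℤ T T,
        (∀ b, δ (algebraMap Γ(X, g ⁻¹ᵁ V) T (g.app V b)) = algebraMap _ T (dY V b)) ∧
        ∀ a, δ (algebraMap Γ(X, g ⁻¹ᵁ V) T (q.appLE ⊤ (g ⁻¹ᵁ V) (le_preimage_top q _) a)) =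
          algebraMap Γ(X, g ⁻¹ᵁ V) T (q.appLE ⊤ (g ⁻¹ᵁ V) (le_preimage_top q _) (dF a)) := by
    refine exists_derivation (isPushout_sections H V hV) M
      ((algebraMap Γ(X, g ⁻¹ᵁ V) T).toAddMonoidHom.comp (dY V))
      (((algebraMap Γ(X, g ⁻¹ᵁ V) T).comp (q.appLE ⊤ (g ⁻¹ᵁ V) (le_preimage_top q _)).hom).toAddMonoidHom.comp
        dF) ?_ ?_ ?_
    · intro a b
      change algebraMap _ T (dY V (a * b)) = algebraMap _ T _ * algebraMap _ T (dY V b) +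
        algebraMap _ T _ * algebraMap _ T (dY V a)
      rw [hY, map_add, map_mul, map_mul]
    · intro a b
      change algebraMap _ T (q.appLE ⊤ (g ⁻¹ᵁ V) (le_preimage_top q _) (dF (a * b))) = _ *
        algebraMap _ T (q.appLE ⊤ (g ⁻¹ᵁ V) (le_preimage_top q _) (dF b)) +
        _ * algebraMap _ T (q.appLE ⊤ (g ⁻¹ᵁ V) (le_preimage_top q _) (dF a))
      rw [hF, map_add, map_mul, map_mul, map_add, map_mul, map_mul]
    · intro z
      change algebraMap _ T (dY V _) = algebraMap _ T (q.appLE ⊤ (g ⁻¹ᵁ V) (le_preimage_top q _) (dF _))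
      rw [hSY, hSF, map_zero, map_zero, map_zero]
  -- good derivations of the local rings
  let P (x : X) (V : Y.Opens) (hx : g x ∈ V)
      (δ : Derivation ℤ (X.presheaf.stalk x) (X.presheaf.stalk x)) : Prop :=
    ∀ b, δ (X.presheaf.germ (g ⁻¹ᵁ V) x hx (g.app V b)) =
      X.presheaf.germ (g ⁻¹ᵁ V) x hx (dY V b)
  let Q (x : X) (δ : Derivation ℤ (X.presheaf.stalk x) (X.presheaf.stalk x)) : Prop :=
    ∀ (U : X.Opens) (hx : x ∈ U) (a), δ (X.presheaf.germ U x hx (q.appLE ⊤ U (le_preimage_top q _) a)) =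
      X.presheaf.germ U x hx (q.appLE ⊤ U (le_preimage_top q _) (dF a))
  have exP (x : X) {V : Y.Opens} (hV : IsAffineOpen V) (hx : g x ∈ V) :
      ∃ δ, P x V hx δ ∧ Q x δ := by
    let := X.presheaf.algebra_section_stalk (U := g ⁻¹ᵁ V) ⟨x, hx⟩
    have := (hV.preimage g).isLocalization_stalk ⟨x, hx⟩
    obtain ⟨δ, h1, h2⟩ := ex hV (X.presheaf.stalk x)
      ((hV.preimage g).primeIdealOf ⟨x, hx⟩).asIdeal.primeCompl
    refine ⟨δ, h1, fun U hxU a => ?_⟩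
    rw [germ_q hxU (show x ∈ g ⁻¹ᵁ V from hx), germ_q hxU (show x ∈ g ⁻¹ᵁ V from hx)]
    exact h2 a
  have uniqP (x : X) {V : Y.Opens} (hV : IsAffineOpen V) (hx : g x ∈ V) (δ δ')
      (h : P x V hx δ) (h' : P x V hx δ') (hQ : Q x δ) (hQ' : Q x δ') : δ = δ' := by
    let := X.presheaf.algebra_section_stalk (U := g ⁻¹ᵁ V) ⟨x, hx⟩
    have := (hV.preimage g).isLocalization_stalk ⟨x, hx⟩
    have := leibniz_ext (isPushout_sections H V hV) (T := X.presheaf.stalk x)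
      ((hV.preimage g).primeIdealOf ⟨x, hx⟩).asIdeal.primeCompl (RingHom.id _)
      (d₁ := (δ : X.presheaf.stalk x →+ X.presheaf.stalk x))
      (d₂ := (δ' : X.presheaf.stalk x →+ X.presheaf.stalk x))
      (fun a b => δ.leibniz a b) (fun a b => δ'.leibniz a b)
      (fun b => (h b).trans (h' b).symm)
      (fun a => (hQ _ hx a).trans (hQ' _ hx a).symm)
    ext t
    exact DFunLike.congr_fun this t
  have monoP (x : X) {V V' : Y.Opens} (hVV : V' ≤ V) (hx : g x ∈ V') (δ) (h : P x V' hx δ) :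
      P x V (hVV hx) δ := by
    intro b
    rw [← germ_app hVV hx, ← germ_dY hVV hx]
    exact h _
  have exAll (x : X) : ∃ δ, (∀ V hx, P x V hx δ) ∧ Q x δ := by
    obtain ⟨V₀, hV₀, hx₀, -⟩ := exists_isAffineOpen_mem_and_subset (X := Y)
      (U := ⊤) (x := g x) (TopologicalSpace.Opens.mem_top _)
    obtain ⟨δ₀, h₀, hQ₀⟩ := exP x hV₀ hx₀
    refine ⟨δ₀, fun V hx => ?_, hQ₀⟩
    obtain ⟨V₁, hV₁, hx₁, hle⟩ := exists_isAffineOpen_mem_and_subset (X := Y)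
      (U := V₀ ⊓ V) (x := g x)
      (TopologicalSpace.Opens.mem_inf.mpr ⟨hx₀, hx⟩)
    obtain ⟨δ₁, h₁, hQ₁⟩ := exP x hV₁ hx₁
    have hle₀ : V₁ ≤ V₀ := fun y hy => (hle hy).1
    have hle' : V₁ ≤ V := fun y hy => (hle hy).2
    have e := uniqP x hV₀ hx₀ δ₀ δ₁ h₀ (monoP x hle₀ hx₁ δ₁ h₁) hQ₀ hQ₁
    rw [e]
    exact monoP x hle' hx₁ δ₁ h₁
  choose δ hP hQ using exAll
  have ext' (W : X.Opens) (a b : Γ(X, W)) (h : ∀ (x : X) (hx : x ∈ W),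
      X.presheaf.germ W x hx a = X.presheaf.germ W x hx b) : a = b :=
    TopCat.Presheaf.section_ext X.sheaf W a b h
  obtain ⟨D, hD⟩ := exists_schemeDerivation_of_stalks δ (by
    intro W s x hxW
    obtain ⟨V, hV, hx, -⟩ := exists_isAffineOpen_mem_and_subset (X := Y)
      (U := ⊤) (x := g x) (TopologicalSpace.Opens.mem_top _)
    obtain ⟨b, hb, hxb⟩ := (hV.preimage g).exists_basicOpen_le ⟨x, hxW⟩ hx
    have := (hV.preimage g).isLocalization_basicOpen b
    obtain ⟨ε, h1, h2⟩ := ex hV Γ(X, X.basicOpen b) (Submonoid.powers b)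
    have hbV : X.basicOpen b ≤ g ⁻¹ᵁ V := X.basicOpen_le b
    refine ⟨X.basicOpen b, hb, hxb, ε (X.presheaf.map (homOfLE hb).op s), fun y hy => ?_⟩
    have gr (r : Γ(X, g ⁻¹ᵁ V)) : X.presheaf.germ (X.basicOpen b) y hy
        (algebraMap Γ(X, g ⁻¹ᵁ V) Γ(X, X.basicOpen b) r) =
          X.presheaf.germ (g ⁻¹ᵁ V) y (hbV hy) r :=
      X.presheaf.germ_res_apply _ y hy r
    have key := leibniz_ext (isPushout_sections H V hV) (T := Γ(X, X.basicOpen b))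
      (T' := X.presheaf.stalk y)
      (Submonoid.powers b) (X.presheaf.germ (X.basicOpen b) y hy).hom
      (d₁ := (X.presheaf.germ (X.basicOpen b) y hy).hom.toAddMonoidHom.comp
        (ε : Γ(X, X.basicOpen b) →+ Γ(X, X.basicOpen b)))
      (d₂ := (δ y : X.presheaf.stalk y →+ X.presheaf.stalk y).comp
        (X.presheaf.germ (X.basicOpen b) y hy).hom.toAddMonoidHom)
      (by
        intro a c
        change X.presheaf.germ (X.basicOpen b) y hy (ε (a * c)) =
          X.presheaf.germ (X.basicOpen b) y hy a * X.presheaf.germ (X.basicOpen b) y hy (ε c) +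
          X.presheaf.germ (X.basicOpen b) y hy c * X.presheaf.germ (X.basicOpen b) y hy (ε a)
        rw [Derivation.leibniz, map_add, smul_eq_mul, smul_eq_mul, map_mul, map_mul])
      (by
        intro a c
        change δ y (X.presheaf.germ (X.basicOpen b) y hy (a * c)) =
          X.presheaf.germ (X.basicOpen b) y hy a * δ y (X.presheaf.germ (X.basicOpen b) y hy c) +
          X.presheaf.germ (X.basicOpen b) y hy c * δ y (X.presheaf.germ (X.basicOpen b) y hy a)
        rw [map_mul, Derivation.leibniz, smul_eq_mul, smul_eq_mul])
      (by
        intro r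
        change X.presheaf.germ (X.basicOpen b) y hy (ε (algebraMap _ _ (g.app V r))) =
          δ y (X.presheaf.germ (X.basicOpen b) y hy (algebraMap _ _ (g.app V r)))
        rw [h1, gr, gr]
        exact (hP y V (hbV hy) r).symm)
      (by
        intro r
        change X.presheaf.germ (X.basicOpen b) y hy (ε (algebraMap _ _ (q.appLE ⊤ _ (le_preimage_top q _) r))) =
          δ y (X.presheaf.germ (X.basicOpen b) y hy (algebraMap _ _ (q.appLE ⊤ _ (le_preimage_top q _) r)))
        rw [h2, gr, gr]
        exact (hQ y _ (hbV hy) r).symm)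
    have := DFunLike.congr_fun key (X.presheaf.map (homOfLE hb).op s)
    change X.presheaf.germ (X.basicOpen b) y hy (ε _) =
      δ y (X.presheaf.germ (X.basicOpen b) y hy (X.presheaf.map (homOfLE hb).op s)) at this
    rw [this, X.presheaf.germ_res_apply])
  refine ⟨D, ⟨fun V s => ext' _ _ _ fun x hx => ?_, fun U a => ext' _ _ _ fun x hx => ?_⟩, ?_⟩
  · rw [hD]
    exact hP x V hx s
  · rw [hD]
    exact hQ x U hx a
  · rintro D' ⟨h1, h2⟩
    have hst (x : X) (W : X.Opens) (hx : x ∈ W) (s : Γ(X, W)) :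
        X.presheaf.germ W x hx (D'.app W s) = δ x (X.presheaf.germ W x hx s) := by
      obtain ⟨δ', hδ', -⟩ := D'.exists_stalk x
      obtain ⟨V, hV, hxV, -⟩ := exists_isAffineOpen_mem_and_subset (X := Y)
        (U := ⊤) (x := g x) (TopologicalSpace.Opens.mem_top _)
      have : δ' = δ x := by
        refine uniqP x hV hxV _ _ (fun b => ?_) (hP x V hxV) (fun U hxU a => ?_) (hQ x)
        · rw [hδ' _ hxV, h1]
        · rw [hδ' _ hxU, h2]
      rw [← this, hδ']
    have : D'.app = D.app := by
      funext W
      ext s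
      refine ext' _ _ _ fun x hx => ?_
      rw [hst, hD]
    cases D'; cases D; congr

end Extension

/-! ### Differential fields -/

/-- The field of constants of a differential field. -/
def constants (K : Type u) [Field K] [Differential K] : Subfield K where
  carrier := {a | a′ = 0}
  mul_mem' {a b} (ha : a′ = 0) (hb : b′ = 0) := by simp [ha, hb]
  one_mem' := by simp
  add_mem' {a b} (ha : a′ = 0) (hb : b′ = 0) := by simp [ha, hb]
  zero_mem' := by simp
  neg_mem' {a} (ha : a′ = 0) := by simp [ha]
  inv_mem' a (ha : a′ = 0) := by simp [Derivation.leibniz_inv, ha]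


/-- The derivation of `K` vanishes on the base field `C`. -/
class ConstantBase (C K : Type u) [Field C] [Field K] [Differential K] [Algebra C K] : Prop where
  deriv_algebraMap_eq_zero : ∀ c : C, (algebraMap C K c)′ = 0

instance (K L : Type u) [Field K] [Differential K] [Field L] [Differential L] [Algebra K L]
    [DifferentialAlgebra K L] : ConstantBase (constants K) L where
  deriv_algebraMap_eq_zero c := by
    have h : (c : K)′ = 0 := c.2
    change (algebraMap K L (c : K))′ = 0
    rw [deriv_algebraMap, h, map_zero]

instance (K : Type u) [Field K] [Differential K] : ConstantBase (constants K) K where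
  deriv_algebraMap_eq_zero c := c.2

/-! ### Schemes with derivation over a differential field -/

/-- The structure map from the base field to the sections of a scheme over that field. -/
noncomputable def scalar {F : Type u} [Field F] (X : Over (Spec (.of F))) (U : X.left.Opens) :
    F →+* Γ(X.left, U) :=
  (X.hom.appLE ⊤ U (le_preimage_top _ U)).hom.comp (Scheme.ΓSpecIso (.of F)).inv.hom

noncomputable instance {F : Type u} [Field F] (X : Over (Spec (.of F))) (U : X.left.Opens) :
    Algebra F Γ(X.left, U) :=
  (scalar X U).toAlgebra

theorem res_scalar {F : Type u} [Field F] (X : Over (Spec (.of F))) {U V : X.left.Opens}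
    (h : V ≤ U) (a : F) :
    X.left.presheaf.map (homOfLE h).op (scalar X U a) = scalar X V a :=
  congr($(X.hom.appLE_map (le_preimage_top _ U) (homOfLE h).op) ((Scheme.ΓSpecIso (.of F)).inv a))

theorem app_scalar {F : Type u} [Field F] {X Y : Over (Spec (.of F))} (f : X ⟶ Y)
    (U : Y.left.Opens) (a : F) :
    f.left.app U (scalar Y U a) = scalar X (f.left ⁻¹ᵁ U) a := by
  have h : Y.hom.appLE ⊤ U (le_preimage_top _ U) ≫ f.left.app U = X.hom.appLE ⊤ (f.left ⁻¹ᵁ U) (le_preimage_top _ _) := by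
    rw [← Scheme.Hom.appLE_eq_app, Scheme.Hom.appLE_comp_appLE]
    simp only [Over.w]
  exact congr($h ((Scheme.ΓSpecIso (.of F)).inv a))

/-- A scheme with derivation over a differential field `K`: a `K`-scheme with a derivation of its
structure sheaf that extends the derivation of `K`. -/
structure DiffScheme (K : Type u) [Field K] [Differential K] where
  /-- The underlying `K`-scheme. -/
  toOver : Over (Spec (.of K))
  /-- The derivation of the structure sheaf. -/
  der : SchemeDerivation toOver.left
  der_scalar : ∀ (U : toOver.left.Opens) (a : K),
    der.app U (scalar toOver U a) = scalar toOver U a′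

/-- A morphism of `K`-schemes is a morphism of schemes with derivation if it is compatible with
the derivations on sections. -/
def DiffScheme.IsDifferential {K : Type u} [Field K] [Differential K] {X Y : DiffScheme K}
    (f : X.toOver ⟶ Y.toOver) : Prop :=
  ∀ (U : Y.toOver.left.Opens) (s : Γ(Y.toOver.left, U)),
    X.der.app (f.left ⁻¹ᵁ U) (f.left.app U s) = f.left.app U (Y.der.app U s)

section DiffPoints

variable {K : Type u} [Field K] [Differential K]

/-- The set of differential points: those points that correspond to a differential prime ideal
in each affine open neighbourhood. -/
def DiffScheme.diffPoints (X : DiffScheme K) : Set X.toOver.left :=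
  {x | ∀ (U : X.toOver.left.Opens) (hU : IsAffineOpen U) (hx : x ∈ U),
    ∀ a ∈ (hU.primeIdealOf ⟨x, hx⟩).asIdeal,
      X.der.app U a ∈ (hU.primeIdealOf ⟨x, hx⟩).asIdeal}

/-- The space of differential points, with the Kolchin topology, i.e. the subspace topology. -/
abbrev DiffScheme.Diff (X : DiffScheme K) : Type u := X.diffPoints

/-- A differential point that is closed in the Kolchin topology. -/
def DiffScheme.IsClosedPoint (X : DiffScheme K) (x : X.Diff) : Prop := IsClosed ({x} : Set X.Diff)

theorem mem_primeIdealOf_iff {X : Scheme.{u}} {U : X.Opens} (hU : IsAffineOpen U) {x : X}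
    (hx : x ∈ U) (a : Γ(X, U)) :
    a ∈ (hU.primeIdealOf ⟨x, hx⟩).asIdeal ↔
      X.presheaf.germ U x hx a ∈ IsLocalRing.maximalIdeal (X.presheaf.stalk x) := by
  rw [hU.primeIdealOf_eq_map_closedPoint]
  rfl

/-- The derivation of the local ring at a point. -/
noncomputable def SchemeDerivation.stalk {X : Scheme.{u}} (D : SchemeDerivation X) (x : X) :
    Derivation ℤ (X.presheaf.stalk x) (X.presheaf.stalk x) :=
  (D.exists_stalk x).choose

theorem SchemeDerivation.stalk_germ {X : Scheme.{u}} (D : SchemeDerivation X) (x : X)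
    (U : X.Opens) (hx : x ∈ U) (s : Γ(X, U)) :
    D.stalk x (X.presheaf.germ U x hx s) = X.presheaf.germ U x hx (D.app U s) :=
  (D.exists_stalk x).choose_spec.1 U hx s

theorem DiffScheme.stalk_mem {X : DiffScheme K} {x : X.toOver.left} (hx : x ∈ X.diffPoints)
    (t : X.toOver.left.presheaf.stalk x) (ht : t ∈ IsLocalRing.maximalIdeal _) :
    X.der.stalk x t ∈ IsLocalRing.maximalIdeal _ := by
  obtain ⟨U, hxU, s, rfl⟩ := X.toOver.left.presheaf.exists_germ_eq t
  obtain ⟨V, hV, hxV, hVU⟩ := exists_isAffineOpen_mem_and_subset (X := X.toOver.left) hxU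
  rw [← X.toOver.left.presheaf.germ_res_apply (homOfLE hVU) x hxV] at ht ⊢
  rw [SchemeDerivation.stalk_germ, ← mem_primeIdealOf_iff hV hxV]
  exact hx V hV hxV _ ((mem_primeIdealOf_iff hV hxV _).mpr ht)

/-- The residue field `κ(x)` of a differential point. -/
def DiffScheme.kappa (X : DiffScheme K) (x : X.Diff) : Type u := X.toOver.left.residueField x.1

noncomputable instance (X : DiffScheme K) (x : X.Diff) : Field (X.kappa x) :=
  inferInstanceAs (Field (X.toOver.left.residueField x.1))

/-- The value of a section at a differential point. -/
noncomputable def DiffScheme.eval (X : DiffScheme K) (x : X.Diff) (U : X.toOver.left.Opens)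
    (hx : x.1 ∈ U) : Γ(X.toOver.left, U) →+* X.kappa x :=
  (X.toOver.left.evaluation U x.1 hx).hom

/-- The derivation of `κ(x)` that is induced by the derivation of the local ring. -/
noncomputable instance (X : DiffScheme K) (x : X.Diff) : Differential (X.kappa x) where
  deriv := Derivation.liftOfSurjective
    (f := (show X.toOver.left.presheaf.stalk x.1 →+* X.kappa x from
      (X.toOver.left.residue x.1).hom).toIntAlgHom)
    (X.toOver.left.residue_surjective x.1) (d := X.der.stalk x.1) (fun t ht => by
      have h := DiffScheme.stalk_mem x.2 t ((IsLocalRing.residue_eq_zero_iff t).mp ht)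
      exact (IsLocalRing.residue_eq_zero_iff _).mpr h)

theorem DiffScheme.deriv_eval (X : DiffScheme K) (x : X.Diff) (U : X.toOver.left.Opens)
    (hx : x.1 ∈ U) (s : Γ(X.toOver.left, U)) :
    (X.eval x U hx s)′ = X.eval x U hx (X.der.app U s) := by
  have := Derivation.liftOfSurjective_apply
    (f := (show X.toOver.left.presheaf.stalk x.1 →+* X.kappa x from
      (X.toOver.left.residue x.1).hom).toIntAlgHom)
    (X.toOver.left.residue_surjective x.1) (d := X.der.stalk x.1) (fun t ht => by
      have h := DiffScheme.stalk_mem x.2 t ((IsLocalRing.residue_eq_zero_iff t).mp ht)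
      exact (IsLocalRing.residue_eq_zero_iff _).mpr h)
    (X.toOver.left.presheaf.germ U x.1 hx s)
  refine this.trans ?_
  rw [SchemeDerivation.stalk_germ]
  rfl

noncomputable instance (X : DiffScheme K) (x : X.Diff) : Algebra K (X.kappa x) :=
  ((X.eval x ⊤ (TopologicalSpace.Opens.mem_top _)).comp (scalar X.toOver ⊤)).toAlgebra

instance (X : DiffScheme K) (x : X.Diff) : DifferentialAlgebra K (X.kappa x) where
  deriv_algebraMap a := by
    change (X.eval x ⊤ (TopologicalSpace.Opens.mem_top _) (scalar X.toOver ⊤ a))′ =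
      X.eval x ⊤ (TopologicalSpace.Opens.mem_top _) (scalar X.toOver ⊤ a′)
    rw [X.deriv_eval, X.der_scalar]

end DiffPoints

/-! ### Non-autonomous vector fields -/

section VectorFields

variable {C : Type u} [Field C]

/-- The regular vector fields on a `C`-scheme: the derivations of the structure sheaf that vanish
on `C`. -/
def VectorField (Y : Over (Spec (.of C))) :
    Submodule C (∀ U : Y.left.Opens, Derivation C Γ(Y.left, U) Γ(Y.left, U)) where
  carrier := {D | ∀ (U V : Y.left.Opens) (h : V ≤ U) (s : Γ(Y.left, U)),
    D V (Y.left.presheaf.map (homOfLE h).op s) = Y.left.presheaf.map (homOfLE h).op (D U s)}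
  add_mem' {D E} hD hE U V h s := by
    simp only [Pi.add_apply, Derivation.add_apply, map_add, hD U V h s, hE U V h s]
  zero_mem' U V h s := by simp
  smul_mem' c D hD U V h s := by
    simp only [Pi.smul_apply, Derivation.smul_apply, hD U V h s, Algebra.smul_def, map_mul]
    congr 1
    exact (res_scalar Y h c).symm

/-- The canonical morphism `Spec K ⟶ Spec C`. -/
noncomputable abbrev specMap (C K : Type u) [Field C] [Field K] [Algebra C K] :
    Spec (.of K) ⟶ Spec (.of C) :=
  Spec.map (CommRingCat.ofHom (algebraMap C K))

variable (K : Type u) [Field K] [Algebra C K]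

/-- The base change `Y_K = Y ×_C Spec K`. -/
noncomputable abbrev baseChange (Y : Over (Spec (.of C))) : Over (Spec (.of K)) :=
  (Over.pullback (specMap C K)).obj Y

/-- The projection `Y_K ⟶ Y`. -/
noncomputable abbrev proj (Y : Over (Spec (.of C))) : (baseChange K Y).left ⟶ Y.left :=
  pullback.fst Y.hom (specMap C K)

variable {K}

theorem scalar_baseChange (Y : Over (Spec (.of C))) (V : Y.left.Opens) (c : C) :
    scalar (baseChange K Y) (proj K Y ⁻¹ᵁ V) (algebraMap C K c) =
      (proj K Y).app V (scalar Y V c) := by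
  have h₁ : Y.hom.appLE ⊤ V (le_preimage_top _ V) ≫ (proj K Y).app V =
      (specMap C K).appTop ≫ (baseChange K Y).hom.appLE ⊤ (proj K Y ⁻¹ᵁ V) (le_preimage_top _ _) := by
    have e₁ := Scheme.Hom.appLE_comp_appLE (proj K Y) Y.hom ⊤ V (proj K Y ⁻¹ᵁ V)
      (le_preimage_top _ V) le_rfl
    have e₂ := Scheme.Hom.appLE_comp_appLE (baseChange K Y).hom (specMap C K) ⊤ ⊤
      (proj K Y ⁻¹ᵁ V) (le_preimage_top _ ⊤) (le_preimage_top _ _)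
    have e₃ : proj K Y ≫ Y.hom = (baseChange K Y).hom ≫ specMap C K := pullback.condition
    rw [← Scheme.Hom.appLE_eq_app, e₁]
    simp only [e₃]
    rw [← e₂]
    congr 1
  have h₂ := congr($(Scheme.ΓSpecIso_inv_naturality (CommRingCat.ofHom (algebraMap C K))) c)
  have h₃ := congr($h₁ ((Scheme.ΓSpecIso (.of C)).inv c))
  refine Eq.trans ?_ h₃.symm
  exact congrArg ((baseChange K Y).hom.appLE ⊤ (proj K Y ⁻¹ᵁ V) (le_preimage_top _ _)) h₂

/-- The function `∑ kᵢ · Xᵢ s` on the preimage of `V` in `Y_K`, for a section `s` over `V` and a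
non-autonomous vector field `∑ Xᵢ ⊗ kᵢ`. -/
noncomputable def vectorFieldApply (Y : Over (Spec (.of C))) (V : Y.left.Opens)
    (s : Γ(Y.left, V)) :
    VectorField Y ⊗[C] K →+ Γ((baseChange K Y).left, proj K Y ⁻¹ᵁ V) :=
  TensorProduct.liftAddHom
    (AddMonoidHom.mk' (fun X => AddMonoidHom.mk'
        (fun k => scalar (baseChange K Y) (proj K Y ⁻¹ᵁ V) k * (proj K Y).app V (X.1 V s))
        (fun k l => by rw [map_add, add_mul]))
      (fun X X' => by
        ext k
        simp only [AddMonoidHom.mk'_apply, AddMonoidHom.add_apply, Submodule.coe_add,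
          Pi.add_apply, Derivation.add_apply, map_add, mul_add]))
    (fun c X k => by
      change _ * (proj K Y).app V (c • X.1 V s) = scalar _ _ (c • k) * _
      rw [Algebra.smul_def, Algebra.smul_def, map_mul, map_mul, scalar_baseChange, mul_left_comm,
        mul_assoc]
      rfl)

theorem vectorFieldApply_tmul (Y : Over (Spec (.of C))) (V : Y.left.Opens)
    (s : Γ(Y.left, V)) (X : VectorField Y) (k : K) :
    vectorFieldApply Y V s (X ⊗ₜ k) =
      scalar (baseChange K Y) (proj K Y ⁻¹ᵁ V) k * (proj K Y).app V (X.1 V s) := rfl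

theorem vectorFieldApply_add (Y : Over (Spec (.of C))) (V : Y.left.Opens) (s t : Γ(Y.left, V))
    (A : VectorField Y ⊗[C] K) :
    vectorFieldApply Y V (s + t) A = vectorFieldApply Y V s A + vectorFieldApply Y V t A := by
  have aux {B R : Type u} [CommRing B] [CommRing R] [Algebra C B] (f : B →+* R) (r : R)
      (D : Derivation C B B) (a b : B) : r * f (D (a + b)) = r * f (D a) + r * f (D b) := by
    rw [map_add, map_add, mul_add]
  induction A with
  | zero => simp
  | tmul X k => exact aux ((proj K Y).app V).hom _ (X.1 V) s t
  | add A B hA hB =>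
    rw [map_add, map_add, map_add, hA, hB]
    exact add_add_add_comm ..

theorem vectorFieldApply_mul (Y : Over (Spec (.of C))) (V : Y.left.Opens) (a b : Γ(Y.left, V))
    (A : VectorField Y ⊗[C] K) :
    vectorFieldApply Y V (a * b) A = (proj K Y).app V a * vectorFieldApply Y V b A +
      (proj K Y).app V b * vectorFieldApply Y V a A := by
  have aux {B R : Type u} [CommRing B] [CommRing R] [Algebra C B] (f : B →+* R) (r : R)
      (D : Derivation C B B) (a b : B) :
      r * f (D (a * b)) = f a * (r * f (D b)) + f b * (r * f (D a)) := by
    rw [Derivation.leibniz, map_add, smul_eq_mul, smul_eq_mul, map_mul, map_mul]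
    ring
  have aux' {R : Type u} [CommRing R] (a b p q r s : R) :
      a * p + b * q + (a * r + b * s) = a * (p + r) + b * (q + s) := by ring
  induction A with
  | zero => simp
  | tmul X k => exact aux ((proj K Y).app V).hom _ (X.1 V) a b
  | add A B hA hB =>
    rw [map_add, map_add, map_add, hA, hB]
    exact aux' ..

theorem vectorFieldApply_res (Y : Over (Spec (.of C))) {U V : Y.left.Opens} (h : V ≤ U)
    (s : Γ(Y.left, U)) (A : VectorField Y ⊗[C] K) :
    vectorFieldApply Y V (Y.left.presheaf.map (homOfLE h).op s) A =
      (baseChange K Y).left.presheaf.map (homOfLE ((proj K Y).preimage_mono h)).op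
        (vectorFieldApply Y U s A) := by
  induction A with
  | zero => rw [map_zero, map_zero, map_zero]
  | tmul X k =>
    have h₁ := (res_scalar (baseChange K Y) ((proj K Y).preimage_mono h) k).symm
    have h₂ : (proj K Y).app V (Y.left.presheaf.map (homOfLE h).op (X.1 U s)) =
        (baseChange K Y).left.presheaf.map (homOfLE ((proj K Y).preimage_mono h)).op
          ((proj K Y).app U (X.1 U s)) :=
      congr($((proj K Y).naturality (homOfLE h).op) (X.1 U s))
    rw [vectorFieldApply_tmul, vectorFieldApply_tmul, map_mul, X.2 U V h s, h₁, h₂]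
  | add A B hA hB => rw [map_add, map_add, map_add, hA, hB]

theorem vectorFieldApply_scalar (Y : Over (Spec (.of C))) (V : Y.left.Opens) (c : C)
    (A : VectorField Y ⊗[C] K) : vectorFieldApply Y V (scalar Y V c) A = 0 := by
  induction A with
  | zero => rw [map_zero]
  | tmul X k =>
    have : X.1 V (scalar Y V c) = 0 := (X.1 V).map_algebraMap c
    rw [vectorFieldApply_tmul, this, map_zero, mul_zero]
  | add A B hA hB => rw [map_add, hA, hB, add_zero]

/-- There is exactly one derivation on `Y_K` with `a ⊗ f ↦ ∂a ⊗ f + ∑ a kᵢ ⊗ Xᵢ f`. -/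
theorem existsUnique_nonautonomous [Differential K] [ConstantBase C K] (Y : Over (Spec (.of C)))
    (A : VectorField Y ⊗[C] K) :
    ∃! D : SchemeDerivation (baseChange K Y).left,
      (∀ V s, D.app (proj K Y ⁻¹ᵁ V) ((proj K Y).app V s) = vectorFieldApply Y V s A) ∧
      ∀ U a, D.app U (scalar (baseChange K Y) U a) = scalar (baseChange K Y) U a′ := by
  let e : K ≃+* Γ(Spec (.of K), ⊤) := (Scheme.ΓSpecIso (.of K)).symm.commRingCatIsoToRingEquiv
  let e' : C ≃+* Γ(Spec (.of C), ⊤) := (Scheme.ΓSpecIso (.of C)).symm.commRingCatIsoToRingEquiv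
  let dF : Γ(Spec (.of K), ⊤) →+ Γ(Spec (.of K), ⊤) :=
    AddMonoidHom.mk' (fun z => e (e.symm z)′) (fun a b => by simp only [map_add])
  have hdF (a : K) : dF (e a) = e a′ := congrArg (fun b : K => e b′) (e.symm_apply_apply a)
  have hF (a b) : dF (a * b) = a * dF b + b * dF a := by
    obtain ⟨a, rfl⟩ := e.surjective a
    obtain ⟨b, rfl⟩ := e.surjective b
    rw [← map_mul, hdF, hdF, hdF, Derivation.leibniz, map_add, smul_eq_mul, smul_eq_mul, map_mul,
      map_mul]
  have hSF (z) : dF ((specMap C K).appLE ⊤ ⊤ (le_preimage_top _ ⊤) z) = 0 := by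
    obtain ⟨c, rfl⟩ := e'.surjective z
    have h₂ := congr($(Scheme.ΓSpecIso_inv_naturality (CommRingCat.ofHom (algebraMap C K))) c)
    have h₃ : (specMap C K).appLE ⊤ ⊤ (le_preimage_top _ ⊤) (e' c) = e (algebraMap C K c) :=
      congr($(Scheme.Hom.appLE_eq_app (specMap C K)) (e' c)).trans h₂.symm
    rw [h₃, hdF, ConstantBase.deriv_algebraMap_eq_zero, map_zero]
  have hSY (V z) : vectorFieldApply Y V (Y.hom.appLE ⊤ V (le_preimage_top _ V) z) A = 0 := by
    obtain ⟨c, rfl⟩ := e'.surjective z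
    exact vectorFieldApply_scalar Y V c A
  have key := existsUnique_schemeDerivation (IsPullback.of_hasPullback Y.hom (specMap C K))
    (fun V => AddMonoidHom.mk' (fun s => vectorFieldApply Y V s A)
      (fun s t => vectorFieldApply_add Y V s t A)) dF
    (fun V a b => vectorFieldApply_mul Y V a b A)
    (fun U V h s => vectorFieldApply_res Y h s A) hF hSY hSF
  refine (existsUnique_congr fun D => and_congr_right fun _ => forall_congr' fun U => ?_).mp key
  refine ⟨fun h a => ?_, fun h z => ?_⟩
  · have := h (e a)
    rw [hdF] at this
    exact this
  · obtain ⟨a, rfl⟩ := e.surjective z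
    rw [hdF]
    exact h a

/-- The scheme with derivation `(Y_K, ∂_A)` associated with a non-autonomous vector field
`A = ∑ Xᵢ ⊗ kᵢ`, where `∂_A (a ⊗ f) = ∂a ⊗ f + ∑ a kᵢ ⊗ Xᵢ f`. -/
noncomputable def nonautonomous [Differential K] [ConstantBase C K] (Y : Over (Spec (.of C)))
    (A : VectorField Y ⊗[C] K) : DiffScheme K where
  toOver := baseChange K Y
  der := (existsUnique_nonautonomous Y A).choose
  der_scalar := (existsUnique_nonautonomous Y A).choose_spec.1.2

end VectorFields

/-- A scheme with derivation over `K` splits if it is isomorphic to `Y ×_C (Spec K, ∂)` for a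
scheme `Y` over the field of constants `C` of `K`. -/
def DiffScheme.Splits {K : Type u} [Field K] [Differential K] (X : DiffScheme K) : Prop :=
  ∃ (Y : Over (Spec (.of (constants K)))) (φ : X.toOver ≅ (nonautonomous (K := K) Y 0).toOver),
    DiffScheme.IsDifferential φ.hom

/-! ### Automorphic systems -/

section Automorphic

variable {C : Type u} [Field C]

/-- The right translation `g ↦ g σ` by a rational point `σ ∈ G(C)`. -/
noncomputable abbrev rightTranslation (G : Over (Spec (.of C))) [GrpObj G]
    (σ : 𝟙_ (Over (Spec (.of C))) ⟶ G) : G ⟶ G :=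
  (GrpObj.mulRight σ).hom

/-- The right invariant vector fields on a group scheme over `C` (where `C` is algebraically
closed): those that are invariant under right translation by all points of `G(C)`. -/
def rightInvariant (G : Over (Spec (.of C))) [GrpObj G] : Submodule C (VectorField G) where
  carrier := {X | ∀ (σ : 𝟙_ (Over (Spec (.of C))) ⟶ G) (U : G.left.Opens) (s : Γ(G.left, U)),
    X.1 ((rightTranslation G σ).left ⁻¹ᵁ U) ((rightTranslation G σ).left.app U s) =
      (rightTranslation G σ).left.app U (X.1 U s)}
  add_mem' {X X'} h h' σ U s := by
    simp only [Submodule.coe_add, Pi.add_apply, Derivation.add_apply, map_add, h σ U s, h' σ U s]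
  zero_mem' σ U s := by simp
  smul_mem' c X h σ U s := by
    simp only [Submodule.coe_smul, Pi.smul_apply, Derivation.smul_apply, h σ U s,
      Algebra.smul_def, map_mul]
    congr 1
    exact (app_scalar (rightTranslation G σ) U c).symm

/-- The automorphic vector fields on `G` with coefficients in `K`. -/
abbrev AutomorphicField (G : Over (Spec (.of C))) [GrpObj G] (K : Type u) [Field K]
    [Algebra C K] : Type u :=
  rightInvariant G ⊗[C] K

variable {K : Type u} [Field K] [Algebra C K]

/-- An automorphic vector field with coefficients in `K`, seen with coefficients in `L`. -/
noncomputable def extendCoefficients (G : Over (Spec (.of C))) [GrpObj G]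
    (L : Type u) [Field L] [Algebra C L] [Algebra K L] [IsScalarTower C K L]
    (A : AutomorphicField G K) : AutomorphicField G L :=
  (IsScalarTower.toAlgHom C K L).toLinearMap.lTensor (rightInvariant G) A

/-- The automorphic system `(G_K, ∂_A)` of an automorphic vector field `A`. -/
noncomputable def automorphicSystem [Differential K] [ConstantBase C K]
    (G : Over (Spec (.of C))) [GrpObj G] (A : AutomorphicField G K) : DiffScheme K :=
  nonautonomous G ((rightInvariant G).subtype.rTensor K A)

/-- `L` is a splitting extension of `K` for `(G_K, ∂_A)` if `(G_L, ∂_A)` splits. -/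
def IsSplittingExtension (G : Over (Spec (.of C))) [GrpObj G] (A : AutomorphicField G K)
    (L : Type u) [Field L] [Differential L] [Algebra C L] [ConstantBase C L] [Algebra K L]
    [IsScalarTower C K L] : Prop :=
  (automorphicSystem G (extendCoefficients G L A)).Splits

/-- The right translation of points of `G_K` by `σ ∈ G(C)`. -/
noncomputable def rightTranslate [Differential K] [ConstantBase C K] (G : Over (Spec (.of C)))
    [GrpObj G] (A : AutomorphicField G K) (σ : 𝟙_ (Over (Spec (.of C))) ⟶ G)
    (x : (automorphicSystem G A).toOver.left) : (automorphicSystem G A).toOver.left :=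
  ((Over.pullback (specMap C K)).map (rightTranslation G σ)).left x

end Automorphic

end LieVessiot

/-! Let `C` be the field of constants of `K`. For a differential `K`-algebra `R`, a point `h` of `G`
with values in `R` is a solution if its logarithmic derivative is `A`. Dual numbers turn this into
an identity in the group `G(R[ε])`: the derivation of `R` is a homomorphism `flow : R → R[ε]`, and
`h` is a solution iff its image under `flow` is `tangentAt A R` times its image under the inclusion
`R → R[ε]`. The product appears because the tangent vector of a right invariant field at a point is
the right translate of its tangent vector at the identity (`pointOf_fieldPoint`). At rational points
this is the definition of invariance. It extends to all points because rational points are dense: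
`G` is reduced and locally of finite type, and `C` is algebraically closed.

For two solutions the common left factor cancels, so `h⁻¹ * h'` is a constant point
(`IsSolution.isConstantPoint`), and a constant point with values in a field is defined over the
constants of that field.

The other ingredient is differential algebra. In characteristic zero a proper differential ideal
lies in a differential prime, so a closed point of `Diff` is a maximal differential ideal in each
affine open that contains it. Its residue field is therefore the fraction field of a finitely
generated differentially simple algebra (`DiffScheme.IsClosedPoint.exists_model`). Such a field has
no new constants (`exists_constant_of_isDifferentialSimple`), and with any extension `S` that has
algebraically closed constants it has a composite whose constants are those of `S`
(`exists_composite`).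

Each `κ(x)` carries a tautological solution. In a composite with `S` it differs from a solution over
`S` by a right factor defined over the constants of `S` (`exists_comp_solutionAt_eq`). If `S` is the
residue field of another closed point, this factor lies in `G(C)` and its right translation moves
one point to the other, which gives transitivity and the isomorphism of residue fields. If `S` is a
splitting field, it contains a solution that comes from a rational point of the constant model;
after multiplication by the factor this solution forces the image of `κ(x)` into `S`.

A solution `h` over a field `L` without new constants splits the system through `g ↦ h⁻¹ g`: by the
same cancellation, applied to the tautological points of `G_L`, functions on `G` are pulled back to
functions killed by the derivation. Finally, closed points exist because `Diff` is a nonempty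
noetherian space. -/

namespace LieVessiot

/-! ### Differential ideals -/

section DifferentialIdeals

variable {R : Type*} [CommRing R] [Differential R]

/-- An ideal that is stable under the derivation. -/
def IsDifferentialIdeal (I : Ideal R) : Prop := ∀ a ∈ I, a′ ∈ I

/-- The derivation of the quotient by a differential ideal. -/
noncomputable abbrev quotientDifferential {I : Ideal R} (hI : IsDifferentialIdeal I) :
    Differential (R ⧸ I) where
  deriv := Derivation.liftOfSurjective (f := (Ideal.Quotient.mk I).toIntAlgHom)
    Ideal.Quotient.mk_surjective (d := Differential.deriv) (fun x hx => by
      have hx' : x ∈ I := Ideal.Quotient.eq_zero_iff_mem.mp hx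
      exact Ideal.Quotient.eq_zero_iff_mem.mpr (hI x hx'))

theorem quotientDifferential_mk {I : Ideal R} (hI : IsDifferentialIdeal I) (a : R) :
    (quotientDifferential hI).deriv (Ideal.Quotient.mk I a) = Ideal.Quotient.mk I a′ :=
  Derivation.liftOfSurjective_apply (f := (Ideal.Quotient.mk I).toIntAlgHom)
    Ideal.Quotient.mk_surjective (d := Differential.deriv) (fun x hx => by
      have hx' : x ∈ I := Ideal.Quotient.eq_zero_iff_mem.mp hx
      exact Ideal.Quotient.eq_zero_iff_mem.mpr (hI x hx')) a

/-- A differential ring is simple if it is nonzero and has no nontrivial differential ideals. -/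
structure IsDifferentialSimple (R : Type*) [CommRing R] [Differential R] : Prop where
  nontrivial : Nontrivial R
  eq_bot_or_eq_top : ∀ I : Ideal R, IsDifferentialIdeal I → I = ⊥ ∨ I = ⊤

/-- Zorn's lemma: the union of a chain of proper differential ideals is again proper and
differential. -/
theorem exists_maximal_differentialIdeal {I : Ideal R} (hI : IsDifferentialIdeal I) (h : I ≠ ⊤) :
    ∃ P : Ideal R, I ≤ P ∧ IsDifferentialIdeal P ∧ P ≠ ⊤ ∧
      ∀ J : Ideal R, IsDifferentialIdeal J → P ≤ J → J = P ∨ J = ⊤ := by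
  obtain ⟨P, hIP, hP⟩ := zorn_le_nonempty₀ {J : Ideal R | IsDifferentialIdeal J ∧ J ≠ ⊤} (by
    intro c hc hchain y hy
    refine ⟨sSup c, ⟨fun a ha => ?_, fun htop => ?_⟩, fun z hz => le_sSup hz⟩
    · obtain ⟨J, hJ, haJ⟩ := (Submodule.mem_sSup_of_directed ⟨y, hy⟩ hchain.directedOn).mp ha
      exact (Submodule.mem_sSup_of_directed ⟨y, hy⟩ hchain.directedOn).mpr
        ⟨J, hJ, (hc hJ).1 a haJ⟩
    · have h1 : (1 : R) ∈ sSup c := htop ▸ Submodule.mem_top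
      obtain ⟨J, hJ, haJ⟩ := (Submodule.mem_sSup_of_directed ⟨y, hy⟩ hchain.directedOn).mp h1
      exact (hc hJ).2 ((Ideal.eq_top_iff_one J).mpr haJ)) I ⟨hI, h⟩
  refine ⟨P, hIP, hP.prop.1, hP.prop.2, fun J hJ hPJ => ?_⟩
  by_cases hJt : J = ⊤
  · exact Or.inr hJt
  · exact Or.inl (le_antisymm (hP.le_of_ge ⟨hJ, hJt⟩ hPJ) hPJ)

theorem isDifferentialSimple_quotient {P : Ideal R} (hP : IsDifferentialIdeal P) (hne : P ≠ ⊤)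
    (hmax : ∀ J : Ideal R, IsDifferentialIdeal J → P ≤ J → J = P ∨ J = ⊤) :
    letI := quotientDifferential hP
    IsDifferentialSimple (R ⧸ P) := by
  let := quotientDifferential hP
  refine ⟨Ideal.Quotient.nontrivial_iff.mpr hne, fun I hI => ?_⟩
  have hc : IsDifferentialIdeal (I.comap (Ideal.Quotient.mk P)) := by
    intro a ha
    have := hI _ (Ideal.mem_comap.mp ha)
    rw [quotientDifferential_mk] at this
    exact this
  have hle : P ≤ I.comap (Ideal.Quotient.mk P) := by
    intro a ha
    rw [Ideal.mem_comap, Ideal.Quotient.eq_zero_iff_mem.mpr ha]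
    exact I.zero_mem
  have hmap := Ideal.map_comap_of_surjective (Ideal.Quotient.mk P)
    Ideal.Quotient.mk_surjective I
  rcases hmax _ hc hle with h | h
  · left
    rw [← hmap, h, Ideal.map_quotient_self]
  · right
    rw [← hmap, h, Ideal.map_top]

/-- Powers of `a` are traded for powers of `a′`. Differentiating `a ^ (m + 1) * a′ ^ k = 0` and
multiplying by `a′` gives `(m + 1) * a ^ m * a′ ^ (k + 2) = 0`, since the term with `a′′` contains
the original product; then `m + 1` is cancelled. -/
theorem isNilpotent_deriv (hQ : ∀ n : ℕ, n ≠ 0 → IsUnit (n : R)) {a : R} (ha : IsNilpotent a) :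
    IsNilpotent a′ := by
  have key : ∀ m k : ℕ, a ^ m * a′ ^ k = 0 → IsNilpotent a′ := by
    intro m
    induction m with
    | zero => exact fun k hk => ⟨k, by simpa using hk⟩
    | succ m ih =>
      intro k hk
      refine ih (k + 2) ?_
      have h1 := congrArg Differential.deriv hk
      rw [map_zero, Derivation.leibniz, Derivation.leibniz_pow _ a, Nat.add_sub_cancel, nsmul_eq_mul,
        smul_eq_mul, smul_eq_mul, smul_eq_mul] at h1
      have h2 : a′ * Differential.deriv (a′ ^ k) = k * a′ ^ k * a′′ := by
        rw [Derivation.leibniz_pow, nsmul_eq_mul, smul_eq_mul]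
        cases k with
        | zero => simp
        | succ k => rw [Nat.add_sub_cancel]; ring
      have h3 : ((m + 1 : ℕ) : R) * (a ^ m * a′ ^ (k + 2)) = 0 := by
        have : ((m + 1 : ℕ) : R) * (a ^ m * a′ ^ (k + 2)) =
            a′ * (a ^ (m + 1) * Differential.deriv (a′ ^ k) +
              a′ ^ k * (((m + 1 : ℕ) : R) * (a ^ m * a′))) -
            a ^ (m + 1) * (a′ * Differential.deriv (a′ ^ k)) := by ring
        rw [this, h1, h2]
        have : a ^ (m + 1) * (k * a′ ^ k * a′′) = k * a′′ * (a ^ (m + 1) * a′ ^ k) := by ring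
        rw [this, hk]
        simp
      exact ((hQ _ m.succ_ne_zero).mul_right_eq_zero).mp h3
  obtain ⟨n, hn⟩ := ha
  exact key n 0 (by rw [hn, zero_mul])

/-- The nilradical is a differential ideal, hence zero. In a reduced ring the annihilator of `a` is
differential too: `x * a = 0` gives `(x′ * a) ^ 2 = 0`. So it is `⊥` or `⊤`, and `a` is a
non-zero-divisor or zero. -/
theorem IsDifferentialSimple.isDomain (h : IsDifferentialSimple R)
    (hQ : ∀ n : ℕ, n ≠ 0 → IsUnit (n : R)) : IsDomain R := by
  have := h.nontrivial
  have hnil : ∀ a : R, IsNilpotent a → a = 0 := by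
    have hd : IsDifferentialIdeal (nilradical R) := fun a ha =>
      mem_nilradical.mpr (isNilpotent_deriv hQ (mem_nilradical.mp ha))
    rcases h.eq_bot_or_eq_top _ hd with h0 | h0
    · intro a ha
      have : a ∈ nilradical R := mem_nilradical.mpr ha
      rwa [h0] at this
    · have h1 : (1 : R) ∈ nilradical R := h0 ▸ Submodule.mem_top
      obtain ⟨n, hn⟩ := mem_nilradical.mp h1
      rw [one_pow] at hn
      exact absurd hn one_ne_zero
  have : NoZeroDivisors R := by
    refine ⟨fun {a b} hab => ?_⟩
    by_contra! hne
    have hd : IsDifferentialIdeal (Ideal.span {a}).annihilator := by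
      intro x hx
      rw [Submodule.mem_annihilator_span_singleton, smul_eq_mul] at hx ⊢
      have h1 := congrArg Differential.deriv hx
      rw [map_zero, Derivation.leibniz, smul_eq_mul, smul_eq_mul] at h1
      apply hnil
      refine ⟨2, ?_⟩
      have : (x′ * a) ^ 2 = x′ * a * (x * a′ + a * x′) - x′ * a′ * (x * a) := by ring
      rw [this, h1, hx]
      simp
    rcases h.eq_bot_or_eq_top _ hd with h0 | h0
    · have : b ∈ (Ideal.span {a}).annihilator := by
        rw [Submodule.mem_annihilator_span_singleton, smul_eq_mul, mul_comm, hab]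
      rw [h0] at this
      exact hne.2 this
    · have : (1 : R) ∈ (Ideal.span {a}).annihilator := h0 ▸ Submodule.mem_top
      rw [Submodule.mem_annihilator_span_singleton, smul_eq_mul, one_mul] at this
      exact hne.1 this
  exact NoZeroDivisors.to_isDomain R

/-- In a ring that contains `ℚ` every proper differential ideal is contained in a differential
prime ideal that is maximal among the proper differential ideals. -/
theorem exists_prime_differentialIdeal (hQ : ∀ n : ℕ, n ≠ 0 → IsUnit (n : R)) {I : Ideal R}
    (hI : IsDifferentialIdeal I) (h : I ≠ ⊤) :
    ∃ P : Ideal R, I ≤ P ∧ P.IsPrime ∧ IsDifferentialIdeal P ∧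
      ∀ J : Ideal R, IsDifferentialIdeal J → P ≤ J → J = P ∨ J = ⊤ := by
  obtain ⟨P, hIP, hP, hne, hmax⟩ := exists_maximal_differentialIdeal hI h
  let := quotientDifferential hP
  have hdom := (isDifferentialSimple_quotient hP hne hmax).isDomain (fun n hn => by
    have := (hQ n hn).map (Ideal.Quotient.mk P)
    rwa [map_natCast] at this)
  exact ⟨P, hIP, (Ideal.Quotient.isDomain_iff_prime P).mp hdom, hP, hmax⟩

end DifferentialIdeals

theorem isUnit_natCast_of_algebra (K : Type*) {R : Type*} [Field K] [CharZero K] [CommRing R]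
    [Algebra K R] (n : ℕ) (hn : n ≠ 0) : IsUnit (n : R) := by
  have : IsUnit (n : K) := (Nat.cast_ne_zero.mpr hn).isUnit
  have := this.map (algebraMap K R)
  rwa [map_natCast] at this

/-- A derivation of a domain extends to a field of fractions. -/
theorem exists_differential_fractionRing (B : Type u) [CommRing B] [IsDomain B] [Differential B]
    (L : Type u) [Field L] [Algebra B L] [IsFractionRing B L] :
    ∃ D : Differential L, ∀ b : B, D.deriv (algebraMap B L b) = algebraMap B L b′ := by
  -- The trivial pushout `B ⊗_B B = B` brings the fraction field under `exists_derivation`, which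
  -- treats localizations of pushouts.
  have h : IsPushout (𝟙 (CommRingCat.of B)) (𝟙 (CommRingCat.of B)) (𝟙 (CommRingCat.of B))
      (𝟙 (CommRingCat.of B)) := IsPushout.of_id_fst
  let d : B →+ L :=
    (algebraMap B L).toAddMonoidHom.comp (Differential.deriv : Derivation ℤ B B).toLinearMap.toAddMonoidHom
  have hd (a b : B) : d (a * b) = algebraMap B L a * d b + algebraMap B L b * d a := by
    change algebraMap B L (a * b)′ = _ * algebraMap B L b′ + _ * algebraMap B L a′
    rw [Derivation.leibniz, map_add, smul_eq_mul, smul_eq_mul, map_mul, map_mul]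
  obtain ⟨δ, hδ, -⟩ := exists_derivation (R := CommRingCat.of B) h (T := L) (nonZeroDivisors B) d d
    hd hd (fun _ => rfl)
  exact ⟨⟨δ⟩, hδ⟩

/-! ### Constants -/

open Polynomial in
/-- If `c` is transcendental over `K` in a finitely generated domain `B`, then `c - e` is not
invertible for almost all `e ∈ K`. -/
theorem exists_polynomial_not_isUnit {K B : Type*} [Field K] [CommRing B] [IsDomain B]
    [Algebra K B] [Algebra.FiniteType K B] {c : B} (hc : Transcendental K c) :
    ∃ f : K[X], f ≠ 0 ∧ ∀ e : K, f.eval e ≠ 0 → ¬ IsUnit (c - algebraMap K B e) := by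
  let φ : K[X] →ₐ[K] B := aeval c
  have hφ : Function.Injective φ := transcendental_iff_injective.mp hc
  have hfin : φ.toRingHom.FinitePresentation := by
    -- `K[X]` is noetherian, so Chevalley's theorem applies to `Spec B → Spec K[X]`: its image is
    -- constructible, and it contains the generic point because `φ` is injective.
    rw [← RingHom.FinitePresentation.of_finiteType]
    have h1 : (φ.toRingHom.comp (algebraMap K K[X])).FiniteType := by
      have : φ.toRingHom.comp (algebraMap K K[X]) = algebraMap K B := φ.comp_algebraMap
      rw [this]
      exact RingHom.finiteType_algebraMap.mpr inferInstance
    exact RingHom.FiniteType.of_comp_finiteType h1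
  obtain ⟨S, hS⟩ := PrimeSpectrum.exists_constructibleSetData_iff.mpr
    (PrimeSpectrum.isConstructible_range_comap hfin)
  have hbot : (⊥ : PrimeSpectrum K[X]) ∈ S.toSet := by
    rw [hS]
    refine ⟨⊥, PrimeSpectrum.ext ?_⟩
    change Ideal.comap φ.toRingHom ⊥ = ⊥
    rw [← RingHom.ker_eq_comap_bot]
    exact (RingHom.injective_iff_ker_eq_bot _).mp hφ
  -- A locally closed piece through the generic point has no nontrivial closed condition, so it is
  -- the nonvanishing locus of `T.f`. Outside the roots of `T.f`, the point `X = e` therefore lifts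
  -- to a prime of `B` that contains `c - e`.
  obtain ⟨T, hTS, hT⟩ := Set.mem_iUnion₂.mp hbot
  obtain ⟨hT1, hT2⟩ := hT
  have hg : ∀ i, T.g i = 0 := fun i => by
    have := PrimeSpectrum.mem_zeroLocus _ _ |>.mp hT1 ⟨i, rfl⟩
    exact this
  have hf : T.f ≠ 0 := fun h0 => hT2 (by
    rw [PrimeSpectrum.mem_zeroLocus, Set.singleton_subset_iff, h0]
    exact Ideal.zero_mem _)
  refine ⟨T.f, hf, fun e he hu => ?_⟩
  have hprime : (Ideal.span {X - C e} : Ideal K[X]).IsPrime :=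
    (Ideal.span_singleton_prime (X_sub_C_ne_zero e)).mpr (prime_X_sub_C e)
  have hmem : (⟨Ideal.span {X - C e}, hprime⟩ : PrimeSpectrum K[X]) ∈ S.toSet := by
    refine Set.mem_iUnion₂.mpr ⟨T, hTS, ?_, ?_⟩
    · rw [PrimeSpectrum.mem_zeroLocus]
      rintro _ ⟨i, rfl⟩
      rw [hg i]
      exact Ideal.zero_mem _
    · rw [PrimeSpectrum.mem_zeroLocus, Set.singleton_subset_iff]
      intro hmem
      exact he (dvd_iff_isRoot.mp (Ideal.mem_span_singleton.mp hmem))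
  rw [hS] at hmem
  obtain ⟨Q, hQ⟩ := hmem
  have h1 : X - C e ∈ (PrimeSpectrum.comap φ.toRingHom Q).asIdeal := by
    rw [hQ]
    exact Ideal.mem_span_singleton_self _
  have h2 : c - algebraMap K B e ∈ Q.asIdeal := by
    have : φ (X - C e) ∈ Q.asIdeal := h1
    simpa [φ] using this
  exact Q.2.ne_top (Ideal.eq_top_of_isUnit_mem _ h2 hu)

open Polynomial in
/-- A constant that is algebraic over a differential field with algebraically closed field of
constants is a constant of that field. -/
theorem constant_of_isAlgebraic {K L : Type u} [Field K] [Differential K]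
    [IsAlgClosed (constants K)] [Field L] [Differential L] [Algebra K L] [DifferentialAlgebra K L]
    {c : L} (hc : c′ = 0) (halg : IsAlgebraic K c) : ∃ a : constants K, algebraMap K L a = c := by
  have hint : IsIntegral K c := halg.isIntegral
  set p := minpoly K c with hp
  have hmonic : p.Monic := minpoly.monic hint
  -- Since `c′ = 0`, differentiating `p(c) = 0` shows that the polynomial with differentiated
  -- coefficients also kills `c`. Its degree is smaller because `p` is monic, so it vanishes and `p`
  -- has constant coefficients.
  have h1 : aeval c (Differential.mapCoeffs p) = 0 := by
    have := Differential.deriv_aeval_eq c p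
    rw [hc, mul_zero, add_zero, minpoly.aeval, map_zero] at this
    exact this.symm
  have h2 : Differential.mapCoeffs p = 0 := by
    by_contra hne
    have hle := minpoly.degree_le_of_ne_zero K c hne h1
    rw [← hp] at hle
    have hlt : (Differential.mapCoeffs p).degree < p.degree := by
      refine (degree_lt_iff_coeff_zero _ _).mpr (fun m hm => ?_) |>.trans_eq
        (degree_eq_natDegree hmonic.ne_zero).symm
      rw [Differential.coeff_mapCoeffs]
      rcases hm.eq_or_lt with h | h
      · rw [← h]
        have : p.coeff p.natDegree = 1 := hmonic
        rw [this, Derivation.map_one_eq_zero]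
      · rw [coeff_eq_zero_of_natDegree_lt h, map_zero]
    exact absurd hle (not_le.mpr hlt)
  have hlift : p ∈ Polynomial.lifts (algebraMap (constants K) K) := by
    rw [lifts_iff_coeff_lifts]
    intro n
    have : (p.coeff n)′ = 0 := by rw [← Differential.coeff_mapCoeffs, h2, coeff_zero]
    exact ⟨⟨p.coeff n, this⟩, rfl⟩
  obtain ⟨q, hq⟩ := hlift
  -- The polynomial `q` over the algebraically closed constants splits, so its irreducible image `p`
  -- is linear.
  have hsplit : p.Splits := by
    rw [← hq]
    exact (IsAlgClosed.splits q).map _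
  have hirr : Irreducible p := minpoly.irreducible hint
  have hdeg : p.degree = 1 := hsplit.degree_eq_one_of_irreducible hirr
  have hqdeg : q.degree = 1 := by
    have hqp : q.map (algebraMap (constants K) K) = p := hq
    rw [← hdeg, ← hqp, degree_map]
  obtain ⟨a, ha⟩ := exists_root_of_degree_eq_one hqdeg
  refine ⟨a, ?_⟩
  have hr : p.IsRoot (a : K) := by
    have hqp : q.map (algebraMap (constants K) K) = p := hq
    rw [← hqp]
    exact ha.map
  have hpe : p = X - C (a : K) := by
    have := (monic_X_sub_C (a : K))
    exact (eq_of_monic_of_dvd_of_natDegree_le this hmonic (dvd_iff_isRoot.mpr hr)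
      (by rw [natDegree_X_sub_C, natDegree_eq_of_degree_eq_some hdeg]; rfl))
  have := minpoly.aeval K c
  rw [← hp, hpe] at this
  simp only [map_sub, aeval_X, aeval_C] at this
  exact (sub_eq_zero.mp this).symm

/-- The field of fractions of a finitely generated simple differential algebra over a differential
field with algebraically closed field of constants has no new constants. -/
theorem exists_constant_of_isDifferentialSimple {K B L : Type u} [Field K] [CharZero K]
    [Differential K] [IsAlgClosed (constants K)] [CommRing B] [IsDomain B] [Algebra K B]
    [Algebra.FiniteType K B] [Differential B] [DifferentialAlgebra K B]
    (hB : IsDifferentialSimple B) [Field L] [Differential L] [Algebra B L] [Algebra K L]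
    [IsScalarTower K B L] [DifferentialAlgebra B L] [DifferentialAlgebra K L] [IsFractionRing B L]
    {c : L} (hc : c′ = 0) : ∃ a : constants K, algebraMap K L a = c := by
  have hinj : Function.Injective (algebraMap B L) := IsFractionRing.injective B L
  -- The denominators of `c` form an ideal that is differential because `c′ = 0`. It is nonzero, so
  -- simplicity puts `1` in it and `c` lies in `B`.
  obtain ⟨b, rfl⟩ : ∃ b : B, algebraMap B L b = c := by
    let I : Ideal B :=
      { carrier := {a | ∃ b, algebraMap B L b = algebraMap B L a * c}
        add_mem' := by
          rintro a a' ⟨b, hb⟩ ⟨b', hb'⟩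
          exact ⟨b + b', by rw [map_add, map_add, hb, hb', add_mul]⟩
        zero_mem' := ⟨0, by simp⟩
        smul_mem' := by
          rintro x a ⟨b, hb⟩
          exact ⟨x * b, by rw [smul_eq_mul, map_mul, map_mul, hb, mul_assoc]⟩ }
    have hI : IsDifferentialIdeal I := by
      rintro a ⟨b, hb⟩
      refine ⟨b′, ?_⟩
      have := congrArg Differential.deriv hb
      rw [Derivation.leibniz, hc, smul_zero, zero_add, deriv_algebraMap, deriv_algebraMap,
        smul_eq_mul, mul_comm] at this
      exact this
    rcases hB.eq_bot_or_eq_top I hI with h | h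
    · obtain ⟨x, y, hy, hxy⟩ := IsFractionRing.div_surjective (A := B) c
      have hy0 : algebraMap B L y ≠ 0 :=
        IsLocalization.to_map_ne_zero_of_mem_nonZeroDivisors L le_rfl hy
      have : y ∈ I := ⟨x, by rw [← hxy, mul_div_cancel₀ _ hy0]⟩
      rw [h] at this
      exact absurd this (nonZeroDivisors.ne_zero hy)
    · obtain ⟨b, hb⟩ : (1 : B) ∈ I := h ▸ Submodule.mem_top
      exact ⟨b, by rw [hb, map_one, one_mul]⟩
  have hb : b′ = 0 := hinj (by rw [← deriv_algebraMap, hc, map_zero])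
  -- Both `b` and `e` are constants, so the ideal generated by `b - e` is differential.
  have hunit (e : constants K) : b - algebraMap K B e = 0 ∨ IsUnit (b - algebraMap K B e) := by
    have he : ((e : K))′ = 0 := e.2
    have hd : IsDifferentialIdeal (Ideal.span {b - algebraMap K B e}) := by
      intro a ha
      obtain ⟨x, rfl⟩ := Ideal.mem_span_singleton'.mp ha
      rw [Derivation.leibniz, map_sub, hb, deriv_algebraMap, he, map_zero, sub_zero, smul_zero,
        zero_add]
      exact Ideal.mem_span_singleton'.mpr ⟨x′, by rw [smul_eq_mul, mul_comm]⟩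
    rcases hB.eq_bot_or_eq_top _ hd with h | h
    · exact Or.inl (Ideal.span_singleton_eq_bot.mp h)
    · exact Or.inr (Ideal.span_singleton_eq_top.mp h)
  by_cases halg : IsAlgebraic K b
  · exact constant_of_isAlgebraic hc halg.algebraMap
  -- If `b` is transcendental, `b - e` is a nonunit for all but finitely many `e`. There are
  -- infinitely many constants, so some `e` is not exceptional, and the dichotomy leaves `b = e`.
  · obtain ⟨f, hf, hf'⟩ := exists_polynomial_not_isUnit (K := K) (B := B) halg
    have hinf : Infinite (constants K) := IsAlgClosed.instInfinite
    have hfin : {e : constants K | f.eval (e : K) = 0}.Finite := by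
      refine Set.Finite.preimage (Subtype.val_injective.injOn) (s := {x : K | f.eval x = 0}) ?_
      refine (f.rootSet_finite K).subset fun x hx => ?_
      rw [Polynomial.mem_rootSet]
      exact ⟨hf, by simpa using hx⟩
    obtain ⟨e, he⟩ := hfin.exists_notMem
    rcases hunit e with h | h
    · exact ⟨e, by rw [sub_eq_zero.mp h, ← IsScalarTower.algebraMap_apply]⟩
    · exact absurd h (hf' e he)

/-! ### Composites of differential fields -/

/-- The derivation of a tensor product of differential algebras. -/
theorem exists_differential_tensorProduct (K S B : Type u) [CommRing K] [Differential K]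
    [CommRing S] [Differential S] [Algebra K S] [DifferentialAlgebra K S] [CommRing B]
    [Differential B] [Algebra K B] [DifferentialAlgebra K B] :
    ∃ D : Differential (S ⊗[K] B), (∀ s : S, D.deriv (s ⊗ₜ 1) = s′ ⊗ₜ 1) ∧
      ∀ b : B, D.deriv (1 ⊗ₜ b) = 1 ⊗ₜ b′ := by
  have h := CommRingCat.isPushout_tensorProduct K S B
  let iS : S →+* S ⊗[K] B := Algebra.TensorProduct.includeLeftRingHom
  let iB : B →+* S ⊗[K] B := Algebra.TensorProduct.includeRight.toRingHom
  let dS : S →+ S ⊗[K] B :=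
    iS.toAddMonoidHom.comp (Differential.deriv : Derivation ℤ S S).toLinearMap.toAddMonoidHom
  let dB : B →+ S ⊗[K] B :=
    iB.toAddMonoidHom.comp (Differential.deriv : Derivation ℤ B B).toLinearMap.toAddMonoidHom
  have hS (a b : S) : dS (a * b) = iS a * dS b + iS b * dS a := by
    change iS (a * b)′ = _ * iS b′ + _ * iS a′
    rw [Derivation.leibniz, map_add, smul_eq_mul, smul_eq_mul, map_mul, map_mul]
  have hB (a b : B) : dB (a * b) = iB a * dB b + iB b * dB a := by
    change iB (a * b)′ = _ * iB b′ + _ * iB a′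
    rw [Derivation.leibniz, map_add, smul_eq_mul, smul_eq_mul, map_mul, map_mul]
  -- No elements are inverted here: the tensor product is its own localization at the trivial
  -- submonoid.
  have : IsLocalization (⊥ : Submonoid (S ⊗[K] B)) (S ⊗[K] B) :=
    IsLocalization.of_le_isUnit bot_le
  obtain ⟨δ, h1, h2⟩ := exists_derivation h (T := S ⊗[K] B) (⊥ : Submonoid (S ⊗[K] B)) dS dB
    hS hB (fun z => by
      change iS (algebraMap K S z)′ = iB (algebraMap K B z)′
      rw [deriv_algebraMap, deriv_algebraMap]
      exact Algebra.TensorProduct.algebraMap_apply' z′)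
  exact ⟨⟨δ⟩, h1, h2⟩

/-- A homomorphism of fields is differential if it is so on a ring whose field of fractions is
the source. -/
theorem map_deriv_of_isFractionRing {B L M : Type*} [CommRing B] [Field L] [Field M]
    [Algebra B L] [IsFractionRing B L] [Differential L] [Differential M] (f : L →+* M)
    (h : ∀ b : B, f (algebraMap B L b)′ = (f (algebraMap B L b))′) (x : L) : f x′ = (f x)′ := by
  obtain ⟨a, b, -, rfl⟩ := IsFractionRing.div_surjective (A := B) x
  rw [Derivation.leibniz_div, map_div₀, Derivation.leibniz_div]
  simp only [smul_eq_mul, map_mul, map_pow, map_sub, map_inv₀, h]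

/-- A differential field extension `L` of `K` that is the field of fractions of a finitely
generated simple differential `K`-algebra and an extension `S` with algebraically closed field of
constants are contained in an extension without new constants over `S`. -/
theorem exists_composite {K B L S : Type u} [Field K] [CharZero K] [Differential K] [CommRing B]
    [Algebra K B] [Algebra.FiniteType K B] [Differential B] [DifferentialAlgebra K B]
    (hB : IsDifferentialSimple B) [Field L] [Differential L] [Algebra B L] [Algebra K L]
    [IsScalarTower K B L] [DifferentialAlgebra B L] [IsFractionRing B L]
    [Field S] [Differential S] [Algebra K S] [DifferentialAlgebra K S]
    [IsAlgClosed (constants S)] :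
    ∃ (M : Type u) (_ : Field M) (_ : Differential M) (f : L →+* M) (g : S →+* M),
      f.comp (algebraMap K L) = g.comp (algebraMap K S) ∧
      (∀ x, f x′ = (f x)′) ∧ (∀ x, g x′ = (g x)′) ∧
      ∀ c : M, c′ = 0 → ∃ a : constants S, g a = c := by
  obtain ⟨D, hDS, hDB⟩ := exists_differential_tensorProduct K S B
  have := hB.nontrivial
  have : CharZero S := charZero_of_injective_algebraMap (algebraMap K S).injective
  have hbot : IsDifferentialIdeal (⊥ : Ideal (S ⊗[K] B)) := by
    rintro a rfl
    rw [map_zero]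
    exact Ideal.zero_mem _
  -- A maximal differential ideal `P` of `S ⊗ B` makes the quotient differentially simple. The
  -- composite is the fraction field of this quotient.
  obtain ⟨P, -, hprime, hP, hmax⟩ := exists_prime_differentialIdeal
    (isUnit_natCast_of_algebra S) hbot bot_ne_top
  let : Differential ((S ⊗[K] B) ⧸ P) := quotientDifferential hP
  have hsimple : IsDifferentialSimple ((S ⊗[K] B) ⧸ P) :=
    isDifferentialSimple_quotient hP hprime.ne_top hmax
  obtain ⟨M, _, _, _⟩ : ∃ (M : Type u) (_ : Field M) (_ : Algebra ((S ⊗[K] B) ⧸ P) M),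
      IsFractionRing ((S ⊗[K] B) ⧸ P) M :=
    ⟨FractionRing ((S ⊗[K] B) ⧸ P), inferInstance, inferInstance, inferInstance⟩
  obtain ⟨D', hD'⟩ := exists_differential_fractionRing ((S ⊗[K] B) ⧸ P) M
  let g₀ : S →+* (S ⊗[K] B) ⧸ P :=
    (Ideal.Quotient.mk P).comp Algebra.TensorProduct.includeLeftRingHom
  let f₀ : B →+* (S ⊗[K] B) ⧸ P :=
    (Ideal.Quotient.mk P).comp Algebra.TensorProduct.includeRight.toRingHom
  have hg₀ (s : S) : g₀ s′ = (g₀ s)′ := by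
    refine Eq.trans ?_ (quotientDifferential_mk hP _).symm
    exact congrArg (Ideal.Quotient.mk P) (hDS s).symm
  have hf₀ (b : B) : f₀ b′ = (f₀ b)′ := by
    refine Eq.trans ?_ (quotientDifferential_mk hP _).symm
    exact congrArg (Ideal.Quotient.mk P) (hDB b).symm
  have hfg : f₀.comp (algebraMap K B) = g₀.comp (algebraMap K S) := by
    ext k
    exact congrArg (Ideal.Quotient.mk P) (Algebra.TensorProduct.algebraMap_apply' k).symm
  -- The kernel is a differential ideal of the simple ring `B`, so `f₀` extends to the fraction
  -- field `L`.
  have hinj : Function.Injective f₀ := by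
    rw [RingHom.injective_iff_ker_eq_bot]
    have hd : IsDifferentialIdeal (RingHom.ker f₀) := by
      intro a ha
      rw [RingHom.mem_ker] at ha ⊢
      rw [hf₀, ha, map_zero]
    refine (hB.eq_bot_or_eq_top _ hd).resolve_right (RingHom.ker_ne_top f₀)
  let ι : (S ⊗[K] B) ⧸ P →+* M := algebraMap _ _
  have hι : Function.Injective ι := IsFractionRing.injective _ _
  let f : L →+* M := IsFractionRing.lift (g := ι.comp f₀) (hι.comp hinj)
  have hf (b : B) : f (algebraMap B L b) = ι (f₀ b) := IsFractionRing.lift_algebraMap _ b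
  have hDι (q : (S ⊗[K] B) ⧸ P) : (ι q)′ = ι q′ := hD' q
  refine ⟨M, inferInstance, D', f, ι.comp g₀, ?_, ?_, ?_, ?_⟩
  · ext k
    change f (algebraMap K L k) = ι (g₀ (algebraMap K S k))
    rw [IsScalarTower.algebraMap_apply K B L, hf]
    exact congrArg ι congr($hfg k)
  · refine map_deriv_of_isFractionRing (B := B) f fun b => ?_
    rw [deriv_algebraMap, hf, hf, hDι, hf₀]
  · intro x
    exact (congrArg ι (hg₀ x)).trans (hDι _).symm
  -- The quotient is simple and finitely generated over `S`, so the statement on constants applies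
  -- with `S` as the base field.
  · intro c hc
    let : Algebra S M := (ι.comp g₀).toAlgebra
    have : DifferentialAlgebra S ((S ⊗[K] B) ⧸ P) := ⟨fun s => (hg₀ s).symm⟩
    have : DifferentialAlgebra ((S ⊗[K] B) ⧸ P) M := ⟨hDι⟩
    have : IsScalarTower S ((S ⊗[K] B) ⧸ P) M := IsScalarTower.of_algebraMap_eq fun _ => rfl
    have : DifferentialAlgebra S M := ⟨fun s => by
      change (ι (g₀ s))′ = ι (g₀ s′)
      rw [hDι, hg₀]⟩
    exact exists_constant_of_isDifferentialSimple (K := S) hsimple hc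

/-! ### Homomorphisms to dual numbers -/

section Dual

variable {C A R R' : Type*} [CommRing C] [CommRing A] [CommRing R] [CommRing R'] [Algebra C A]
  [Algebra C R] [Algebra C R']

/-- The homomorphism to the dual numbers given by a homomorphism and a derivation along it. -/
noncomputable def dualAlgHom (ρ : A →ₐ[C] R) (d : A →+ R)
    (hd : ∀ a b, d (a * b) = ρ a * d b + ρ b * d a) (h0 : ∀ c, d (algebraMap C A c) = 0) :
    A →ₐ[C] DualNumber R where
  __ := dualHom ρ.toRingHom d hd
  commutes' c := TrivSqZeroExt.ext (ρ.commutes c) (h0 c)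

/-- The functoriality of dual numbers. -/
noncomputable def dualMap (ψ : R →ₐ[C] R') : DualNumber R →ₐ[C] DualNumber R' where
  toFun x := (ψ x.fst, ψ x.snd)
  map_one' := TrivSqZeroExt.ext (map_one ψ) (map_zero ψ)
  map_mul' x y := TrivSqZeroExt.ext (map_mul ψ _ _) (by
    change ψ (x * y).snd = ψ x.fst • ψ y.snd + MulOpposite.op (ψ y.fst) • ψ x.snd
    simp)
  map_zero' := TrivSqZeroExt.ext (map_zero ψ) (map_zero ψ)
  map_add' x y := TrivSqZeroExt.ext (map_add ψ _ _) (map_add ψ _ _)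
  commutes' c := TrivSqZeroExt.ext (ψ.commutes c) (map_zero ψ)

variable (C R) in
/-- The inclusion of `R` in its dual numbers. -/
noncomputable abbrev dualInl : R →ₐ[C] DualNumber R := TrivSqZeroExt.inlAlgHom C R R

variable (C R) in
/-- The reduction of the dual numbers. -/
noncomputable abbrev dualFst : DualNumber R →ₐ[C] R := TrivSqZeroExt.fstHom C R R

/-- The kernel of the reduction has square zero and so lies in every prime: the dual numbers have
the same points as `R`. -/
theorem range_comap_dualFst :
    Set.range (PrimeSpectrum.comap (dualFst C R).toRingHom) = Set.univ := by
  rw [range_comap_of_surjective _ _ fun r => ⟨TrivSqZeroExt.inl r, rfl⟩]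
  refine Set.eq_univ_of_forall fun P => ?_
  rw [PrimeSpectrum.mem_zeroLocus]
  intro x hx
  have hx' : x.fst = 0 := hx
  have hsq : x * x = 0 := TrivSqZeroExt.ext (by simp [hx']) (by simp [hx'])
  have : x * x ∈ P.asIdeal := hsq ▸ P.asIdeal.zero_mem
  exact (P.2.mem_or_mem this).elim id id

end Dual

/-! ### Points with values in algebras -/

section Points

variable {C : Type u} [Field C]

variable (C) in
/-- The spectrum of a `C`-algebra as a `C`-scheme. -/
noncomputable abbrev specOver (R : Type u) [CommRing R] [Algebra C R] : Over (Spec (.of C)) :=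
  Over.mk (Spec.map (CommRingCat.ofHom (algebraMap C R)))

variable {R R' R'' : Type u} [CommRing R] [Algebra C R] [CommRing R'] [Algebra C R'] [CommRing R'']
  [Algebra C R'']

/-- The morphism of spectra given by a homomorphism of `C`-algebras. -/
noncomputable def specOverMap (ψ : R →ₐ[C] R') : specOver C R' ⟶ specOver C R :=
  Over.homMk (Spec.map (CommRingCat.ofHom ψ.toRingHom)) (by
    dsimp
    rw [← Spec.map_comp, ← CommRingCat.ofHom_comp]
    congr 2
    exact ψ.comp_algebraMap)

theorem specOverMap_left (ψ : R →ₐ[C] R') :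
    (specOverMap ψ).left = Spec.map (CommRingCat.ofHom ψ.toRingHom) := rfl

theorem specOverMap_comp (ψ : R →ₐ[C] R') (ψ' : R' →ₐ[C] R'') :
    specOverMap ψ' ≫ specOverMap ψ = specOverMap (ψ'.comp ψ) := by
  ext1
  rw [Over.comp_left, specOverMap_left, specOverMap_left, specOverMap_left, ← Spec.map_comp]
  rfl

theorem specOverMap_id : specOverMap (AlgHom.id C R) = 𝟙 (specOver C R) := by
  ext1
  rw [specOverMap_left]
  exact Spec.map_id _

variable {Y Z : Over (Spec (.of C))}

theorem fromSpec_comp_hom {V : Y.left.Opens} (hV : IsAffineOpen V) :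
    hV.fromSpec ≫ Y.hom = Spec.map (CommRingCat.ofHom (algebraMap C Γ(Y.left, V))) := by
  have h := IsAffineOpen.SpecMap_appLE_fromSpec Y.hom (isAffineOpen_top (Spec (.of C))) hV
    (le_preimage_top _ V)
  rw [← h, IsAffineOpen.fromSpec_top, Scheme.isoSpec_Spec_inv, ← Spec.map_comp]
  rfl

/-- The point of a `C`-scheme `Y` given by a homomorphism from the sections over an affine open
subset. -/
noncomputable def pointOf {V : Y.left.Opens} (hV : IsAffineOpen V) (φ : Γ(Y.left, V) →ₐ[C] R) :
    specOver C R ⟶ Y :=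
  Over.homMk (Spec.map (CommRingCat.ofHom φ.toRingHom) ≫ hV.fromSpec) (by
    rw [Category.assoc, fromSpec_comp_hom, ← Spec.map_comp, ← CommRingCat.ofHom_comp]
    change Spec.map _ = Spec.map _
    congr 2
    exact φ.comp_algebraMap)

theorem pointOf_left {V : Y.left.Opens} (hV : IsAffineOpen V) (φ : Γ(Y.left, V) →ₐ[C] R) :
    (pointOf hV φ).left = Spec.map (CommRingCat.ofHom φ.toRingHom) ≫ hV.fromSpec := rfl

theorem pointOf_injective {V : Y.left.Opens} (hV : IsAffineOpen V)
    {φ φ' : Γ(Y.left, V) →ₐ[C] R} (h : pointOf hV φ = pointOf hV φ') : φ = φ' := by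
  have h1 := congr(($h).left)
  rw [pointOf_left, pointOf_left, cancel_mono] at h1
  have h2 := congr(($(Spec.map_injective h1)).hom)
  ext x
  exact congr($h2 x)

theorem specOverMap_pointOf {V : Y.left.Opens} (hV : IsAffineOpen V) (φ : Γ(Y.left, V) →ₐ[C] R)
    (ψ : R →ₐ[C] R') : specOverMap ψ ≫ pointOf hV φ = pointOf hV (ψ.comp φ) := by
  ext1
  rw [Over.comp_left, specOverMap_left, pointOf_left, pointOf_left, ← Category.assoc,
    ← Spec.map_comp]
  rfl

theorem exists_pointOf {V : Y.left.Opens} (hV : IsAffineOpen V) (h : specOver C R ⟶ Y)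
    (hr : ∀ x, h.left x ∈ V) : ∃ φ : Γ(Y.left, V) →ₐ[C] R, h = pointOf hV φ := by
  have hsub : Set.range h.left ⊆ Set.range hV.fromSpec := by
    rw [hV.range_fromSpec]
    rintro _ ⟨x, rfl⟩
    exact hr x
  let l := IsOpenImmersion.lift hV.fromSpec h.left hsub
  have hl : l ≫ hV.fromSpec = h.left := IsOpenImmersion.lift_fac _ _ _
  obtain ⟨φ₀, hφ₀⟩ := Spec.map_surjective l
  have hw : Spec.map φ₀ ≫ Spec.map (CommRingCat.ofHom (algebraMap C Γ(Y.left, V))) =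
      Spec.map (CommRingCat.ofHom (algebraMap C R)) := by
    rw [← fromSpec_comp_hom hV, ← Category.assoc, hφ₀, hl]
    exact Over.w h
  rw [← Spec.map_comp] at hw
  have hw' := congr(($(Spec.map_injective hw)).hom)
  refine ⟨{ φ₀.hom with commutes' := fun c => congr($hw' c) }, ?_⟩
  ext1
  rw [pointOf_left, ← hl, ← hφ₀]
  rfl

theorem pointOf_mem {V : Y.left.Opens} (hV : IsAffineOpen V) (φ : Γ(Y.left, V) →ₐ[C] R) (x) :
    (pointOf hV φ).left x ∈ V := by
  rw [pointOf_left, Scheme.Hom.comp_apply]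
  have : hV.fromSpec (Spec.map (CommRingCat.ofHom φ.toRingHom) x) ∈ Set.range hV.fromSpec :=
    ⟨_, rfl⟩
  rwa [hV.range_fromSpec] at this

/-- Pull-back of sections as a homomorphism of algebras. -/
noncomputable def appAlgHom (f : Y ⟶ Z) {U : Z.left.Opens} {V : Y.left.Opens}
    (h : V ≤ f.left ⁻¹ᵁ U) : Γ(Z.left, U) →ₐ[C] Γ(Y.left, V) :=
  { (f.left.appLE U V h).hom with
    commutes' := fun c => by
      change f.left.appLE U V h (scalar Z U c) = scalar Y V c
      have h1 := app_scalar f U c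
      rw [← res_scalar Y h, ← h1]
      rfl }

theorem appAlgHom_apply (f : Y ⟶ Z) {U : Z.left.Opens} {V : Y.left.Opens}
    (h : V ≤ f.left ⁻¹ᵁ U) (s : Γ(Z.left, U)) : appAlgHom f h s = f.left.appLE U V h s := rfl

theorem pointOf_comp (f : Y ⟶ Z) {U : Z.left.Opens} (hU : IsAffineOpen U) {V : Y.left.Opens}
    (hV : IsAffineOpen V) (h : V ≤ f.left ⁻¹ᵁ U) (φ : Γ(Y.left, V) →ₐ[C] R) :
    pointOf hV φ ≫ f = pointOf hU (φ.comp (appAlgHom f h)) := by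
  ext1
  rw [Over.comp_left, pointOf_left, pointOf_left, Category.assoc,
    ← IsAffineOpen.SpecMap_appLE_fromSpec f.left hU hV h, ← Category.assoc, ← Spec.map_comp]
  rfl

/-- Restriction of sections as a homomorphism of algebras. -/
noncomputable def resAlgHom (Y : Over (Spec (.of C))) {U V : Y.left.Opens} (h : V ≤ U) :
    Γ(Y.left, U) →ₐ[C] Γ(Y.left, V) :=
  { (Y.left.presheaf.map (homOfLE h).op).hom with
    commutes' := fun c => res_scalar Y h c }

theorem pointOf_res {U V : Y.left.Opens} (hU : IsAffineOpen U) (hV : IsAffineOpen V) (h : V ≤ U)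
    (φ : Γ(Y.left, V) →ₐ[C] R) : pointOf hU (φ.comp (resAlgHom Y h)) = pointOf hV φ := by
  ext1
  rw [pointOf_left, pointOf_left, ← hU.map_fromSpec hV (homOfLE h).op, ← Category.assoc,
    ← Spec.map_comp]
  rfl

/-- An infinitesimal thickening adds no points, so a tangent vector stays in any affine open that
contains its base point and can be computed there. -/
theorem exists_pointOf_dual {V : Y.left.Opens} (hV : IsAffineOpen V) {φ : Γ(Y.left, V) →ₐ[C] R}
    (h : specOver C (DualNumber R) ⟶ Y) (hh : specOverMap (dualFst C R) ≫ h = pointOf hV φ) :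
    ∃ φ' : Γ(Y.left, V) →ₐ[C] DualNumber R, h = pointOf hV φ' ∧ (dualFst C R).comp φ' = φ := by
  obtain ⟨φ', hφ'⟩ := exists_pointOf hV h (by
    intro x
    obtain ⟨y, rfl⟩ : x ∈ Set.range (PrimeSpectrum.comap (dualFst C R).toRingHom) := by
      rw [range_comap_dualFst]; trivial
    have := pointOf_mem hV φ y
    rw [← hh] at this
    exact this)
  refine ⟨φ', hφ', pointOf_injective hV ?_⟩
  rw [← hh, hφ', specOverMap_pointOf]

/-- A point with values in a local ring is contained in an affine open subset. -/
theorem exists_isAffineOpen_pointOf [IsLocalRing R] (h : specOver C R ⟶ Y) {U : Y.left.Opens}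
    (hU : h.left (IsLocalRing.closedPoint R) ∈ U) :
    ∃ (V : Y.left.Opens) (hV : IsAffineOpen V) (φ : Γ(Y.left, V) →ₐ[C] R),
      V ≤ U ∧ h = pointOf hV φ := by
  obtain ⟨V, hV, hxV, hVU⟩ := exists_isAffineOpen_mem_and_subset (X := Y.left) hU
  obtain ⟨φ, hφ⟩ := exists_pointOf hV h (fun x => by
    -- All points of the spectrum of a local ring specialize to the closed one, so an open set that
    -- contains the image of the closed point contains the whole image.
    have hs : x ⤳ IsLocalRing.closedPoint R := IsLocalRing.specializes_closedPoint x
    exact (hs.map h.left.continuous).mem_open V.2 hxV)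
  exact ⟨V, hV, φ, hVU, hφ⟩

end Points

/-! ### Tangent vectors given by vector fields -/

section FieldEval

variable {C K : Type u} [Field C] [Field K] [Algebra C K] {Y : Over (Spec (.of C))}
variable {R R' : Type u} [CommRing R] [Algebra C R] [Algebra K R] [IsScalarTower C K R]
  [CommRing R'] [Algebra C R'] [Algebra K R'] [IsScalarTower C K R']

/-- The value `∑ kᵢ φ (Xᵢ s)` of a non-autonomous vector field `∑ Xᵢ ⊗ kᵢ`. -/
noncomputable def fieldEval {V : Y.left.Opens} (φ : Γ(Y.left, V) →ₐ[C] R) (s : Γ(Y.left, V)) :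
    VectorField Y ⊗[C] K →ₗ[C] R :=
  LinearMap.mul' C R ∘ₗ TensorProduct.map
    { toFun := fun X => φ (X.1 V s)
      map_add' := fun X X' => by
        rw [Submodule.coe_add, Pi.add_apply, Derivation.add_apply, map_add]
      map_smul' := fun c X => by
        rw [Submodule.coe_smul, Pi.smul_apply, Derivation.smul_apply, map_smul, RingHom.id_apply] }
    (IsScalarTower.toAlgHom C K R).toLinearMap

theorem fieldEval_tmul {V : Y.left.Opens} (φ : Γ(Y.left, V) →ₐ[C] R) (s : Γ(Y.left, V))
    (X : VectorField Y) (k : K) :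
    fieldEval φ s (X ⊗ₜ k) = φ (X.1 V s) * algebraMap K R k := rfl

theorem fieldEval_add {V : Y.left.Opens} (φ : Γ(Y.left, V) →ₐ[C] R) (s t : Γ(Y.left, V))
    (A : VectorField Y ⊗[C] K) :
    fieldEval φ (s + t) A = fieldEval φ s A + fieldEval φ t A := by
  induction A with
  | zero => simp
  | tmul X k => rw [fieldEval_tmul, fieldEval_tmul, fieldEval_tmul, map_add, map_add, add_mul]
  | add A B hA hB =>
    rw [LinearMap.map_add, LinearMap.map_add, LinearMap.map_add]
    exact (congrArg₂ (· + ·) hA hB).trans (add_add_add_comm ..)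

theorem fieldEval_mul {V : Y.left.Opens} (φ : Γ(Y.left, V) →ₐ[C] R) (s t : Γ(Y.left, V))
    (A : VectorField Y ⊗[C] K) :
    fieldEval φ (s * t) A = φ s * fieldEval φ t A + φ t * fieldEval φ s A := by
  induction A with
  | zero => simp
  | tmul X k =>
    rw [fieldEval_tmul, fieldEval_tmul, fieldEval_tmul, Derivation.leibniz, map_add, smul_eq_mul,
      smul_eq_mul, map_mul, map_mul]
    ring
  | add A B hA hB =>
    rw [LinearMap.map_add, LinearMap.map_add, LinearMap.map_add]
    refine (congrArg₂ (· + ·) hA hB).trans ?_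
    ring

theorem fieldEval_algebraMap {V : Y.left.Opens} (φ : Γ(Y.left, V) →ₐ[C] R) (c : C)
    (A : VectorField Y ⊗[C] K) : fieldEval φ (algebraMap C Γ(Y.left, V) c) A = 0 := by
  induction A with
  | zero => simp
  | tmul X k => rw [fieldEval_tmul, Derivation.map_algebraMap, map_zero, zero_mul]
  | add A B hA hB => rw [map_add, hA, hB, add_zero]

/-- The tangent vector of a non-autonomous vector field at a point. -/
noncomputable def fieldPoint {V : Y.left.Opens} (φ : Γ(Y.left, V) →ₐ[C] R)
    (A : VectorField Y ⊗[C] K) : Γ(Y.left, V) →ₐ[C] DualNumber R :=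
  dualAlgHom φ (AddMonoidHom.mk' (fun s => fieldEval φ s A) (fun s t => fieldEval_add φ s t A))
    (fun s t => fieldEval_mul φ s t A) (fun c => fieldEval_algebraMap φ c A)

theorem dualFst_comp_fieldPoint {V : Y.left.Opens} (φ : Γ(Y.left, V) →ₐ[C] R)
    (A : VectorField Y ⊗[C] K) : (dualFst C R).comp (fieldPoint φ A) = φ := rfl

theorem map_fieldEval {V : Y.left.Opens} (φ : Γ(Y.left, V) →ₐ[C] R) (s : Γ(Y.left, V))
    (A : VectorField Y ⊗[C] K) (ψ : R →ₐ[K] R') :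
    ψ (fieldEval φ s A) = fieldEval ((ψ.restrictScalars C).comp φ) s A := by
  induction A with
  | zero => simp
  | tmul X k => rw [fieldEval_tmul, fieldEval_tmul, map_mul, AlgHom.commutes]; rfl
  | add A B hA hB => rw [map_add, map_add, map_add, hA, hB]

theorem dualMap_comp_fieldPoint {V : Y.left.Opens} (φ : Γ(Y.left, V) →ₐ[C] R)
    (A : VectorField Y ⊗[C] K) (ψ : R →ₐ[K] R') :
    (dualMap (ψ.restrictScalars C)).comp (fieldPoint φ A) =
      fieldPoint ((ψ.restrictScalars C).comp φ) A :=
  AlgHom.ext fun s => TrivSqZeroExt.ext rfl (map_fieldEval φ s A ψ)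

theorem fieldPoint_comp_res {U V : Y.left.Opens} (h : V ≤ U) (φ : Γ(Y.left, V) →ₐ[C] R)
    (A : VectorField Y ⊗[C] K) :
    (fieldPoint φ A).comp (resAlgHom Y h) = fieldPoint (φ.comp (resAlgHom Y h)) A := by
  refine AlgHom.ext fun s => TrivSqZeroExt.ext rfl ?_
  change fieldEval φ (Y.left.presheaf.map (homOfLE h).op s) A = fieldEval _ s A
  induction A with
  | zero => simp
  | tmul X k => rw [fieldEval_tmul, fieldEval_tmul, X.2 U V h s]; rfl
  | add A B hA hB => rw [map_add, map_add, hA, hB]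

/-- Right invariant vector fields are compatible with right translations. -/
theorem fieldPoint_comp_rightTranslation {G : Over (Spec (.of C))} [GrpObj G]
    (A : AutomorphicField G K) (σ : 𝟙_ (Over (Spec (.of C))) ⟶ G) {V : G.left.Opens}
    (φ : Γ(G.left, (rightTranslation G σ).left ⁻¹ᵁ V) →ₐ[C] R) :
    (fieldPoint φ ((rightInvariant G).subtype.rTensor K A)).comp
        (appAlgHom (rightTranslation G σ) le_rfl) =
      fieldPoint (φ.comp (appAlgHom (rightTranslation G σ) le_rfl))
        ((rightInvariant G).subtype.rTensor K A) := by
  refine AlgHom.ext fun s => TrivSqZeroExt.ext rfl ?_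
  have happ (t) : appAlgHom (rightTranslation G σ) (U := V) le_rfl t =
      (rightTranslation G σ).left.app V t := by
    rw [appAlgHom_apply, Scheme.Hom.appLE_eq_app]
  let τ := (rightInvariant G).subtype.rTensor K
  let ρ := (rightTranslation G σ).left.app V s
  -- Both sides are linear in the field, and on a pure tensor `X ⊗ k` the equality is the invariance
  -- of `X`.
  have key : (fieldEval φ ρ).comp τ =
      (fieldEval (φ.comp (appAlgHom (rightTranslation G σ) le_rfl)) s).comp τ := by
    refine TensorProduct.ext' fun X k => ?_
    refine (fieldEval_tmul φ _ X.1 k).trans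
      (Eq.trans ?_ (fieldEval_tmul (φ.comp (appAlgHom (rightTranslation G σ) le_rfl)) s X.1 k).symm)
    refine congrArg (fun t => φ t * algebraMap K R k) ?_
    exact (X.2 σ V s).trans (happ _).symm
  have e : appAlgHom (rightTranslation G σ) le_rfl s = ρ := happ s
  exact (congrArg (fun t => fieldEval φ t (τ A)) e).trans (LinearMap.congr_fun key A)

end FieldEval

/-! ### Density of rational points -/

theorem finiteType_sections {F : Type u} [Field F] (Y : Over (Spec (.of F)))
    [LocallyOfFiniteType Y.hom] {V : Y.left.Opens} (hV : IsAffineOpen V) :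
    Algebra.FiniteType F Γ(Y.left, V) := by
  have h := LocallyOfFiniteType.finiteType_appLE Y.hom (isAffineOpen_top _) hV
    (le_preimage_top _ V)
  rw [← RingHom.finiteType_algebraMap]
  exact h.comp (RingHom.FiniteType.of_surjective (Scheme.ΓSpecIso (.of F)).inv.hom
    (Scheme.ΓSpecIso (.of F)).symm.commRingCatIsoToRingEquiv.surjective)

/-- Nullstellensatz: `B` is a reduced Jacobson ring, so its maximal ideals intersect in zero, and
each residue field is finite over the algebraically closed `C`, hence equal to it. -/
theorem eq_zero_of_forall_algHom {C B : Type*} [Field C] [IsAlgClosed C] [CommRing B] [Algebra C B]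
    [Algebra.FiniteType C B] [IsReduced B] {b : B} (h : ∀ τ : B →ₐ[C] C, τ b = 0) : b = 0 := by
  have : IsJacobsonRing B := isJacobsonRing_of_finiteType (A := C)
  have hrad : (⊥ : Ideal B).IsRadical := fun x ⟨n, hn⟩ => IsReduced.eq_zero x ⟨n, hn⟩
  have hb : b ∈ (⊥ : Ideal B).jacobson := by
    refine Ideal.mem_sInf.mpr fun {J} hJ => ?_
    have := hJ.2
    let := Ideal.Quotient.field J
    have : Module.Finite C (B ⧸ J) := finite_of_finite_type_of_isJacobsonRing _ _
    have hbij := IsAlgClosed.algebraMap_bijective_of_isIntegral (k := C) (K := B ⧸ J)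
    let e := AlgEquiv.ofBijective (Algebra.ofId C (B ⧸ J)) hbij
    have := h (e.symm.toAlgHom.comp (Ideal.Quotient.mkₐ C J))
    exact Ideal.Quotient.eq_zero_iff_mem.mp
      ((map_eq_zero_iff e.symm e.symm.injective).mp this)
  rw [IsJacobsonRing.out inferInstance hrad] at hb
  exact hb

/-- An element of `K ⊗ B` that vanishes at all rational points of `B` is zero. -/
theorem tensor_eq_zero_of_forall_algHom {C K B : Type*} [Field C] [IsAlgClosed C] [CommRing K]
    [Algebra C K] [CommRing B] [Algebra C B] [Algebra.FiniteType C B] [IsReduced B] {d : K ⊗[C] B}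
    (h : ∀ τ : B →ₐ[C] C, τ.toLinearMap.lTensor K d = 0) : d = 0 := by
  -- In a `C`-basis of `K` the element has coefficients in `B`, and evaluation at `τ` acts on each
  -- coefficient separately.
  let b := Module.Free.chooseBasis C K
  apply (TensorProduct.equivFinsuppOfBasisLeft b).injective
  rw [map_zero]
  ext i
  apply eq_zero_of_forall_algHom (C := C)
  intro τ
  have key (x : K ⊗[C] B) : TensorProduct.equivFinsuppOfBasisLeft b (τ.toLinearMap.lTensor K x) i =
      τ (TensorProduct.equivFinsuppOfBasisLeft b x i) := by
    induction x with
    | zero => simp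
    | tmul k y => simp
    | add x y hx hy => simp [map_add, hx, hy]
  rw [← key, h, map_zero]
  rfl

/-- The universal homomorphism from a `C`-algebra `B` to a `K`-algebra. -/
theorem exists_universal_algebra (C K B : Type u) [Field C] [IsAlgClosed C] [CommRing K]
    [Algebra C K] [CommRing B] [Algebra C B] [Algebra.FiniteType C B] [IsReduced B] :
    ∃ (R₀ : Type u) (_ : CommRing R₀) (_ : Algebra C R₀) (_ : Algebra K R₀)
      (_ : IsScalarTower C K R₀) (φ₀ : B →ₐ[C] R₀),
      (∀ (R : Type u) [CommRing R] [Algebra C R] [Algebra K R] [IsScalarTower C K R]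
        (φ : B →ₐ[C] R), ∃ ψ : R₀ →ₐ[K] R, (ψ.restrictScalars C).comp φ₀ = φ) ∧
      ∀ d : R₀, (∀ τ : B →ₐ[C] C, ∀ ψ : R₀ →ₐ[K] K,
        (ψ.restrictScalars C).comp φ₀ = (Algebra.ofId C K).comp τ → ψ d = 0) → d = 0 := by
  have huniv (R : Type u) [CommRing R] [Algebra C R] [Algebra K R] [IsScalarTower C K R]
      (φ : B →ₐ[C] R) : ∃ ψ : K ⊗[C] B →ₐ[K] R,
        (ψ.restrictScalars C).comp Algebra.TensorProduct.includeRight = φ := by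
    refine ⟨Algebra.TensorProduct.lift (Algebra.ofId K R) φ (fun _ _ => Commute.all _ _), ?_⟩
    ext y
    simp
  -- The tensor product is recorded only through its universal property and the separation of its
  -- elements by rational points of `B`.
  refine ⟨K ⊗[C] B, inferInstance, inferInstance, inferInstance, inferInstance,
    Algebra.TensorProduct.includeRight, huniv, fun d hd => ?_⟩
  apply tensor_eq_zero_of_forall_algHom (C := C)
  intro τ
  obtain ⟨ψ, hψ⟩ := huniv K ((Algebra.ofId C K).comp τ)
  have key (x : K ⊗[C] B) : TensorProduct.rid C K (τ.toLinearMap.lTensor K x) = ψ x := by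
    induction x with
    | zero => simp
    | tmul k y =>
      have h1 : ψ (1 ⊗ₜ y) = algebraMap C K (τ y) := congr($hψ y)
      have h2 : k ⊗ₜ y = k • ((1 : K) ⊗ₜ[C] y) := by
        rw [TensorProduct.smul_tmul', smul_eq_mul, mul_one]
      rw [h2, map_smul ψ, h1, ← h2]
      simp [Algebra.smul_def, mul_comm]
    | add x y hx hy => rw [map_add, map_add, hx, hy, map_add]
  apply (TensorProduct.rid C K).injective
  rw [key, hd τ ψ hψ, map_zero]

/-! ### The logarithmic derivative -/

section Tangent

variable {C K : Type u} [Field C] [Field K] [Algebra C K] {Y : Over (Spec (.of C))}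
variable {R R' : Type u} [CommRing R] [Algebra C R] [Algebra K R] [IsScalarTower C K R]
  [CommRing R'] [Algebra C R'] [Algebra K R'] [IsScalarTower C K R']

/-- The tangent vector at a point does not depend on the affine chart: as `R` is local, the point
factors through an affine open inside both charts, and vector fields commute with restriction. -/
theorem pointOf_fieldPoint_congr [IsLocalRing R] {V V' : Y.left.Opens} (hV : IsAffineOpen V)
    (hV' : IsAffineOpen V') {φ : Γ(Y.left, V) →ₐ[C] R} {φ' : Γ(Y.left, V') →ₐ[C] R}
    (h : pointOf hV φ = pointOf hV' φ') (A : VectorField Y ⊗[C] K) :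
    pointOf hV (fieldPoint φ A) = pointOf hV' (fieldPoint φ' A) := by
  have hmem : (pointOf hV φ).left (IsLocalRing.closedPoint R) ∈ V ⊓ V' :=
    ⟨pointOf_mem hV φ _, h ▸ pointOf_mem hV' φ' _⟩
  obtain ⟨W, hW, χ, hle, hχ⟩ := exists_isAffineOpen_pointOf (pointOf hV φ) hmem
  have e : φ = χ.comp (resAlgHom Y (hle.trans inf_le_left)) :=
    pointOf_injective hV (by rw [pointOf_res hV hW, hχ])
  have e' : φ' = χ.comp (resAlgHom Y (hle.trans inf_le_right)) :=
    pointOf_injective hV' (by rw [pointOf_res hV' hW, ← h, hχ])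
  rw [e, e', ← fieldPoint_comp_res, ← fieldPoint_comp_res, pointOf_res hV hW, pointOf_res hV' hW]

open scoped MonObj

variable {G : Over (Spec (.of C))}

theorem specMap_algebraMap_self :
    Spec.map (CommRingCat.ofHom (algebraMap C C)) = 𝟙 (Spec (.of C)) := by
  rw [Algebra.algebraMap_self, CommRingCat.ofHom_id, Spec.map_id]

/-- The identification of the final object with the spectrum of the base field. -/
noncomputable def unitToSpecOver : 𝟙_ (Over (Spec (.of C))) ⟶ specOver C C :=
  Over.homMk (𝟙 (Spec (.of C))) (by
    change 𝟙 _ ≫ Spec.map (CommRingCat.ofHom (algebraMap C C)) = 𝟙 _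
    rw [specMap_algebraMap_self, Category.id_comp])

theorem unitToSpecOver_left : (unitToSpecOver (C := C)).left = 𝟙 (Spec (.of C)) := rfl

theorem toUnit_unitToSpecOver : CartesianMonoidalCategory.toUnit (specOver C R) ≫ unitToSpecOver =
    specOverMap (Algebra.ofId C R) := by
  ext1
  rw [Over.comp_left, Over.toUnit_left, specOverMap_left, unitToSpecOver_left]
  change Spec.map (CommRingCat.ofHom (algebraMap C R)) ≫ _ =
    Spec.map (CommRingCat.ofHom (algebraMap C R))
  rw [Category.comp_id]

/-- A point with values in the base field. -/
noncomputable def unitPoint (h : specOver C C ⟶ G) : 𝟙_ (Over (Spec (.of C))) ⟶ G :=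
  unitToSpecOver ≫ h

theorem toUnit_unitPoint (h : specOver C C ⟶ G) :
    CartesianMonoidalCategory.toUnit (specOver C R) ≫ unitPoint h =
      specOverMap (Algebra.ofId C R) ≫ h := by
  rw [unitPoint, ← Category.assoc, toUnit_unitToSpecOver]

variable [GrpObj G]

theorem exists_pointOf_one : ∃ (V : G.left.Opens) (hV : IsAffineOpen V)
    (φ : Γ(G.left, V) →ₐ[C] K), (1 : specOver C K ⟶ G) = pointOf hV φ := by
  obtain ⟨V, hV, φ, -, h⟩ := exists_isAffineOpen_pointOf (1 : specOver C K ⟶ G) (U := ⊤)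
    (TopologicalSpace.Opens.mem_top _)
  exact ⟨V, hV, φ, h⟩

/-- An automorphic vector field as a non-autonomous vector field. -/
noncomputable abbrev toField (A : AutomorphicField G K) : VectorField G ⊗[C] K :=
  (rightInvariant G).subtype.rTensor K A

/-- The tangent vector of an automorphic vector field at the identity. -/
noncomputable def unitTangent (A : AutomorphicField G K) : specOver C (DualNumber K) ⟶ G :=
  pointOf (exists_pointOf_one (G := G) (K := K)).choose_spec.choose
    (fieldPoint (exists_pointOf_one (G := G) (K := K)).choose_spec.choose_spec.choose (toField A))

theorem unitTangent_eq (A : AutomorphicField G K) {V : G.left.Opens} (hV : IsAffineOpen V)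
    (φ : Γ(G.left, V) →ₐ[C] K) (h : (1 : specOver C K ⟶ G) = pointOf hV φ) :
    unitTangent A = pointOf hV (fieldPoint φ (toField A)) :=
  pointOf_fieldPoint_congr _ hV
    ((exists_pointOf_one (G := G) (K := K)).choose_spec.choose_spec.choose_spec.symm.trans h) _

theorem specOverMap_dualFst_unitTangent (A : AutomorphicField G K) :
    specOverMap (dualFst C K) ≫ unitTangent A = 1 := by
  obtain ⟨V, hV, φ, h⟩ := exists_pointOf_one (G := G) (K := K)
  rw [unitTangent_eq A hV φ h, specOverMap_pointOf, dualFst_comp_fieldPoint, h]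

/-- The tangent vector of an automorphic vector field at the identity, over a `K`-algebra. -/
noncomputable def tangentAt (A : AutomorphicField G K) (R : Type u) [CommRing R] [Algebra C R]
    [Algebra K R] [IsScalarTower C K R] : specOver C (DualNumber R) ⟶ G :=
  specOverMap (dualMap (IsScalarTower.toAlgHom C K R)) ≫ unitTangent A

theorem specOverMap_tangentAt (A : AutomorphicField G K) (ψ : R →ₐ[K] R') :
    specOverMap (dualMap (ψ.restrictScalars C)) ≫ tangentAt A R = tangentAt A R' := by
  rw [tangentAt, tangentAt, ← Category.assoc, specOverMap_comp]
  congr 2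
  exact AlgHom.ext fun x => TrivSqZeroExt.ext (ψ.commutes _) (ψ.commutes _)

theorem specOverMap_dualFst_tangentAt (A : AutomorphicField G K) :
    specOverMap (dualFst C R) ≫ tangentAt A R = 1 := by
  have : (dualFst C R).comp (dualMap (IsScalarTower.toAlgHom C K R)) =
      (IsScalarTower.toAlgHom C K R).comp (dualFst C K) := rfl
  rw [tangentAt, ← Category.assoc, specOverMap_comp, this, ← specOverMap_comp, Category.assoc,
    specOverMap_dualFst_unitTangent, MonObj.comp_one]

theorem comp_rightTranslation {X : Over (Spec (.of C))} (f : X ⟶ G)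
    (σ : 𝟙_ (Over (Spec (.of C))) ⟶ G) :
    f ≫ rightTranslation G σ = f * (CartesianMonoidalCategory.toUnit X ≫ σ) := by
  rw [rightTranslation, GrpObj.mulRight_hom, Hom.mul_def, ← Category.assoc,
    CartesianMonoidalCategory.comp_lift, Category.comp_id, ← Category.assoc,
    CartesianMonoidalCategory.comp_toUnit]

/-- At a point that comes from `G(C)` the formula is right invariance itself: right translation by
`σ` takes the tangent vector at the identity to the one at `σ`. -/
theorem pointOf_fieldPoint_of_unit (A : AutomorphicField G K) (σ : 𝟙_ (Over (Spec (.of C))) ⟶ G)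
    {V : G.left.Opens} (hV : IsAffineOpen V) (φ : Γ(G.left, V) →ₐ[C] K)
    (h : pointOf hV φ = CartesianMonoidalCategory.toUnit _ ≫ σ) :
    pointOf hV (fieldPoint φ (toField A)) =
      unitTangent A * (CartesianMonoidalCategory.toUnit _ ≫ σ) := by
  let ρ := rightTranslation G σ
  have : IsIso ρ.left := inferInstanceAs (IsIso ((Over.forget _).map (GrpObj.mulRight σ).hom))
  have hV' : IsAffineOpen (ρ.left ⁻¹ᵁ V) := hV.preimage_of_isIso ρ.left
  have h1 : (1 : specOver C K ⟶ G) ≫ ρ = pointOf hV φ := by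
    rw [comp_rightTranslation, one_mul, h]
  obtain ⟨φ', hφ'⟩ := exists_pointOf hV' (1 : specOver C K ⟶ G) (fun x => by
    have := pointOf_mem hV φ x
    rw [← h1] at this
    exact this)
  have e : φ = φ'.comp (appAlgHom ρ le_rfl) := by
    apply pointOf_injective hV
    rw [← h1, hφ', pointOf_comp ρ hV hV' le_rfl]
  rw [← comp_rightTranslation, unitTangent_eq A hV' φ' hφ', pointOf_comp ρ hV hV' le_rfl,
    fieldPoint_comp_rightTranslation, ← e]

/-- The tangent vectors of a right invariant vector field are the right translates of its tangent
vector at the identity. -/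
theorem pointOf_fieldPoint [IsAlgClosed C] [IsReduced G.left] [LocallyOfFiniteType G.hom]
    (A : AutomorphicField G K) {V : G.left.Opens} (hV : IsAffineOpen V)
    (φ : Γ(G.left, V) →ₐ[C] R) :
    pointOf hV (fieldPoint φ (toField A)) =
      tangentAt A R * (specOverMap (dualInl C R) ≫ pointOf hV φ) := by
  have : Algebra.FiniteType C Γ(G.left, V) := finiteType_sections G hV
  -- Both sides are functorial in `R`, so the universal point suffices.
  obtain ⟨R₀, _, _, _, _, φ₀, huniv, hzero⟩ := exists_universal_algebra C K Γ(G.left, V)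
  have hinl {R R' : Type u} [CommRing R] [Algebra C R] [CommRing R'] [Algebra C R']
      (ψ : R →ₐ[C] R') : (dualMap ψ).comp (dualInl C R) = (dualInl C R').comp ψ :=
    AlgHom.ext fun x => TrivSqZeroExt.ext rfl (map_zero ψ)
  have hmap {R R' : Type u} [CommRing R] [Algebra C R] [Algebra K R] [IsScalarTower C K R]
      [CommRing R'] [Algebra C R'] [Algebra K R'] [IsScalarTower C K R'] (ψ : R →ₐ[K] R')
      (φ : Γ(G.left, V) →ₐ[C] R) :
      specOverMap (dualMap (ψ.restrictScalars C)) ≫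
          (tangentAt A R * (specOverMap (dualInl C R) ≫ pointOf hV φ)) =
        tangentAt A R' * (specOverMap (dualInl C R') ≫
          pointOf hV ((ψ.restrictScalars C).comp φ)) := by
    rw [MonObj.comp_mul, specOverMap_tangentAt, ← Category.assoc, specOverMap_comp, hinl,
      specOverMap_pointOf, specOverMap_pointOf, AlgHom.comp_assoc]
  have h₀ : pointOf hV (fieldPoint φ₀ (toField A)) =
      tangentAt A R₀ * (specOverMap (dualInl C R₀) ≫ pointOf hV φ₀) := by
    -- The right side reduces to `φ₀` modulo `ε`, so it is also a homomorphism from `Γ(V)` to the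
    -- dual numbers, and only `ε`-coefficients remain to be compared.
    obtain ⟨φ', hφ', hfst⟩ := exists_pointOf_dual hV (φ := φ₀)
      (tangentAt A R₀ * (specOverMap (dualInl C R₀) ≫ pointOf hV φ₀)) (by
        rw [MonObj.comp_mul, specOverMap_dualFst_tangentAt, one_mul, ← Category.assoc,
          specOverMap_comp]
        have : (dualFst C R₀).comp (dualInl C R₀) = AlgHom.id C R₀ := rfl
        rw [this, specOverMap_id, Category.id_comp])
    rw [hφ']
    congr 1
    -- The coefficients agree after specialization at each rational point `τ`, by the case already
    -- known. Elements of `R₀` are determined by these specializations.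
    have hτ (τ : Γ(G.left, V) →ₐ[C] C) (ψ : R₀ →ₐ[K] K)
        (hψ : (ψ.restrictScalars C).comp φ₀ = (Algebra.ofId C K).comp τ) (s : Γ(G.left, V)) :
        ψ (fieldPoint φ₀ (toField A) s).snd = ψ (φ' s).snd := by
      have hpt : pointOf hV ((Algebra.ofId C K).comp τ) =
          CartesianMonoidalCategory.toUnit _ ≫ unitPoint (pointOf hV τ) := by
        rw [toUnit_unitPoint, specOverMap_pointOf]
      have h1 := pointOf_fieldPoint_of_unit A (unitPoint (pointOf hV τ)) hV _ hpt
      have h2 := congr(specOverMap (dualMap (ψ.restrictScalars C)) ≫ $hφ')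
      have h4 : tangentAt A K = unitTangent A := by
        rw [tangentAt]
        have : dualMap (IsScalarTower.toAlgHom C K K) = AlgHom.id C (DualNumber K) := rfl
        rw [this, specOverMap_id, Category.id_comp]
      rw [hmap, hψ, hpt, h4, ← Category.assoc, CartesianMonoidalCategory.comp_toUnit, ← h1, ← hψ,
        ← dualMap_comp_fieldPoint, specOverMap_pointOf] at h2
      exact congr(($(pointOf_injective hV h2) s).snd)
    refine AlgHom.ext fun s => TrivSqZeroExt.ext congr($hfst s).symm ?_
    rw [← sub_eq_zero]
    refine hzero _ fun τ ψ hψ => ?_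
    rw [map_sub, hτ τ ψ hψ, sub_self]
  obtain ⟨ψ, hψ⟩ := huniv R φ
  have h2 := congr(specOverMap (dualMap (ψ.restrictScalars C)) ≫ $h₀)
  rwa [hmap, specOverMap_pointOf, dualMap_comp_fieldPoint, hψ] at h2

end Tangent

/-! ### Differential points and differential morphisms -/

section DiffSchemes

variable {K : Type u} [Field K] [Differential K]

theorem DiffScheme.mem_diffPoints_iff {X : DiffScheme K} {x : X.toOver.left} :
    x ∈ X.diffPoints ↔ ∀ t ∈ IsLocalRing.maximalIdeal (X.toOver.left.presheaf.stalk x),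
      X.der.stalk x t ∈ IsLocalRing.maximalIdeal (X.toOver.left.presheaf.stalk x) := by
  refine ⟨fun h t ht => DiffScheme.stalk_mem h t ht, fun h U hU hx a ha => ?_⟩
  rw [mem_primeIdealOf_iff] at ha ⊢
  rw [← SchemeDerivation.stalk_germ]
  exact h _ ha

/-- One affine neighbourhood suffices, because the condition can be read in the local ring. If `t *
u = s` with `u` outside the prime, then `u * t′ = s′ - t * u′` lies in the maximal ideal, hence so
does `t′`. -/
theorem DiffScheme.mem_diffPoints_of_isAffineOpen {X : DiffScheme K} {x : X.toOver.left}
    {U : X.toOver.left.Opens} (hU : IsAffineOpen U) (hx : x ∈ U)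
    (h : ∀ a ∈ (hU.primeIdealOf ⟨x, hx⟩).asIdeal,
      X.der.app U a ∈ (hU.primeIdealOf ⟨x, hx⟩).asIdeal) : x ∈ X.diffPoints := by
  rw [DiffScheme.mem_diffPoints_iff]
  intro t ht
  let := X.toOver.left.presheaf.algebra_section_stalk (U := U) ⟨x, hx⟩
  have := hU.isLocalization_stalk ⟨x, hx⟩
  have hg (a : Γ(X.toOver.left, U)) : algebraMap Γ(X.toOver.left, U) _ a =
    X.toOver.left.presheaf.germ U x hx a := rfl
  obtain ⟨⟨s, u⟩, hsu⟩ := IsLocalization.surj (hU.primeIdealOf ⟨x, hx⟩).asIdeal.primeCompl t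
  rw [hg, hg] at hsu
  have hs : s ∈ (hU.primeIdealOf ⟨x, hx⟩).asIdeal := by
    rw [mem_primeIdealOf_iff]
    exact hsu ▸ Ideal.mul_mem_right _ _ ht
  have hds := h s hs
  rw [mem_primeIdealOf_iff, ← SchemeDerivation.stalk_germ, ← hsu, Derivation.leibniz, smul_eq_mul,
    smul_eq_mul] at hds
  have h1 := (Ideal.add_mem_iff_right _ (Ideal.mul_mem_right _ _ ht)).mp hds
  refine ((IsLocalRing.maximalIdeal.isMaximal _).isPrime.mem_or_mem h1).resolve_left
    fun hu => u.2 ?_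
  rw [SetLike.mem_coe, mem_primeIdealOf_iff]
  exact hu

/-- The residue map at a differential point. -/
noncomputable def DiffScheme.toKappa (X : DiffScheme K) (x : X.Diff) :
    X.toOver.left.presheaf.stalk x.1 →+* X.kappa x :=
  (X.toOver.left.residue x.1).hom

theorem DiffScheme.toKappa_surjective (X : DiffScheme K) (x : X.Diff) :
    Function.Surjective (X.toKappa x) := X.toOver.left.residue_surjective x.1

theorem DiffScheme.toKappa_germ (X : DiffScheme K) (x : X.Diff) (U : X.toOver.left.Opens)
    (hx : x.1 ∈ U) (s : Γ(X.toOver.left, U)) :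
    X.toKappa x (X.toOver.left.presheaf.germ U x.1 hx s) = X.eval x U hx s := rfl

theorem DiffScheme.toKappa_deriv (X : DiffScheme K) (x : X.Diff)
    (t : X.toOver.left.presheaf.stalk x.1) :
    (X.toKappa x t)′ = X.toKappa x (X.der.stalk x.1 t) := by
  obtain ⟨U, hx, s, rfl⟩ := X.toOver.left.presheaf.exists_germ_eq t
  rw [X.toKappa_germ, X.deriv_eval, SchemeDerivation.stalk_germ, X.toKappa_germ]

theorem DiffScheme.eval_scalar (X : DiffScheme K) (x : X.Diff) (U : X.toOver.left.Opens)
    (hx : x.1 ∈ U) (a : K) : X.eval x U hx (scalar X.toOver U a) = algebraMap K (X.kappa x) a := by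
  rw [← res_scalar X.toOver (le_top : U ≤ ⊤), ← X.toKappa_germ]
  rw [X.toOver.left.presheaf.germ_res_apply]
  rfl

variable {X Y Z : DiffScheme K}

theorem DiffScheme.isDifferential_iff_stalk (f : X.toOver ⟶ Y.toOver) :
    DiffScheme.IsDifferential f ↔ ∀ (x : X.toOver.left) (t), X.der.stalk x (f.left.stalkMap x t) =
      f.left.stalkMap x (Y.der.stalk (f.left x) t) := by
  have key (x : X.toOver.left) (U : Y.toOver.left.Opens) (hx : f.left x ∈ U)
      (hx' : x ∈ f.left ⁻¹ᵁ U) (s : Γ(Y.toOver.left, U)) :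
      f.left.stalkMap x (Y.toOver.left.presheaf.germ U (f.left x) hx s) =
        X.toOver.left.presheaf.germ (f.left ⁻¹ᵁ U) x hx' (f.left.app U s) :=
    Scheme.Hom.germ_stalkMap_apply f.left U x hx s
  constructor
  · intro h x t
    obtain ⟨U, hx, s, rfl⟩ := Y.toOver.left.presheaf.exists_germ_eq t
    have hx' : x ∈ f.left ⁻¹ᵁ U := hx
    rw [key x U hx hx' s, SchemeDerivation.stalk_germ, h U s, ← key x U hx hx',
      SchemeDerivation.stalk_germ]
  · intro h U s
    refine TopCat.Presheaf.section_ext X.toOver.left.sheaf _ _ _ fun x hx => ?_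
    have hx' : f.left x ∈ U := hx
    have := h x (Y.toOver.left.presheaf.germ U (f.left x) hx' s)
    rw [key x U hx' hx, SchemeDerivation.stalk_germ, SchemeDerivation.stalk_germ,
      key x U hx' hx] at this
    exact this

/-- The stalks at `x` and `g x` are distinct types even when `g` equals the identity; a variable `g`
lets the equality be substituted. -/
theorem SchemeDerivation.stalk_stalkMap_of_eq_id {X : Scheme.{u}} (D : SchemeDerivation X)
    {g : X ⟶ X} (hg : g = 𝟙 X) (x : X) (t) :
    D.stalk x (g.stalkMap x t) = g.stalkMap x (D.stalk (g x) t) := by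
  subst hg
  rw [Scheme.Hom.stalkMap_id]
  rfl

theorem DiffScheme.IsDifferential.inv {φ : X.toOver ≅ Y.toOver}
    (h : DiffScheme.IsDifferential φ.hom) : DiffScheme.IsDifferential φ.inv := by
  have h0 : φ.inv.left ≫ φ.hom.left = 𝟙 _ := by rw [← Over.comp_left, φ.inv_hom_id, Over.id_left]
  rw [DiffScheme.isDifferential_iff_stalk] at h ⊢
  have : IsIso φ.hom.left := inferInstanceAs (IsIso ((Over.forget _).map φ.hom))
  have h1 : φ.hom.left ≫ φ.inv.left = 𝟙 _ := by rw [← Over.comp_left, φ.hom_inv_id, Over.id_left]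
  intro y t
  obtain ⟨x, rfl⟩ : ∃ x, φ.hom.left x = y := ⟨φ.inv.left y, by
    rw [← Scheme.Hom.comp_apply, h0]; rfl⟩
  have hb : Function.Bijective (φ.hom.left.stalkMap x) :=
    ConcreteCategory.bijective_of_isIso (φ.hom.left.stalkMap x)
  -- Injectivity of the stalk map of `φ.hom` moves the claim to the composite `φ.hom ≫ φ.inv`, which
  -- is the identity.
  apply hb.1
  rw [← h]
  have key (t) : φ.hom.left.stalkMap x (φ.inv.left.stalkMap (φ.hom.left x) t) =
      (φ.hom.left ≫ φ.inv.left).stalkMap x t := by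
    rw [Scheme.Hom.stalkMap_comp]; rfl
  rw [key, key]
  exact X.der.stalk_stalkMap_of_eq_id h1 x t

theorem DiffScheme.IsDifferential.mem_diffPoints {f : X.toOver ⟶ Y.toOver}
    (h : DiffScheme.IsDifferential f) {x : X.toOver.left} (hx : x ∈ X.diffPoints) :
    f.left x ∈ Y.diffPoints := by
  rw [DiffScheme.isDifferential_iff_stalk] at h
  rw [DiffScheme.mem_diffPoints_iff] at hx ⊢
  intro t ht
  have h1 (t) : t ∈ IsLocalRing.maximalIdeal (Y.toOver.left.presheaf.stalk (f.left x)) ↔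
      f.left.stalkMap x t ∈ IsLocalRing.maximalIdeal (X.toOver.left.presheaf.stalk x) :=
    (map_mem_nonunits_iff (f.left.stalkMap x).hom t).symm
  rw [h1] at ht ⊢
  rw [← h]
  exact hx _ ht

/-- The map of spaces of differential points that is induced by a differential morphism. -/
noncomputable def DiffScheme.mapDiff {f : X.toOver ⟶ Y.toOver} (h : DiffScheme.IsDifferential f)
    (x : X.Diff) : Y.Diff := ⟨f.left x.1, h.mem_diffPoints x.2⟩

theorem DiffScheme.IsClosedPoint.map {φ : X.toOver ≅ Y.toOver}
    (h : DiffScheme.IsDifferential φ.hom) {x : X.Diff} (hx : X.IsClosedPoint x) :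
    Y.IsClosedPoint (DiffScheme.mapDiff h x) := by
  have h0 : φ.inv.left ≫ φ.hom.left = 𝟙 _ := by rw [← Over.comp_left, φ.inv_hom_id, Over.id_left]
  have h1 : φ.hom.left ≫ φ.inv.left = 𝟙 _ := by rw [← Over.comp_left, φ.hom_inv_id, Over.id_left]
  have e : ({DiffScheme.mapDiff h x} : Set Y.Diff) = DiffScheme.mapDiff h.inv ⁻¹' {x} := by
    ext y
    simp only [Set.mem_singleton_iff, Set.mem_preimage]
    have a0 : φ.hom.left (φ.inv.left y.1) = y.1 := by rw [← Scheme.Hom.comp_apply, h0]; rfl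
    have a1 : φ.inv.left (φ.hom.left x.1) = x.1 := by rw [← Scheme.Hom.comp_apply, h1]; rfl
    constructor
    · rintro rfl
      exact Subtype.ext a1
    · rintro rfl
      exact Subtype.ext a0.symm
  rw [DiffScheme.IsClosedPoint, e]
  refine IsClosed.preimage ?_ hx
  exact Continuous.subtype_mk (φ.inv.left.continuous.comp continuous_subtype_val) _

/-- The homomorphism of residue fields that is induced by a differential morphism. -/
noncomputable def DiffScheme.mapKappa {f : X.toOver ⟶ Y.toOver} (h : DiffScheme.IsDifferential f)
    (x : X.Diff) : Y.kappa (DiffScheme.mapDiff h x) →+* X.kappa x :=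
  (f.left.residueFieldMap x.1).hom

theorem DiffScheme.mapKappa_toKappa {f : X.toOver ⟶ Y.toOver} (h : DiffScheme.IsDifferential f)
    (x : X.Diff) (t) : DiffScheme.mapKappa h x (Y.toKappa (DiffScheme.mapDiff h x) t) =
      X.toKappa x (f.left.stalkMap x.1 t) :=
  congr($(Scheme.residue_residueFieldMap f.left x.1) t)

theorem DiffScheme.mapKappa_deriv {f : X.toOver ⟶ Y.toOver} (h : DiffScheme.IsDifferential f)
    (x : X.Diff) (a) : DiffScheme.mapKappa h x a′ = (DiffScheme.mapKappa h x a)′ := by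
  obtain ⟨t, rfl⟩ := Y.toKappa_surjective _ a
  rw [DiffScheme.toKappa_deriv, DiffScheme.mapKappa_toKappa, DiffScheme.mapKappa_toKappa,
    DiffScheme.toKappa_deriv]
  exact congrArg _ ((DiffScheme.isDifferential_iff_stalk f).mp h x.1 t).symm

theorem DiffScheme.mapKappa_algebraMap {f : X.toOver ⟶ Y.toOver}
    (h : DiffScheme.IsDifferential f) (x : X.Diff) (a : K) :
    DiffScheme.mapKappa h x (algebraMap K _ a) = algebraMap K _ a := by
  have h1 := DiffScheme.mapKappa_toKappa h x
    (Y.toOver.left.presheaf.germ ⊤ (f.left x.1) (TopologicalSpace.Opens.mem_top _)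
      (scalar Y.toOver ⊤ a))
  refine h1.trans ?_
  rw [Scheme.Hom.germ_stalkMap_apply, app_scalar]
  rfl

theorem DiffScheme.bijective_mapKappa {φ : X.toOver ≅ Y.toOver}
    (h : DiffScheme.IsDifferential φ.hom) (x : X.Diff) :
    Function.Bijective (DiffScheme.mapKappa h x) := by
  have : IsIso φ.hom.left := inferInstanceAs (IsIso ((Over.forget _).map φ.hom))
  exact ConcreteCategory.bijective_of_isIso (φ.hom.left.residueFieldMap x.1)

end DiffSchemes

/-! ### Solutions of automorphic systems -/

section Solutions

variable {C K : Type u} [Field C] [Field K] [Algebra C K]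
variable {R R' : Type u} [CommRing R] [Algebra C R] [Algebra K R] [IsScalarTower C K R]
  [CommRing R'] [Algebra C R'] [Algebra K R'] [IsScalarTower C K R']

/-- The homomorphism to the dual numbers given by a derivation. -/
noncomputable def flow (δ : Derivation C R R) : R →ₐ[C] DualNumber R :=
  dualAlgHom (AlgHom.id C R) δ.toLinearMap.toAddMonoidHom (fun a b => δ.leibniz a b)
    (fun c => δ.map_algebraMap c)

theorem dualMap_comp_flow (ψ : R →ₐ[C] R') {δ : Derivation C R R} {δ' : Derivation C R' R'}
    (h : ∀ a, ψ (δ a) = δ' (ψ a)) : (dualMap ψ).comp (flow δ) = (flow δ').comp ψ :=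
  AlgHom.ext fun a => TrivSqZeroExt.ext rfl (h a)

theorem dualMap_comp_dualInl (ψ : R →ₐ[C] R') :
    (dualMap ψ).comp (dualInl C R) = (dualInl C R').comp ψ :=
  AlgHom.ext fun _ => TrivSqZeroExt.ext rfl (map_zero ψ)

variable {G : Over (Spec (.of C))}

/-- A point is constant if it is invariant under the flow of the derivation. -/
def IsConstantPoint (δ : Derivation C R R) (h : specOver C R ⟶ G) : Prop :=
  specOverMap (flow δ) ≫ h = specOverMap (dualInl C R) ≫ h

theorem isConstantPoint_pointOf_iff (δ : Derivation C R R) {V : G.left.Opens}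
    (hV : IsAffineOpen V) (φ : Γ(G.left, V) →ₐ[C] R) :
    IsConstantPoint δ (pointOf hV φ) ↔ ∀ s, δ (φ s) = 0 := by
  rw [IsConstantPoint, specOverMap_pointOf, specOverMap_pointOf]
  refine ⟨fun h s => congr(($(pointOf_injective hV h) s).snd), fun h => ?_⟩
  congr 1
  exact AlgHom.ext fun s => TrivSqZeroExt.ext rfl (h s)

theorem exists_pointOf_of_field {L : Type u} [Field L] [Algebra C L] (h : specOver C L ⟶ G) :
    ∃ (V : G.left.Opens) (hV : IsAffineOpen V) (φ : Γ(G.left, V) →ₐ[C] L), h = pointOf hV φ := by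
  obtain ⟨V, hV, φ, -, h⟩ := exists_isAffineOpen_pointOf h (U := ⊤)
    (TopologicalSpace.Opens.mem_top _)
  exact ⟨V, hV, φ, h⟩

/-- A constant point with values in a field is defined over the field of constants. -/
theorem IsConstantPoint.exists_eq {M C' : Type u} [Field M] [Algebra C M] [Field C'] [Algebra C C']
    {δ : Derivation C M M} (j : C' →ₐ[C] M) (hj : ∀ c, δ c = 0 → ∃ a, j a = c)
    {h : specOver C M ⟶ G} (hh : IsConstantPoint δ h) :
    ∃ k : specOver C C' ⟶ G, h = specOverMap j ≫ k := by
  obtain ⟨V, hV, φ, rfl⟩ := exists_pointOf_of_field h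
  rw [isConstantPoint_pointOf_iff] at hh
  let e := AlgEquiv.ofInjectiveField j
  let φ' : Γ(G.left, V) →ₐ[C] C' := e.symm.toAlgHom.comp (φ.codRestrict j.range
    (fun s => hj _ (hh s)))
  refine ⟨pointOf hV φ', ?_⟩
  rw [specOverMap_pointOf]
  congr 1
  refine AlgHom.ext fun s => ?_
  have := congrArg Subtype.val (e.apply_symm_apply (φ.codRestrict j.range (fun s => hj _ (hh s)) s))
  exact this.symm

open scoped MonObj

variable [GrpObj G]

/-- The solutions of the automorphic system of `A` with values in a differential algebra. -/
def IsSolution (A : AutomorphicField G K) (δ : Derivation C R R) (h : specOver C R ⟶ G) : Prop :=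
  specOverMap (flow δ) ≫ h = tangentAt A R * (specOverMap (dualInl C R) ≫ h)

/-- Comparing `ε`-coefficients turns the identity in the group `G(R[ε])` into the differential
equation for the coordinates `φ s`. -/
theorem isSolution_pointOf_iff [IsAlgClosed C] [IsReduced G.left] [LocallyOfFiniteType G.hom]
    (A : AutomorphicField G K) (δ : Derivation C R R) {V : G.left.Opens} (hV : IsAffineOpen V)
    (φ : Γ(G.left, V) →ₐ[C] R) :
    IsSolution A δ (pointOf hV φ) ↔ ∀ s, δ (φ s) = fieldEval φ s (toField A) := by
  rw [IsSolution, specOverMap_pointOf, ← pointOf_fieldPoint]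
  refine ⟨fun h s => congr(($(pointOf_injective hV h) s).snd), fun h => ?_⟩
  congr 1
  exact AlgHom.ext fun s => TrivSqZeroExt.ext rfl (h s)

/-- A differential homomorphism intertwines the two flows and respects the inclusions into dual
numbers and `tangentAt A`, so the defining identity is carried along. -/
theorem IsSolution.map {A : AutomorphicField G K} {δ : Derivation C R R}
    {δ' : Derivation C R' R'} {h : specOver C R ⟶ G} (hh : IsSolution A δ h) (ψ : R →ₐ[K] R')
    (hψ : ∀ a, ψ (δ a) = δ' (ψ a)) :
    IsSolution A δ' (specOverMap (ψ.restrictScalars C) ≫ h) := by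
  have h1 := congr(specOverMap (dualMap (ψ.restrictScalars C)) ≫ $hh)
  rw [MonObj.comp_mul, specOverMap_tangentAt, ← Category.assoc, specOverMap_comp,
    dualMap_comp_flow (ψ.restrictScalars C) hψ, ← specOverMap_comp, Category.assoc,
    ← Category.assoc (specOverMap (dualMap (ψ.restrictScalars C))), specOverMap_comp,
    dualMap_comp_dualInl, ← specOverMap_comp, Category.assoc] at h1
  exact h1

/-- The factor `tangentAt A R` depends on `A` alone and stands on the left in both equations, so it
cancels in `h⁻¹ * h'`. -/
theorem IsSolution.isConstantPoint {A : AutomorphicField G K} {δ : Derivation C R R}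
    {h h' : specOver C R ⟶ G} (hh : IsSolution A δ h) (hh' : IsSolution A δ h') :
    IsConstantPoint δ (h⁻¹ * h') := by
  rw [IsSolution] at hh hh'
  rw [IsConstantPoint, MonObj.comp_mul, MonObj.comp_mul, GrpObj.comp_inv, GrpObj.comp_inv, hh, hh',
    mul_inv_rev, mul_assoc, inv_mul_cancel_left]

end Solutions

/-! ### Derivations of base changes -/

section BaseChange

variable {C K : Type u} [Field C] [Field K] [Algebra C K]

/-- The local ring is a localization of a tensor product, so a map with the Leibniz rule is fixed by
functions pulled back from `Y` and by scalars. Comparisons of derivations on `Y_K` reduce to these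
two kinds of elements. -/
theorem isPullback_leibniz_ext {X Y S : Scheme.{u}} {F : CommRingCat.{u}} {g : X ⟶ Y}
    {q : X ⟶ Spec F} {p : Y ⟶ S} {f : Spec F ⟶ S} [IsAffine S] (H : IsPullback g q p f) (x : X)
    {V : Y.Opens} (hV : IsAffineOpen V) (hx : x ∈ g ⁻¹ᵁ V) {T : Type u} [CommRing T]
    (ρ : X.presheaf.stalk x →+* T) {d₁ d₂ : X.presheaf.stalk x →+ T}
    (h₁ : ∀ a b, d₁ (a * b) = ρ a * d₁ b + ρ b * d₁ a)
    (h₂ : ∀ a b, d₂ (a * b) = ρ a * d₂ b + ρ b * d₂ a)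
    (hl : ∀ s, d₁ (X.presheaf.germ (g ⁻¹ᵁ V) x hx (g.app V s)) =
      d₂ (X.presheaf.germ (g ⁻¹ᵁ V) x hx (g.app V s)))
    (hr : ∀ a, d₁ (X.presheaf.germ (g ⁻¹ᵁ V) x hx (q.appLE ⊤ _ (le_preimage_top q _) a)) =
      d₂ (X.presheaf.germ (g ⁻¹ᵁ V) x hx (q.appLE ⊤ _ (le_preimage_top q _) a))) : d₁ = d₂ := by
  have hgaff : IsAffineHom g := MorphismProperty.of_isPullback H.flip inferInstance
  let := X.presheaf.algebra_section_stalk (U := g ⁻¹ᵁ V) ⟨x, hx⟩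
  have := (hV.preimage g).isLocalization_stalk ⟨x, hx⟩
  exact leibniz_ext (isPushout_sections H V hV)
    ((hV.preimage g).primeIdealOf ⟨x, hx⟩).asIdeal.primeCompl ρ h₁ h₂ hl hr

theorem baseChange_leibniz_ext (Y : Over (Spec (.of C))) (x : (baseChange K Y).left)
    {V : Y.left.Opens} (hV : IsAffineOpen V) (hx : x ∈ proj K Y ⁻¹ᵁ V) {T : Type u} [CommRing T]
    (ρ : (baseChange K Y).left.presheaf.stalk x →+* T)
    {d₁ d₂ : (baseChange K Y).left.presheaf.stalk x →+ T}
    (h₁ : ∀ a b, d₁ (a * b) = ρ a * d₁ b + ρ b * d₁ a)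
    (h₂ : ∀ a b, d₂ (a * b) = ρ a * d₂ b + ρ b * d₂ a)
    (hl : ∀ s, d₁ ((baseChange K Y).left.presheaf.germ _ x hx ((proj K Y).app V s)) =
      d₂ ((baseChange K Y).left.presheaf.germ _ x hx ((proj K Y).app V s)))
    (hr : ∀ a, d₁ ((baseChange K Y).left.presheaf.germ _ x hx (scalar (baseChange K Y) _ a)) =
      d₂ ((baseChange K Y).left.presheaf.germ _ x hx (scalar (baseChange K Y) _ a))) : d₁ = d₂ := by
  refine isPullback_leibniz_ext (IsPullback.of_hasPullback Y.hom (specMap C K)) x hV hx ρ h₁ h₂ hl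
    fun k => ?_
  obtain ⟨a, rfl⟩ := (Scheme.ΓSpecIso (.of K)).symm.commRingCatIsoToRingEquiv.surjective k
  exact hr a

theorem map_vectorFieldApply {Y : Over (Spec (.of C))} {V : Y.left.Opens} {R : Type u} [CommRing R]
    [Algebra C R] [Algebra K R] [IsScalarTower C K R] (φ : Γ(Y.left, V) →ₐ[C] R)
    (θ : Γ((baseChange K Y).left, proj K Y ⁻¹ᵁ V) →+* R)
    (hφ : ∀ s, θ ((proj K Y).app V s) = φ s)
    (hK : ∀ a, θ (scalar (baseChange K Y) _ a) = algebraMap K R a) (s : Γ(Y.left, V))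
    (A : VectorField Y ⊗[C] K) : θ (vectorFieldApply Y V s A) = fieldEval φ s A := by
  induction A with
  | zero => rw [map_zero, map_zero, map_zero]
  | tmul X k => rw [vectorFieldApply_tmul, fieldEval_tmul, map_mul, hφ, hK, mul_comm]
  | add A B hA hB =>
    rw [map_add, map_add, map_add]
    exact congrArg₂ (· + ·) hA hB

variable [Differential K] [ConstantBase C K]

theorem nonautonomous_der_proj (Y : Over (Spec (.of C))) (A : VectorField Y ⊗[C] K)
    (V : Y.left.Opens) (s : Γ(Y.left, V)) :
    (nonautonomous Y A).der.app (proj K Y ⁻¹ᵁ V) ((proj K Y).app V s) = vectorFieldApply Y V s A :=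
  (existsUnique_nonautonomous Y A).choose_spec.1.1 V s

/-- A morphism to a base change is differential if it is so on the sections of `Y`. -/
theorem isDifferential_of_stalk {X : DiffScheme K} {Y : Over (Spec (.of C))}
    {A : VectorField Y ⊗[C] K} (f : X.toOver ⟶ (nonautonomous Y A).toOver)
    (h : ∀ x : X.toOver.left, ∃ (V : Y.left.Opens) (_ : IsAffineOpen V)
      (hx : f.left x ∈ proj K Y ⁻¹ᵁ V), ∀ s : Γ(Y.left, V),
        X.der.stalk x (f.left.stalkMap x
          ((baseChange K Y).left.presheaf.germ _ (f.left x) hx ((proj K Y).app V s))) =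
        f.left.stalkMap x
          ((baseChange K Y).left.presheaf.germ _ (f.left x) hx (vectorFieldApply Y V s A))) :
    DiffScheme.IsDifferential f := by
  rw [DiffScheme.isDifferential_iff_stalk]
  intro x t
  obtain ⟨V, hV, hx, hs⟩ := h x
  let ρ := (f.left.stalkMap x).hom
  let d₁ := (X.der.stalk x).toLinearMap.toAddMonoidHom.comp ρ.toAddMonoidHom
  let d₂ := ρ.toAddMonoidHom.comp
    ((nonautonomous Y A).der.stalk (f.left x)).toLinearMap.toAddMonoidHom
  -- Both composites obey the Leibniz rule along `ρ`. On scalars they agree because `f` is a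
  -- morphism over `K`, which leaves only the functions on `Y`.
  have key : d₁ = d₂ := by
    refine baseChange_leibniz_ext Y (f.left x) hV hx ρ (fun a b => ?_) (fun a b => ?_)
      (fun s => ?_) (fun a => ?_)
    · change X.der.stalk x (ρ (a * b)) = ρ a * X.der.stalk x (ρ b) + ρ b * X.der.stalk x (ρ a)
      exact (congrArg (X.der.stalk x) (RingHom.map_mul ρ a b)).trans
        ((X.der.stalk x).leibniz (ρ a) (ρ b))
    · exact (congrArg ρ (((nonautonomous Y A).der.stalk (f.left x)).leibniz a b)).trans
        ((RingHom.map_add ρ _ _).trans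
          (congrArg₂ (· + ·) (RingHom.map_mul ρ _ _) (RingHom.map_mul ρ _ _)))
    · refine (hs s).trans (congrArg ρ ?_)
      exact ((SchemeDerivation.stalk_germ ..).trans
        (congrArg _ (nonautonomous_der_proj Y A V s))).symm
    · have e1 (b : K) : ρ ((baseChange K Y).left.presheaf.germ (proj K Y ⁻¹ᵁ V) (f.left x) hx
          (scalar (baseChange K Y) _ b)) =
          X.toOver.left.presheaf.germ (f.left ⁻¹ᵁ proj K Y ⁻¹ᵁ V) x hx (scalar X.toOver _ b) :=
        (Scheme.Hom.germ_stalkMap_apply f.left _ x hx _).trans (congrArg _ (app_scalar f _ b))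
      refine (congrArg (X.der.stalk x) (e1 a)).trans ?_
      refine (SchemeDerivation.stalk_germ ..).trans ?_
      rw [X.der_scalar]
      refine (e1 _).symm.trans (congrArg ρ ?_)
      exact ((SchemeDerivation.stalk_germ ..).trans
        (congrArg _ ((nonautonomous Y A).der_scalar _ a))).symm
  exact DFunLike.congr_fun key t

end BaseChange

theorem fieldEval_extendCoefficients {C K L R : Type u} [Field C] [Field K] [Field L] [Algebra C K]
    [Algebra C L] [Algebra K L] [IsScalarTower C K L] [CommRing R] [Algebra C R] [Algebra K R]
    [Algebra L R] [IsScalarTower C K R] [IsScalarTower C L R] [IsScalarTower K L R]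
    {G : Over (Spec (.of C))} [GrpObj G] {V : G.left.Opens} (φ : Γ(G.left, V) →ₐ[C] R)
    (s : Γ(G.left, V)) (A : AutomorphicField G K) :
    fieldEval φ s (toField (extendCoefficients G L A)) = fieldEval φ s (toField A) := by
  let τ := (rightInvariant G).subtype.rTensor K
  let τ' := (rightInvariant G).subtype.rTensor L
  let ε := (IsScalarTower.toAlgHom C K L).toLinearMap.lTensor (rightInvariant G)
  have key : ((fieldEval φ s).comp τ').comp ε = (fieldEval φ s).comp τ := by
    refine TensorProduct.ext' fun X k => ?_
    refine (fieldEval_tmul φ s X.1 (algebraMap K L k)).trans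
      (Eq.trans ?_ (fieldEval_tmul φ s X.1 k).symm)
    rw [← IsScalarTower.algebraMap_apply]
  exact LinearMap.congr_fun key A

/-! ### Closed differential points -/

section ClosedPoints

variable {K : Type u} [Field K] [Differential K] {X : DiffScheme K}

/-- The derivation of the sections over an open subset. -/
noncomputable abbrev DiffScheme.sectionsDifferential (X : DiffScheme K) (U : X.toOver.left.Opens) :
    Differential Γ(X.toOver.left, U) := ⟨X.der.app U⟩

theorem DiffScheme.exists_diff_of_prime {U : X.toOver.left.Opens} (hU : IsAffineOpen U)
    (P : Ideal Γ(X.toOver.left, U)) (hP : P.IsPrime) (hD : ∀ a ∈ P, X.der.app U a ∈ P) :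
    ∃ (x : X.Diff) (hx : x.1 ∈ U), (hU.primeIdealOf ⟨x.1, hx⟩).asIdeal = P := by
  let p : Spec Γ(X.toOver.left, U) := ⟨P, hP⟩
  have hx : hU.fromSpec p ∈ U := by
    have : hU.fromSpec p ∈ Set.range hU.fromSpec := ⟨p, rfl⟩
    rwa [hU.range_fromSpec] at this
  have hp : hU.primeIdealOf ⟨hU.fromSpec p, hx⟩ = p :=
    hU.fromSpec.isOpenEmbedding.injective (hU.fromSpec_primeIdealOf ⟨_, hx⟩)
  have hp' : (hU.primeIdealOf ⟨hU.fromSpec p, hx⟩).asIdeal = P := by rw [hp]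
  refine ⟨⟨hU.fromSpec p, DiffScheme.mem_diffPoints_of_isAffineOpen hU hx ?_⟩, hx, hp'⟩
  rw [hp']
  exact hD

theorem DiffScheme.isUnit_natCast_sections [CharZero K] (U : X.toOver.left.Opens) (n : ℕ)
    (hn : n ≠ 0) : IsUnit (n : Γ(X.toOver.left, U)) :=
  isUnit_natCast_of_algebra K n hn

theorem DiffScheme.nonempty_diff [CharZero K] [Nonempty X.toOver.left] : Nonempty X.Diff := by
  obtain ⟨z⟩ := ‹Nonempty X.toOver.left›
  obtain ⟨U, hU, hz, -⟩ := exists_isAffineOpen_mem_and_subset (X := X.toOver.left) (U := ⊤) (x := z)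
    (TopologicalSpace.Opens.mem_top _)
  let := X.sectionsDifferential U
  have hne : (⊥ : Ideal Γ(X.toOver.left, U)) ≠ ⊤ := fun h =>
    (hU.primeIdealOf ⟨z, hz⟩).isPrime.ne_top (top_le_iff.mp (h ▸ bot_le))
  obtain ⟨P, -, hP, hD, -⟩ := exists_prime_differentialIdeal
    (DiffScheme.isUnit_natCast_sections U) (I := ⊥) (fun a ha => by
      rw [Ideal.mem_bot] at ha ⊢
      rw [ha, map_zero]) hne
  obtain ⟨x, -⟩ := DiffScheme.exists_diff_of_prime hU P hP hD
  exact ⟨x⟩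

/-- A scheme of finite type over a field has a noetherian space, and so has any subspace. A nonempty
compact space with the `T₀` property has a closed point. -/
theorem DiffScheme.exists_isClosedPoint [CharZero K] [Nonempty X.toOver.left]
    [LocallyOfFiniteType X.toOver.hom] [QuasiCompact X.toOver.hom] :
    ∃ x : X.Diff, X.IsClosedPoint x := by
  have : IsLocallyNoetherian X.toOver.left :=
    LocallyOfFiniteType.isLocallyNoetherian X.toOver.hom
  have : CompactSpace X.toOver.left :=
    QuasiCompact.compactSpace_of_compactSpace X.toOver.hom
  have : IsNoetherian X.toOver.left := { }
  have : TopologicalSpace.NoetherianSpace X.toOver.left := inferInstance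
  have : TopologicalSpace.NoetherianSpace X.Diff :=
    Topology.IsInducing.subtypeVal.noetherianSpace
  have : Nonempty X.Diff := DiffScheme.nonempty_diff
  obtain ⟨x, -, hx⟩ := IsClosed.exists_closed_singleton (isClosed_univ (X := X.Diff))
    Set.univ_nonempty
  exact ⟨x, hx⟩

/-- A proper differential ideal above the prime of `x` lies in a differential prime, that is, in a
specialization of `x` within `Diff`. Closedness in `Diff` makes this specialization equal to `x`;
the point need not be closed in the scheme. -/
theorem DiffScheme.IsClosedPoint.eq_or_eq_top [CharZero K] {x : X.Diff} (h : X.IsClosedPoint x)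
    {U : X.toOver.left.Opens} (hU : IsAffineOpen U) (hx : x.1 ∈ U)
    (J : Ideal Γ(X.toOver.left, U)) (hJ : ∀ a ∈ J, X.der.app U a ∈ J)
    (hle : (hU.primeIdealOf ⟨x.1, hx⟩).asIdeal ≤ J) :
    J = (hU.primeIdealOf ⟨x.1, hx⟩).asIdeal ∨ J = ⊤ := by
  refine or_iff_not_imp_right.mpr fun hne => ?_
  let := X.sectionsDifferential U
  obtain ⟨P, hJP, hP, hD, -⟩ := exists_prime_differentialIdeal
    (DiffScheme.isUnit_natCast_sections U) (I := J) hJ hne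
  obtain ⟨y, hy, hyP⟩ := DiffScheme.exists_diff_of_prime hU P hP hD
  have hs : hU.primeIdealOf ⟨x.1, hx⟩ ⤳ hU.primeIdealOf ⟨y.1, hy⟩ := by
    rw [← PrimeSpectrum.le_iff_specializes]
    change (hU.primeIdealOf ⟨x.1, hx⟩).asIdeal ≤ (hU.primeIdealOf ⟨y.1, hy⟩).asIdeal
    rw [hyP]
    exact hle.trans hJP
  have hs' := hs.map hU.fromSpec.continuous
  rw [hU.fromSpec_primeIdealOf, hU.fromSpec_primeIdealOf] at hs'
  have hs'' : x ⤳ y := Topology.IsInducing.subtypeVal.specializes_iff.mp hs'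
  have hyx : y = x := by
    have := hs''.mem_closed h rfl
    exact this
  subst hyx
  exact le_antisymm (hyP ▸ hJP) hle

theorem DiffScheme.eval_eq_zero_iff {x : X.Diff} {U : X.toOver.left.Opens} (hU : IsAffineOpen U)
    (hx : x.1 ∈ U) (s : Γ(X.toOver.left, U)) :
    X.eval x U hx s = 0 ↔ s ∈ (hU.primeIdealOf ⟨x.1, hx⟩).asIdeal := by
  rw [mem_primeIdealOf_iff, ← IsLocalRing.residue_eq_zero_iff]
  rfl

theorem DiffScheme.exists_eval_div {x : X.Diff} {U : X.toOver.left.Opens} (hU : IsAffineOpen U)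
    (hx : x.1 ∈ U) (z : X.kappa x) :
    ∃ a b : Γ(X.toOver.left, U), z = X.eval x U hx a / X.eval x U hx b := by
  obtain ⟨t, rfl⟩ := X.toKappa_surjective x z
  let := X.toOver.left.presheaf.algebra_section_stalk (U := U) ⟨x.1, hx⟩
  have := hU.isLocalization_stalk ⟨x.1, hx⟩
  have hg (a : Γ(X.toOver.left, U)) : algebraMap Γ(X.toOver.left, U) _ a =
    X.toOver.left.presheaf.germ U x.1 hx a := rfl
  obtain ⟨⟨s, u⟩, hsu⟩ :=
    IsLocalization.surj (hU.primeIdealOf ⟨x.1, hx⟩).asIdeal.primeCompl t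
  rw [hg, hg] at hsu
  refine ⟨s, u.1, ?_⟩
  have hu : X.eval x U hx u.1 ≠ 0 := fun h => u.2 ((DiffScheme.eval_eq_zero_iff hU hx _).mp h)
  rw [eq_div_iff hu, ← X.toKappa_germ, ← X.toKappa_germ, ← map_mul, ← hsu]

/-- The residue field of a closed differential point is the fraction field of a finitely generated
differentially simple algebra. -/
theorem DiffScheme.IsClosedPoint.exists_model [CharZero K] [LocallyOfFiniteType X.toOver.hom]
    {x : X.Diff} (h : X.IsClosedPoint x) :
    ∃ (B : Type u) (_ : CommRing B) (_ : Differential B) (_ : Algebra K B)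
      (_ : DifferentialAlgebra K B) (_ : Algebra B (X.kappa x))
      (_ : DifferentialAlgebra B (X.kappa x)) (_ : IsScalarTower K B (X.kappa x)),
      IsDifferentialSimple B ∧ Algebra.FiniteType K B ∧ IsFractionRing B (X.kappa x) := by
  obtain ⟨U, hU, hx, -⟩ := exists_isAffineOpen_mem_and_subset (X := X.toOver.left) (U := ⊤)
    (x := x.1) (TopologicalSpace.Opens.mem_top _)
  let := X.sectionsDifferential U
  let P := (hU.primeIdealOf ⟨x.1, hx⟩).asIdeal
  have hPp : P.IsPrime := (hU.primeIdealOf ⟨x.1, hx⟩).isPrime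
  have hP : IsDifferentialIdeal P := x.2 U hU hx
  let := quotientDifferential hP
  let θ : Γ(X.toOver.left, U) ⧸ P →+* X.kappa x := Ideal.Quotient.lift P (X.eval x U hx)
    (fun a ha => (DiffScheme.eval_eq_zero_iff hU hx a).mpr ha)
  let := θ.toAlgebra
  have hθ (a : Γ(X.toOver.left, U)) :
      algebraMap (Γ(X.toOver.left, U) ⧸ P) (X.kappa x) (Ideal.Quotient.mk P a) =
        X.eval x U hx a := rfl
  have hinj : Function.Injective θ := by
    refine (injective_iff_map_eq_zero θ).mpr fun b hb => ?_
    obtain ⟨a, rfl⟩ := Ideal.Quotient.mk_surjective b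
    exact Ideal.Quotient.eq_zero_iff_mem.mpr ((DiffScheme.eval_eq_zero_iff hU hx a).mp hb)
  have hfin := finiteType_sections X.toOver hU
  refine ⟨Γ(X.toOver.left, U) ⧸ P, inferInstance, inferInstance, inferInstance, ⟨fun a => ?_⟩,
    inferInstance, ⟨fun b => ?_⟩, ?_, ?_, ?_, ?_⟩
  · change (Ideal.Quotient.mk P (scalar X.toOver U a))′ = Ideal.Quotient.mk P (scalar X.toOver U a′)
    rw [← X.der_scalar]
    exact quotientDifferential_mk hP _
  · obtain ⟨a, rfl⟩ := Ideal.Quotient.mk_surjective b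
    have h1 : (Ideal.Quotient.mk P a)′ = Ideal.Quotient.mk P a′ := quotientDifferential_mk hP a
    rw [h1, hθ, hθ, X.deriv_eval]
    rfl
  · exact IsScalarTower.of_algebraMap_eq fun a => (X.eval_scalar x U hx a).symm
  -- Closedness of `x` means that `P` is maximal among the proper differential ideals.
  · exact isDifferentialSimple_quotient hP hPp.ne_top fun J hJ hle => h.eq_or_eq_top hU hx J hJ hle
  · exact Algebra.FiniteType.of_surjective (Ideal.Quotient.mkₐ K P) Ideal.Quotient.mk_surjective
  · have : FaithfulSMul (Γ(X.toOver.left, U) ⧸ P) (X.kappa x) :=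
      (faithfulSMul_iff_algebraMap_injective _ _).mpr hinj
    refine IsFractionRing.of_field _ _ fun z => ?_
    obtain ⟨a, b, rfl⟩ := DiffScheme.exists_eval_div hU hx z
    exact ⟨Ideal.Quotient.mk P a, Ideal.Quotient.mk P b, rfl⟩

theorem DiffScheme.IsClosedPoint.constants_eq [CharZero K] [IsAlgClosed (constants K)]
    [LocallyOfFiniteType X.toOver.hom] {x : X.Diff} (h : X.IsClosedPoint x) :
    constants (X.kappa x) = (constants K).map (algebraMap K (X.kappa x)) := by
  obtain ⟨B, _, _, _, _, _, _, _, hB, _, _⟩ := h.exists_model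
  have := hB.isDomain (isUnit_natCast_of_algebra K)
  refine le_antisymm (fun c hc => ?_) ?_
  · obtain ⟨a, rfl⟩ := exists_constant_of_isDifferentialSimple hB (K := K) (L := X.kappa x) hc
    exact ⟨a, a.2, rfl⟩
  · rintro _ ⟨a, ha, rfl⟩
    have ha' : a′ = 0 := ha
    change (algebraMap K (X.kappa x) a)′ = 0
    rw [deriv_algebraMap, ha', map_zero]

end ClosedPoints

/-! ### Points of base changes -/

section Points

variable {C K : Type u} [Field C] [Field K] [Algebra C K]
variable {R R' : Type u} [CommRing R] [Algebra C R] [Algebra K R] [IsScalarTower C K R]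
  [CommRing R'] [Algebra C R'] [Algebra K R'] [IsScalarTower C K R']
variable {Y Z : Over (Spec (.of C))}

theorem specMap_comp_specMap (C K L : Type u) [Field C] [Field K] [Algebra C K] [CommRing L]
    [Algebra C L] [Algebra K L] [IsScalarTower C K L] :
    Spec.map (CommRingCat.ofHom (algebraMap K L)) ≫ specMap C K =
      Spec.map (CommRingCat.ofHom (algebraMap C L)) := by
  rw [← Spec.map_comp, ← CommRingCat.ofHom_comp, ← IsScalarTower.algebraMap_eq]

/-- The projection to `Y` of a point of `Y_K`. -/
noncomputable def projPoint (p : specOver K R ⟶ baseChange K Y) : specOver C R ⟶ Y :=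
  Over.homMk (p.left ≫ proj K Y) (by
    have h1 : p.left ≫ (baseChange K Y).hom = Spec.map (CommRingCat.ofHom (algebraMap K R)) :=
      Over.w p
    have h2 : proj K Y ≫ Y.hom = (baseChange K Y).hom ≫ specMap C K := pullback.condition
    rw [Category.assoc, h2, ← Category.assoc, h1]
    exact specMap_comp_specMap C K R)

theorem projPoint_left (p : specOver K R ⟶ baseChange K Y) :
    (projPoint p).left = p.left ≫ proj K Y := rfl

theorem projPoint_injective {p p' : specOver K R ⟶ baseChange K Y}
    (h : projPoint p = projPoint p') : p = p' := by
  ext1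
  refine pullback.hom_ext congr(($h).left) ?_
  exact (Over.w p).trans (Over.w p').symm

/-- The point of `Y_K` given by a point of `Y`. -/
theorem exists_projPoint_eq (h : specOver C R ⟶ Y) :
    ∃ p : specOver K R ⟶ baseChange K Y, projPoint p = h := by
  have hw : h.left ≫ Y.hom = Spec.map (CommRingCat.ofHom (algebraMap K R)) ≫ specMap C K := by
    rw [specMap_comp_specMap C K R]
    exact Over.w h
  refine ⟨Over.homMk (pullback.lift h.left (Spec.map (CommRingCat.ofHom (algebraMap K R))) hw)
    (pullback.lift_snd _ _ hw), ?_⟩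
  ext1
  exact pullback.lift_fst _ _ hw

theorem projPoint_specOverMap_comp (p : specOver K R ⟶ baseChange K Y) (ψ : R →ₐ[K] R') :
    projPoint (specOverMap ψ ≫ p) = specOverMap (ψ.restrictScalars C) ≫ projPoint p := by
  ext1
  rw [projPoint_left, Over.comp_left, Over.comp_left, projPoint_left, Category.assoc]
  rfl

theorem projPoint_comp_map (p : specOver K R ⟶ baseChange K Y) (f : Y ⟶ Z) :
    projPoint (p ≫ (Over.pullback (specMap C K)).map f) = projPoint p ≫ f := by
  ext1
  rw [projPoint_left, Over.comp_left, Over.comp_left, projPoint_left, Category.assoc,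
    Category.assoc]
  congr 1
  exact pullback.lift_fst _ _ _

/-- Pull-back of sections to the base change. -/
noncomputable def projAlgHom (V : Y.left.Opens)
    (θ : Γ((baseChange K Y).left, proj K Y ⁻¹ᵁ V) →ₐ[K] R) : Γ(Y.left, V) →ₐ[C] R :=
  { θ.toRingHom.comp ((proj K Y).app V).hom with
    commutes' := fun c => by
      change θ ((proj K Y).app V (scalar Y V c)) = _
      rw [← scalar_baseChange]
      exact (θ.commutes (algebraMap C K c)).trans (IsScalarTower.algebraMap_apply C K R c).symm }

theorem projAlgHom_apply (V : Y.left.Opens)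
    (θ : Γ((baseChange K Y).left, proj K Y ⁻¹ᵁ V) →ₐ[K] R) (s : Γ(Y.left, V)) :
    projAlgHom V θ s = θ ((proj K Y).app V s) := rfl

theorem isAffineOpen_preimage_proj {V : Y.left.Opens} (hV : IsAffineOpen V) :
    IsAffineOpen (proj K Y ⁻¹ᵁ V) := by
  have : IsAffineHom (proj K Y) := MorphismProperty.of_isPullback
    (IsPullback.of_hasPullback Y.hom (specMap C K)).flip inferInstance
  exact hV.preimage (proj K Y)

theorem projPoint_pointOf {V : Y.left.Opens} (hV : IsAffineOpen V)
    (θ : Γ((baseChange K Y).left, proj K Y ⁻¹ᵁ V) →ₐ[K] R) :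
    projPoint (pointOf (Y := baseChange K Y) (isAffineOpen_preimage_proj hV) θ) =
      pointOf hV (projAlgHom V θ) := by
  ext1
  rw [projPoint_left, pointOf_left, pointOf_left, Category.assoc]
  have h := IsAffineOpen.SpecMap_appLE_fromSpec (proj K Y) hV (isAffineOpen_preimage_proj hV) le_rfl
  refine (congrArg (Spec.map (CommRingCat.ofHom θ.toRingHom) ≫ ·) h.symm).trans ?_
  rw [← Category.assoc, ← Spec.map_comp, Scheme.Hom.appLE_eq_app]
  rfl

/-- Differential points of `(G_K, ∂_A)` are solutions: on functions from `G` the derivation `∂_A` is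
the field `A` itself. -/
theorem isSolution_projPoint [Differential K] [ConstantBase C K] [IsAlgClosed C]
    {G : Over (Spec (.of C))} [GrpObj G] [IsReduced G.left] [LocallyOfFiniteType G.hom]
    (A : AutomorphicField G K) (δ : Derivation C R R) {V : G.left.Opens} (hV : IsAffineOpen V)
    (θ : Γ((baseChange K G).left, proj K G ⁻¹ᵁ V) →ₐ[K] R)
    (hθ : ∀ s, δ (θ ((proj K G).app V s)) =
      θ ((automorphicSystem G A).der.app (proj K G ⁻¹ᵁ V) ((proj K G).app V s))) :
    IsSolution A δ
      (projPoint (pointOf (Y := baseChange K G) (isAffineOpen_preimage_proj hV) θ)) := by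
  rw [projPoint_pointOf hV, isSolution_pointOf_iff A δ hV]
  intro s
  rw [projAlgHom_apply, hθ]
  refine (congrArg θ (nonautonomous_der_proj G (toField A) V s)).trans ?_
  exact map_vectorFieldApply (projAlgHom V θ) θ.toRingHom (fun _ => rfl) (fun a => θ.commutes a) s _

end Points

/-! ### Tautological solutions over residue fields and their comparison with other solutions -/

section Kappa

variable {K : Type u} [Field K] [Differential K]

/-- The evaluation at a differential point as a homomorphism of algebras. -/
noncomputable def DiffScheme.evalAlgHom (X : DiffScheme K) (x : X.Diff) (U : X.toOver.left.Opens)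
    (hx : x.1 ∈ U) : Γ(X.toOver.left, U) →ₐ[K] X.kappa x :=
  { X.eval x U hx with commutes' := X.eval_scalar x U hx }

theorem DiffScheme.pointOf_evalAlgHom_left (X : DiffScheme K) (x : X.Diff)
    {U : X.toOver.left.Opens} (hU : IsAffineOpen U) (hx : x.1 ∈ U) :
    (pointOf hU (X.evalAlgHom x U hx)).left = X.toOver.left.fromSpecResidueField x.1 := by
  rw [pointOf_left, Scheme.fromSpecResidueField, ← hU.fromSpecStalk_eq_fromSpecStalk hx]
  change Spec.map (X.toOver.left.presheaf.germ U x.1 hx ≫ X.toOver.left.residue x.1) ≫ _ =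
    _ ≫ Spec.map (X.toOver.left.presheaf.germ U x.1 hx) ≫ _
  rw [Spec.map_comp, Category.assoc]

/-- The point of a scheme with derivation with values in the residue field of a differential
point. -/
noncomputable def DiffScheme.kappaPoint (X : DiffScheme K) (x : X.Diff) :
    specOver K (X.kappa x) ⟶ X.toOver :=
  Over.homMk (X.toOver.left.fromSpecResidueField x.1) (by
    obtain ⟨U, hU, hx, -⟩ := exists_isAffineOpen_mem_and_subset (X := X.toOver.left) (U := ⊤)
      (x := x.1) (TopologicalSpace.Opens.mem_top _)
    rw [← X.pointOf_evalAlgHom_left x hU hx]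
    exact Over.w (pointOf hU (X.evalAlgHom x U hx)))

theorem DiffScheme.kappaPoint_left (X : DiffScheme K) (x : X.Diff) :
    (X.kappaPoint x).left = X.toOver.left.fromSpecResidueField x.1 := rfl

theorem DiffScheme.kappaPoint_eq_pointOf (X : DiffScheme K) (x : X.Diff)
    {U : X.toOver.left.Opens} (hU : IsAffineOpen U) (hx : x.1 ∈ U) :
    X.kappaPoint x = pointOf hU (X.evalAlgHom x U hx) := by
  ext1
  rw [X.pointOf_evalAlgHom_left x hU hx, X.kappaPoint_left]

theorem DiffScheme.kappaPoint_apply (X : DiffScheme K) (x : X.Diff) {M : Type u} [Field M]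
    [Algebra K M] (f : X.kappa x →ₐ[K] M) (z : Spec (.of M)) :
    (specOverMap f ≫ X.kappaPoint x).left z = x.1 := by
  rw [Over.comp_left, Scheme.Hom.comp_apply, X.kappaPoint_left]
  have : X.toOver.left.fromSpecResidueField x.1 ((specOverMap f).left z) ∈
    Set.range (X.toOver.left.fromSpecResidueField x.1) := ⟨_, rfl⟩
  rwa [Scheme.range_fromSpecResidueField, Set.mem_singleton_iff] at this

variable (C L : Type u) [Field C] [Field L] [Differential L] [Algebra C L] [ConstantBase C L] in
/-- The derivation of a differential field as a derivation over a field of constants. -/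
noncomputable def derivOver : Derivation C L L :=
  Derivation.mk'
    { toFun := Differential.deriv
      map_add' := map_add _
      map_smul' := fun c a => by
        rw [Algebra.smul_def, Derivation.leibniz, ConstantBase.deriv_algebraMap_eq_zero, smul_zero,
          add_zero, RingHom.id_apply, smul_eq_mul, Algebra.smul_def] }
    (fun a b => Differential.deriv.leibniz a b)

variable [IsAlgClosed (constants K)] {G : Over (Spec (.of (constants K)))} [GrpObj G]
  [IsReduced G.left] [LocallyOfFiniteType G.hom]

/-- The point of `G` given by a differential point of an automorphic system. -/
noncomputable def solutionAt {A : AutomorphicField G K} (x : (automorphicSystem G A).Diff) :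
    specOver (constants K) ((automorphicSystem G A).kappa x) ⟶ G :=
  projPoint (Y := G) ((automorphicSystem G A).kappaPoint x)

/-- The derivation of `κ(x)` is the one for which evaluation at `x` is differential. -/
theorem isSolution_solutionAt {A : AutomorphicField G K} (x : (automorphicSystem G A).Diff) :
    IsSolution A (derivOver (constants K) ((automorphicSystem G A).kappa x)) (solutionAt x) := by
  obtain ⟨V, hV, hx, -⟩ := exists_isAffineOpen_mem_and_subset (X := G.left) (U := ⊤)
    (x := proj K G x.1) (TopologicalSpace.Opens.mem_top _)
  have hx' : x.1 ∈ proj K G ⁻¹ᵁ V := hx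
  rw [solutionAt, (automorphicSystem G A).kappaPoint_eq_pointOf x
    (isAffineOpen_preimage_proj hV) hx']
  exact isSolution_projPoint A _ hV ((automorphicSystem G A).evalAlgHom x _ hx')
    fun s => (automorphicSystem G A).deriv_eval x _ hx' _

open scoped MonObj

/-- Solutions over a splitting field differ from the solution at a closed differential point by a
constant point. -/
theorem exists_comp_solutionAt_eq [CharZero K] {A : AutomorphicField G K}
    {x : (automorphicSystem G A).Diff} (hx : (automorphicSystem G A).IsClosedPoint x)
    {S : Type u} [Field S] [Differential S] [Algebra K S] [DifferentialAlgebra K S]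
    [IsAlgClosed (constants S)] {h : specOver (constants K) S ⟶ G}
    (hh : IsSolution A (derivOver (constants K) S) h) {C' : Type u} [Field C']
    [Algebra (constants K) C'] (i : C' →ₐ[constants K] S) (hi : ∀ c : S, c′ = 0 → ∃ a, i a = c) :
    ∃ (M : Type u) (_ : Field M) (_ : Differential M) (_ : Algebra K M)
      (f : (automorphicSystem G A).kappa x →ₐ[K] M) (g : S →ₐ[K] M)
      (k : specOver (constants K) C' ⟶ G), (∀ a, f a′ = (f a)′) ∧ (∀ a, g a′ = (g a)′) ∧
      specOverMap (f.restrictScalars (constants K)) ≫ solutionAt x =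
        specOverMap (g.restrictScalars (constants K)) ≫ (h * (specOverMap i ≫ k)) := by
  have : LocallyOfFiniteType (automorphicSystem G A).toOver.hom :=
    inferInstanceAs (LocallyOfFiniteType (pullback.snd G.hom (specMap (constants K) K)))
  obtain ⟨B, _, _, _, _, _, _, _, hB, _, _⟩ := hx.exists_model
  -- The two solutions live over different fields; they are compared in a composite `M` that has
  -- only the constants of `S`.
  obtain ⟨M, _, _, f, g, hfg, hf, hg, hc⟩ :=
    exists_composite (K := K) hB (L := (automorphicSystem G A).kappa x) (S := S)
  let : Algebra K M := (f.comp (algebraMap K _)).toAlgebra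
  let f' : (automorphicSystem G A).kappa x →ₐ[K] M := { f with commutes' := fun _ => rfl }
  let g' : S →ₐ[K] M := { g with commutes' := fun a => (congr($hfg a)).symm }
  have : DifferentialAlgebra K M := ⟨fun a => by
    change (f (algebraMap K _ a))′ = f (algebraMap K _ a′)
    rw [← hf, deriv_algebraMap]⟩
  have h1 := (isSolution_solutionAt x).map (δ' := derivOver (constants K) M) f' hf
  have h2 := hh.map (δ' := derivOver (constants K) M) g' hg
  -- The quotient of the two solutions is a constant point over `M`. Constants of `M` come from `S`
  -- and those of `S` from `C'`, so `k` descends to `C'`. For transitivity `C'` is `constants K`,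
  -- for the embedding it is `constants S`.
  obtain ⟨k, hk⟩ := (h2.isConstantPoint h1).exists_eq ((g'.restrictScalars (constants K)).comp i)
    (fun c hcc => by
      obtain ⟨a, rfl⟩ := hc c hcc
      obtain ⟨b, hb⟩ := hi a a.2
      exact ⟨b, congrArg g hb⟩)
  refine ⟨M, _, _, _, f', g', k, hf, hg, ?_⟩
  rw [MonObj.comp_mul, ← Category.assoc _ (specOverMap i), specOverMap_comp, ← hk,
    mul_inv_cancel_left]

end Kappa

/-! ### Right translations -/

/-- Equal morphisms have preimages that are equal only propositionally, so their sections are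
compared through germs. -/
theorem germ_app_congr {X Y : Scheme.{u}} {f g : X ⟶ Y} (e : f = g) (V : Y.Opens) (s : Γ(Y, V))
    (x : X) (hf : x ∈ f ⁻¹ᵁ V) (hg : x ∈ g ⁻¹ᵁ V) :
    X.presheaf.germ (f ⁻¹ᵁ V) x hf (f.app V s) = X.presheaf.germ (g ⁻¹ᵁ V) x hg (g.app V s) := by
  subst e; rfl

theorem tensorProduct_addHom_congr {R M N P : Type*} [CommSemiring R] [AddCommMonoid M]
    [AddCommMonoid N] [Module R M] [Module R N] [AddCommMonoid P] {u v : M ⊗[R] N →+ P}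
    (h : ∀ m n, u (m ⊗ₜ n) = v (m ⊗ₜ n)) (t : M ⊗[R] N) : u t = v t := by
  induction t with
  | zero => rw [map_zero, map_zero]
  | tmul m n => exact h m n
  | add a b ha hb => rw [map_add, map_add, ha, hb]

section RightTranslation

variable {C K : Type u} [Field C] [Field K] [Algebra C K] (G : Over (Spec (.of C))) [GrpObj G]

/-- Both sides are additive in `A`. For `X ⊗ k` the scalar `k` is preserved by the morphism `f` over
`K`, and `X` commutes with the translation by invariance. -/
theorem germ_vectorFieldApply_rightTranslation (A : AutomorphicField G K)
    (σ : 𝟙_ (Over (Spec (.of C))) ⟶ G) (V : G.left.Opens) (s : Γ(G.left, V))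
    (f : baseChange K G ⟶ baseChange K G)
    (e : f.left ≫ proj K G = proj K G ≫ (rightTranslation G σ).left)
    (x : (baseChange K G).left) (hx : x ∈ f.left ⁻¹ᵁ proj K G ⁻¹ᵁ V)
    (hx' : x ∈ proj K G ⁻¹ᵁ (rightTranslation G σ).left ⁻¹ᵁ V) :
    (baseChange K G).left.presheaf.germ _ x hx' (vectorFieldApply G _
      ((rightTranslation G σ).left.app V s) (toField A)) =
    (baseChange K G).left.presheaf.germ _ x hx
      (f.left.app _ (vectorFieldApply G V s (toField A))) := by
  have hs (t : Γ(G.left, V)) : (baseChange K G).left.presheaf.germ _ x hx'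
      ((proj K G).app _ ((rightTranslation G σ).left.app V t)) =
      (baseChange K G).left.presheaf.germ _ x hx (f.left.app _ ((proj K G).app V t)) := by
    have h := germ_app_congr e V t x hx hx'
    rw [Scheme.Hom.comp_app, Scheme.Hom.comp_app] at h
    exact h.symm
  have hk (k : K) : (baseChange K G).left.presheaf.germ _ x hx' (scalar (baseChange K G) _ k) =
      (baseChange K G).left.presheaf.germ _ x hx (f.left.app _ (scalar (baseChange K G) _ k)) := by
    rw [app_scalar, ← res_scalar (baseChange K G) (le_top :
      proj K G ⁻¹ᵁ (rightTranslation G σ).left ⁻¹ᵁ V ≤ ⊤), ← res_scalar (baseChange K G) (le_top :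
      f.left ⁻¹ᵁ proj K G ⁻¹ᵁ V ≤ ⊤), TopCat.Presheaf.germ_res_apply,
      TopCat.Presheaf.germ_res_apply]
  let τ := ((rightInvariant G).subtype.rTensor K).toAddMonoidHom
  let u : AutomorphicField G K →+ (baseChange K G).left.presheaf.stalk x :=
    ((baseChange K G).left.presheaf.germ _ x hx').hom.toAddMonoidHom.comp
      ((vectorFieldApply G _ ((rightTranslation G σ).left.app V s)).comp τ)
  let v : AutomorphicField G K →+ (baseChange K G).left.presheaf.stalk x :=
    ((baseChange K G).left.presheaf.germ _ x hx).hom.toAddMonoidHom.comp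
      ((f.left.app _).hom.toAddMonoidHom.comp ((vectorFieldApply G V s).comp τ))
  have huv (X : rightInvariant G) (k : K) : u (X ⊗ₜ k) = v (X ⊗ₜ k) := by
    change (baseChange K G).left.presheaf.germ _ x hx' (scalar (baseChange K G) _ k *
        (proj K G).app _ (X.1.1 _ ((rightTranslation G σ).left.app V s))) =
      (baseChange K G).left.presheaf.germ _ x hx (f.left.app _
        (scalar (baseChange K G) _ k * (proj K G).app V (X.1.1 V s)))
    rw [X.2 σ V s, map_mul, map_mul, map_mul, hk]
    exact congrArg _ (hs _)
  exact tensorProduct_addHom_congr huv A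

variable {G}

/-- The right translation of an automorphic system by a rational point. -/
noncomputable def rightTranslationIso [Differential K] [ConstantBase C K] (A : AutomorphicField G K)
    (σ : 𝟙_ (Over (Spec (.of C))) ⟶ G) :
    (automorphicSystem G A).toOver ≅ (automorphicSystem G A).toOver :=
  (Over.pullback (specMap C K)).mapIso (GrpObj.mulRight σ)

/-- The check is needed only on functions pulled back from `G`, where it is the invariance of `A`.
-/
theorem isDifferential_rightTranslationIso [Differential K] [ConstantBase C K]
    (A : AutomorphicField G K) (σ : 𝟙_ (Over (Spec (.of C))) ⟶ G) :
    DiffScheme.IsDifferential (rightTranslationIso A σ).hom := by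
  let f : baseChange K G ⟶ baseChange K G :=
    (Over.pullback (specMap C K)).map (rightTranslation G σ)
  have e : f.left ≫ proj K G = proj K G ≫ (rightTranslation G σ).left := pullback.lift_fst _ _ _
  refine isDifferential_of_stalk (A := toField A) (rightTranslationIso A σ).hom fun x => ?_
  obtain ⟨V, hV, hx, -⟩ := exists_isAffineOpen_mem_and_subset (X := G.left) (U := ⊤)
    (x := proj K G (f.left x)) (TopologicalSpace.Opens.mem_top _)
  have hx₁ : x ∈ f.left ⁻¹ᵁ proj K G ⁻¹ᵁ V := hx
  have hx₂ : x ∈ proj K G ⁻¹ᵁ (rightTranslation G σ).left ⁻¹ᵁ V := by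
    have : x ∈ (f.left ≫ proj K G) ⁻¹ᵁ V := hx
    rw [e] at this
    exact this
  refine ⟨V, hV, hx, fun s => ?_⟩
  have h1 (t : Γ((baseChange K G).left, proj K G ⁻¹ᵁ V)) : f.left.stalkMap x
      ((baseChange K G).left.presheaf.germ _ (f.left x) hx t) =
      (baseChange K G).left.presheaf.germ _ x hx₁ (f.left.app _ t) :=
    Scheme.Hom.germ_stalkMap_apply f.left _ x hx t
  have h2 := germ_app_congr e V s x hx₁ hx₂
  rw [Scheme.Hom.comp_app, Scheme.Hom.comp_app] at h2
  refine (congrArg ((automorphicSystem G A).der.stalk x) ((h1 _).trans h2)).trans ?_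
  refine Eq.trans ?_ (h1 _).symm
  refine ((automorphicSystem G A).der.stalk_germ x _ hx₂ _).trans ?_
  refine (congrArg _ (nonautonomous_der_proj G (toField A) _ _)).trans ?_
  exact germ_vectorFieldApply_rightTranslation G A σ V s f e x hx₁ hx₂

end RightTranslation

/-! ### The action of rational points on closed differential points -/

section Closed

variable {K : Type u} [Field K] [Differential K] {G : Over (Spec (.of (constants K)))} [GrpObj G]
  {A : AutomorphicField G K}

theorem exists_rightTranslate_isClosedPoint (σ : 𝟙_ (Over (Spec (.of (constants K)))) ⟶ G)
    {x : (automorphicSystem G A).Diff} (hx : (automorphicSystem G A).IsClosedPoint x) :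
    ∃ y : (automorphicSystem G A).Diff, (automorphicSystem G A).IsClosedPoint y ∧
      rightTranslate G A σ x.1 = y.1 :=
  ⟨_, hx.map (isDifferential_rightTranslationIso A σ), rfl⟩

theorem isAlgClosed_constants [IsAlgClosed (constants K)] {L : Type u} [Field L] [Differential L]
    [Algebra K L] (h : constants L = (constants K).map (algebraMap K L)) :
    IsAlgClosed (constants L) := by
  let f : constants K →+* constants L := ((algebraMap K L).comp (constants K).subtype).codRestrict
    (constants L) (fun a => by rw [h]; exact ⟨a, a.2, rfl⟩)
  have hf : Function.Bijective f := by
    refine ⟨f.injective, fun ⟨c, hc⟩ => ?_⟩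
    rw [h] at hc
    obtain ⟨a, ha, rfl⟩ := hc
    exact ⟨⟨a, ha⟩, rfl⟩
  exact IsAlgClosed.of_ringEquiv _ _ (RingEquiv.ofBijective f hf)

variable [CharZero K] [IsAlgClosed (constants K)] [IsReduced G.left] [LocallyOfFiniteType G.hom]

/-- The comparison is made over `S = κ(x)`, whose constants are those of `K`. The constant factor
between the solutions at `x` and `y` is thus a rational point of `G`, and it is the required
translation. -/
theorem exists_rightTranslate_eq {x y : (automorphicSystem G A).Diff}
    (hx : (automorphicSystem G A).IsClosedPoint x) (hy : (automorphicSystem G A).IsClosedPoint y) :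
    ∃ σ : 𝟙_ (Over (Spec (.of (constants K)))) ⟶ G, rightTranslate G A σ x.1 = y.1 := by
  have : LocallyOfFiniteType (automorphicSystem G A).toOver.hom :=
    inferInstanceAs (LocallyOfFiniteType (pullback.snd G.hom (specMap (constants K) K)))
  have hc := hx.constants_eq
  have := isAlgClosed_constants hc
  obtain ⟨M, _, _, _, f, g, k, -, -, hfg⟩ := exists_comp_solutionAt_eq hy (isSolution_solutionAt x)
    (Algebra.ofId (constants K) _) (fun c hcc => by
      have hcc' : c ∈ constants ((automorphicSystem G A).kappa x) := hcc
      rw [hc] at hcc'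
      obtain ⟨a, ha, rfl⟩ := hcc'
      exact ⟨⟨a, ha⟩, rfl⟩)
  refine ⟨unitPoint k, ?_⟩
  rw [← toUnit_unitPoint, ← comp_rightTranslation] at hfg
  have h1 : specOverMap f ≫ (automorphicSystem G A).kappaPoint y = specOverMap g ≫
      (automorphicSystem G A).kappaPoint x ≫
        (Over.pullback (specMap (constants K) K)).map (rightTranslation G (unitPoint k)) := by
    refine projPoint_injective (C := constants K) (Y := G) ?_
    refine (projPoint_specOverMap_comp (Y := G) _ f).trans (hfg.trans ?_)
    refine Eq.trans ?_ (projPoint_specOverMap_comp (Y := G) _ g).symm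
    exact congrArg _ (projPoint_comp_map (Y := G) _ _).symm
  -- Both sides of `h1` are evaluated at a point of `Spec M`: one gives `y`, the other the translate
  -- of `x`.
  obtain ⟨z⟩ : Nonempty (Spec (.of M)) := inferInstance
  have h2 := (automorphicSystem G A).kappaPoint_apply y f z
  rw [h1] at h2
  have h3 := (automorphicSystem G A).kappaPoint_apply x g z
  rw [← h2, ← h3]
  rfl

/-- A right translation that moves `x` to `y` is a differential automorphism over `K`, so it
identifies the residue fields. The induced map goes from `κ(y)` to `κ(x)`, hence the inverse. -/
theorem exists_algEquiv_kappa {x y : (automorphicSystem G A).Diff}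
    (hx : (automorphicSystem G A).IsClosedPoint x) (hy : (automorphicSystem G A).IsClosedPoint y) :
    ∃ e : (automorphicSystem G A).kappa x ≃ₐ[K] (automorphicSystem G A).kappa y,
      ∀ a, e a′ = (e a)′ := by
  obtain ⟨σ, hσ⟩ := exists_rightTranslate_eq hx hy
  have h := isDifferential_rightTranslationIso A σ
  obtain rfl : DiffScheme.mapDiff h x = y := Subtype.ext hσ
  let e : (automorphicSystem G A).kappa (DiffScheme.mapDiff h x) ≃ₐ[K]
      (automorphicSystem G A).kappa x := AlgEquiv.ofBijective
    { DiffScheme.mapKappa h x with commutes' := DiffScheme.mapKappa_algebraMap h x }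
    (DiffScheme.bijective_mapKappa h x)
  have he (a) : e a′ = (e a)′ := DiffScheme.mapKappa_deriv h x a
  refine ⟨e.symm, fun a => e.injective ?_⟩
  rw [he, e.apply_symm_apply, e.apply_symm_apply]

end Closed

/-! ### Differential points with values in a differential field -/

theorem stalkClosedPointTo_germ_fromSpec {X : Scheme.{u}} {V : X.Opens} (hV : IsAffineOpen V)
    {R : CommRingCat.{u}} [IsLocalRing R] (φ : Γ(X, V) ⟶ R)
    (h : (Spec.map φ ≫ hV.fromSpec) (IsLocalRing.closedPoint R) ∈ V) (s : Γ(X, V)) :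
    Scheme.stalkClosedPointTo (Spec.map φ ≫ hV.fromSpec) (X.presheaf.germ V _ h s) = φ s := by
  have h1 : X.presheaf.germ V _ h ≫ Scheme.stalkClosedPointTo (Spec.map φ ≫ hV.fromSpec) = φ := by
    rw [Scheme.stalkClosedPointTo_comp]
    have h2 : hV.fromSpec (Spec.map φ (IsLocalRing.closedPoint R)) ∈ V := h
    have e : X.presheaf.germ V _ h2 ≫
        hV.fromSpec.stalkMap (Spec.map φ (IsLocalRing.closedPoint R)) =
        (Scheme.ΓSpecIso Γ(X, V)).inv ≫ (Spec Γ(X, V)).presheaf.germ ⊤ _ trivial := by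
      rw [Scheme.Hom.germ_stalkMap, hV.fromSpec_app_self, Category.assoc]
      exact congrArg _ ((Spec Γ(X, V)).presheaf.germ_res _ _ _)
    refine (Category.assoc _ _ _).symm.trans ?_
    refine (congrArg (· ≫ Scheme.stalkClosedPointTo (Spec.map φ)) e).trans ?_
    rw [Category.assoc, Scheme.germ_stalkClosedPointTo_Spec, Iso.inv_hom_id_assoc]
  exact congr($h1 s)

section DiffValued

variable {K : Type u} [Field K] [Differential K]

/-- A point with values in `K` is differential if evaluation at it is compatible with the
derivations. -/
def DiffScheme.IsDiffValued {X : DiffScheme K} (p : Spec (.of K) ⟶ X.toOver.left) : Prop :=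
  ∀ t, (Scheme.stalkClosedPointTo p t)′ = Scheme.stalkClosedPointTo p (X.der.stalk _ t)

theorem DiffScheme.IsDiffValued.comp {X Y : DiffScheme K} {p : Spec (.of K) ⟶ X.toOver.left}
    (hp : DiffScheme.IsDiffValued p) {f : X.toOver ⟶ Y.toOver} (hf : DiffScheme.IsDifferential f) :
    DiffScheme.IsDiffValued (p ≫ f.left) := by
  rw [DiffScheme.isDifferential_iff_stalk] at hf
  intro t
  rw [Scheme.stalkClosedPointTo_comp]
  change (Scheme.stalkClosedPointTo p (f.left.stalkMap _ t))′ =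
    Scheme.stalkClosedPointTo p (f.left.stalkMap _ (Y.der.stalk _ t))
  exact (hp _).trans (congrArg _ (hf _ t))

theorem DiffScheme.isDiffValued_pointOf {X : DiffScheme K} {U : X.toOver.left.Opens}
    (hU : IsAffineOpen U) {θ : Γ(X.toOver.left, U) →ₐ[K] K}
    (h : DiffScheme.IsDiffValued (X := X) (pointOf hU θ).left) (s : Γ(X.toOver.left, U)) :
    (θ s)′ = θ (X.der.app U s) := by
  have hm := pointOf_mem hU θ (IsLocalRing.closedPoint K)
  have e (t) : Scheme.stalkClosedPointTo (pointOf hU θ).left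
      (X.toOver.left.presheaf.germ U _ hm t) =
      θ t := stalkClosedPointTo_germ_fromSpec hU (CommRingCat.ofHom θ.toRingHom) hm t
  have h1 := h (X.toOver.left.presheaf.germ U _ hm s)
  rw [e, SchemeDerivation.stalk_germ, e] at h1
  exact h1

variable {C : Type u} [Field C] [Algebra C K] [ConstantBase C K]

/-- For the zero field the derivation kills all functions from `Y`, so a point whose coordinates on
`Y` are constants is compatible with the derivations. -/
theorem isDiffValued_of_constant {Y : Over (Spec (.of C))} {V : Y.left.Opens} (hV : IsAffineOpen V)
    (θ : Γ((baseChange K Y).left, proj K Y ⁻¹ᵁ V) →ₐ[K] K)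
    (hθ : ∀ s, (θ ((proj K Y).app V s))′ = 0) :
    DiffScheme.IsDiffValued (X := nonautonomous Y (0 : VectorField Y ⊗[C] K))
      (pointOf (Y := baseChange K Y) (isAffineOpen_preimage_proj hV) θ).left := by
  let X := nonautonomous Y (0 : VectorField Y ⊗[C] K)
  let p := (pointOf (Y := baseChange K Y) (isAffineOpen_preimage_proj hV) θ).left
  have hm : p (IsLocalRing.closedPoint K) ∈ proj K Y ⁻¹ᵁ V :=
    pointOf_mem (Y := baseChange K Y) (isAffineOpen_preimage_proj hV) θ (IsLocalRing.closedPoint K)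
  let ρ := (Scheme.stalkClosedPointTo p).hom
  have e (t) : ρ ((baseChange K Y).left.presheaf.germ _ _ hm t) = θ t :=
    stalkClosedPointTo_germ_fromSpec (isAffineOpen_preimage_proj hV)
      (CommRingCat.ofHom θ.toRingHom) hm t
  let d₁ := (Differential.deriv (R := K)).toLinearMap.toAddMonoidHom.comp ρ.toAddMonoidHom
  let d₂ := ρ.toAddMonoidHom.comp
    (X.der.stalk (p (IsLocalRing.closedPoint K))).toLinearMap.toAddMonoidHom
  have key : d₁ = d₂ := by
    refine baseChange_leibniz_ext Y _ hV hm ρ (fun a b => ?_) (fun a b => ?_)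
      (fun s => ?_) (fun a => ?_)
    · exact (congrArg _ (RingHom.map_mul ρ a b)).trans (Differential.deriv.leibniz (ρ a) (ρ b))
    · exact (congrArg ρ ((X.der.stalk _).leibniz a b)).trans
        ((RingHom.map_add ρ _ _).trans
          (congrArg₂ (· + ·) (RingHom.map_mul ρ _ _) (RingHom.map_mul ρ _ _)))
    · refine ((congrArg (fun z : K => z′) (e _)).trans (hθ s)).trans ?_
      refine Eq.trans ?_ (congrArg ρ (((X.der.stalk_germ _ _ hm _).trans
        (congrArg _ (nonautonomous_der_proj Y 0 V s))))).symm
      rw [map_zero]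
      exact ((RingHom.map_zero _).symm.trans (congrArg ρ (RingHom.map_zero _).symm))
    · refine (congrArg (fun z : K => z′) ((e _).trans (θ.commutes a))).trans ?_
      refine Eq.trans ?_ (congrArg ρ ((X.der.stalk_germ _ _ hm _).trans
        (congrArg _ (X.der_scalar _ a)))).symm
      exact ((e _).trans (θ.commutes a′)).symm
  exact fun t => DFunLike.congr_fun key t

theorem isSolution_extendCoefficients {C K L R : Type u} [Field C] [Field K] [Field L] [Algebra C K]
    [Algebra C L] [Algebra K L] [IsScalarTower C K L] [CommRing R] [Algebra C R] [Algebra K R]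
    [Algebra L R] [IsScalarTower C K R] [IsScalarTower C L R] [IsScalarTower K L R]
    [Differential L] [ConstantBase C L] [IsAlgClosed C]
    {G : Over (Spec (.of C))} [GrpObj G] [IsReduced G.left] [LocallyOfFiniteType G.hom]
    (A : AutomorphicField G K) (δ : Derivation C R R) {V : G.left.Opens} (hV : IsAffineOpen V)
    (θ : Γ((baseChange L G).left, proj L G ⁻¹ᵁ V) →ₐ[L] R)
    (hθ : ∀ s, δ (θ ((proj L G).app V s)) = θ ((automorphicSystem G
      (extendCoefficients G L A)).der.app (proj L G ⁻¹ᵁ V) ((proj L G).app V s))) :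
    IsSolution A δ
      (projPoint (pointOf (Y := baseChange L G) (isAffineOpen_preimage_proj hV) θ)) := by
  have h := isSolution_projPoint (extendCoefficients G L A) δ hV θ hθ
  rw [projPoint_pointOf hV, isSolution_pointOf_iff _ δ hV] at h ⊢
  intro s
  rw [h, fieldEval_extendCoefficients]

end DiffValued

/-! ### Splitting fields contain solutions -/

section Splitting

theorem exists_algHom_of_nontrivial {C B : Type*} [Field C] [IsAlgClosed C] [CommRing B]
    [Nontrivial B] [Algebra C B] [Algebra.FiniteType C B] : Nonempty (B →ₐ[C] C) := by
  obtain ⟨J, hJ⟩ := Ideal.exists_maximal B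
  let := Ideal.Quotient.field J
  have : Algebra.FiniteType C (B ⧸ J) :=
    Algebra.FiniteType.of_surjective (Ideal.Quotient.mkₐ C J) Ideal.Quotient.mk_surjective
  -- Without any homomorphism to `C`, the element `1` would vanish at all rational points vacuously
  -- and hence be zero.
  have : ∃ τ : (B ⧸ J) →ₐ[C] C, True := by
    by_contra hne
    push Not at hne
    exact one_ne_zero (eq_zero_of_forall_algHom (C := C) (b := (1 : B ⧸ J))
      (fun τ => (hne τ).elim))
  obtain ⟨τ, -⟩ := this
  exact ⟨τ.comp (Ideal.Quotient.mkₐ C J)⟩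

/-- Descent along the faithfully flat quasi-compact morphism `Spec S → Spec C`. The constant model
in the definition of splitting is an arbitrary scheme; finiteness provides it with rational points.
-/
theorem locallyOfFiniteType_of_baseChange {C S : Type u} [Field C] [Field S] [Algebra C S]
    (Y : Over (Spec (.of C))) (h : LocallyOfFiniteType (baseChange S Y).hom) :
    LocallyOfFiniteType Y.hom := by
  have hs : Surjective (specMap C S) :=
    ⟨fun x => ⟨IsLocalRing.closedPoint S, Subsingleton.elim _ _⟩⟩
  exact MorphismProperty.of_pullback_snd_of_descendsAlong (P := @LocallyOfFiniteType)
    (Q := @Surjective ⊓ @Flat ⊓ @QuasiCompact) (f := Y.hom) (g := specMap C S)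
    ⟨⟨hs, inferInstance⟩, inferInstance⟩ h

variable {K : Type u} [Field K] [Differential K] [IsAlgClosed (constants K)]
  {G : Over (Spec (.of (constants K)))} [GrpObj G] [IsReduced G.left] [LocallyOfFiniteType G.hom]
  {A : AutomorphicField G K}

/-- An automorphic system has a solution in each splitting field with algebraically closed
constants. -/
theorem exists_isSolution_of_isSplittingExtension {S : Type u} [Field S] [Differential S]
    [Algebra K S] [DifferentialAlgebra K S] [IsAlgClosed (constants S)]
    (h : IsSplittingExtension G A S) :
    ∃ s : specOver (constants K) S ⟶ G, IsSolution A (derivOver (constants K) S) s := by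
  obtain ⟨Y, φ, hφ⟩ := h
  have hG : LocallyOfFiniteType (baseChange S G).hom :=
    inferInstanceAs (LocallyOfFiniteType (pullback.snd G.hom (specMap (constants K) S)))
  have hiso : IsIso φ.inv.left := inferInstanceAs (IsIso ((Over.forget _).map φ.inv))
  have hYS : LocallyOfFiniteType (baseChange S Y).hom := by
    have e : φ.inv.left ≫ (baseChange S G).hom = (baseChange S Y).hom := Over.w φ.inv
    rw [← e]
    exact MorphismProperty.comp_mem @LocallyOfFiniteType φ.inv.left (baseChange S G).hom
      inferInstance hG
  have hY := locallyOfFiniteType_of_baseChange Y hYS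
  -- a rational point of `Y`
  obtain ⟨z, -⟩ : ∃ z : Y.left, True := by
    -- The identity of `G` gives a point of `G_S`, which `φ` carries to `Y_S`; so `Y` is nonempty.
    obtain ⟨p, -⟩ := exists_projPoint_eq (K := S) (Y := G)
      (CartesianMonoidalCategory.toUnit (specOver (constants K) S) ≫ MonObj.one)
    exact ⟨proj S Y (φ.hom.left (p.left (IsLocalRing.closedPoint S))), trivial⟩
  obtain ⟨V, hV, hz, -⟩ := exists_isAffineOpen_mem_and_subset (X := Y.left) (U := ⊤) (x := z)
    (TopologicalSpace.Opens.mem_top _)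
  have : Nontrivial Γ(Y.left, V) := by
    refine ⟨0, 1, fun h01 => (hV.primeIdealOf ⟨z, hz⟩).isPrime.ne_top ?_⟩
    rw [Ideal.eq_top_iff_one, ← h01]
    exact Ideal.zero_mem _
  have := finiteType_sections Y hV
  obtain ⟨τ⟩ := exists_algHom_of_nontrivial (C := constants S) (B := Γ(Y.left, V))
  -- the constant point of `Y_S` that it gives
  obtain ⟨q, hq⟩ := exists_projPoint_eq (K := S) (Y := Y)
    (pointOf hV ((Algebra.ofId (constants S) S).comp τ))
  have hqV (x) : q.left x ∈ proj S Y ⁻¹ᵁ V := by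
    have := pointOf_mem hV ((Algebra.ofId (constants S) S).comp τ) x
    rw [← hq] at this
    exact this
  obtain ⟨θ, rfl⟩ := exists_pointOf (Y := baseChange S Y) (isAffineOpen_preimage_proj hV) q hqV
  rw [projPoint_pointOf hV] at hq
  have hθ (s) : (θ ((proj S Y).app V s))′ = 0 := by
    have := congr($(pointOf_injective hV hq) s)
    rw [projAlgHom_apply] at this
    rw [this]
    exact (τ s).2
  -- A constant point of `Y_S` is differential, and the differential morphism `φ⁻¹` takes it to a
  -- differential point of `G_S`, which is a solution.
  have hp := (isDiffValued_of_constant hV θ hθ).comp hφ.inv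
  -- the corresponding point of `G_S`
  let p : specOver S S ⟶ baseChange S G :=
    pointOf (Y := baseChange S Y) (isAffineOpen_preimage_proj hV) θ ≫ φ.inv
  obtain ⟨W, hW, hz, -⟩ := exists_isAffineOpen_mem_and_subset (X := G.left) (U := ⊤)
    (x := proj S G (p.left (IsLocalRing.closedPoint S))) (TopologicalSpace.Opens.mem_top _)
  obtain ⟨ψ, hψ⟩ := exists_pointOf (Y := baseChange S G) (isAffineOpen_preimage_proj hW) p
    (fun x => by
      rw [show x = IsLocalRing.closedPoint S from Subsingleton.elim (α := Spec (.of S)) _ _]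
      exact hz)
  have hp' : DiffScheme.IsDiffValued (X := automorphicSystem G (extendCoefficients G S A))
      (pointOf (Y := baseChange S G) (isAffineOpen_preimage_proj hW) ψ).left := by
    rw [← hψ]
    exact hp
  exact ⟨_, isSolution_extendCoefficients A (derivOver (constants K) S) hW ψ fun s =>
    DiffScheme.isDiffValued_pointOf (X := automorphicSystem G (extendCoefficients G S A))
      (isAffineOpen_preimage_proj hW) hp' _⟩

end Splitting

/-! ### Minimality of the residue fields -/

section Embedding

open scoped MonObj

variable {K : Type u} [Field K] [Differential K] [CharZero K] [IsAlgClosed (constants K)]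
  {G : Over (Spec (.of (constants K)))} [GrpObj G] [IsReduced G.left] [LocallyOfFiniteType G.hom]
  {A : AutomorphicField G K}

/-- In the composite `M` the tautological solution equals a solution over `S` times a point over the
constants of `S`. This product is defined over `S`, so the coordinates at `x`, which generate
`κ(x)`, have their images in `S`. -/
theorem exists_algHom_of_isSplittingExtension {x : (automorphicSystem G A).Diff}
    (hx : (automorphicSystem G A).IsClosedPoint x) {S : Type u} [Field S] [Differential S]
    [Algebra K S] [DifferentialAlgebra K S] [IsAlgClosed (constants S)]
    (h : IsSplittingExtension G A S) :
    ∃ f : (automorphicSystem G A).kappa x →ₐ[K] S, ∀ a, f a′ = (f a)′ := by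
  obtain ⟨s, hs⟩ := exists_isSolution_of_isSplittingExtension h
  let i₀ : constants K →+* constants S := (algebraMap (constants K) S).codRestrict (constants S)
    (fun a => ConstantBase.deriv_algebraMap_eq_zero a)
  let : Algebra (constants K) (constants S) := i₀.toAlgebra
  let i : constants S →ₐ[constants K] S := { (constants S).subtype with commutes' := fun _ => rfl }
  obtain ⟨M, _, _, _, f, g, k, hf, hg, hfg⟩ :=
    exists_comp_solutionAt_eq hx hs i (fun c hc => ⟨⟨c, hc⟩, rfl⟩)
  -- The corrected solution, seen as an `S`-point of `G_K`. Over `M` it becomes the tautological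
  -- point of `x`, so it lies over `x` as well.
  obtain ⟨p, hp⟩ := exists_projPoint_eq (K := K) (Y := G) (s * (specOverMap i ≫ k))
  have h1 : specOverMap f ≫ (automorphicSystem G A).kappaPoint x = specOverMap g ≫ p := by
    refine projPoint_injective (C := constants K) (Y := G) ?_
    refine (projPoint_specOverMap_comp (Y := G) _ f).trans (hfg.trans ?_)
    refine Eq.trans ?_ (projPoint_specOverMap_comp (Y := G) _ g).symm
    rw [hp]
  obtain ⟨U, hU, hxU, -⟩ := exists_isAffineOpen_mem_and_subset
    (X := (automorphicSystem G A).toOver.left) (U := ⊤) (x := x.1)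
    (TopologicalSpace.Opens.mem_top _)
  obtain ⟨z⟩ : Nonempty (Spec (.of M)) := inferInstance
  have hz : p.left ((specOverMap g).left z) = x.1 := by
    have h2 := (automorphicSystem G A).kappaPoint_apply x f z
    rw [h1] at h2
    exact h2
  obtain ⟨θ, hθ⟩ := exists_pointOf (Y := (automorphicSystem G A).toOver) hU p (fun y => by
    rw [show y = (specOverMap g).left z from Subsingleton.elim (α := Spec (.of S)) _ _]
    exact hz ▸ hxU)
  rw [hθ, (automorphicSystem G A).kappaPoint_eq_pointOf x hU hxU] at h1
  have h2 : f.comp ((automorphicSystem G A).evalAlgHom x U hxU) = g.comp θ :=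
    pointOf_injective hU (((specOverMap_pointOf hU _ f).symm.trans h1).trans
      (specOverMap_pointOf hU θ g))
  have h3 (a) : f ((automorphicSystem G A).eval x U hxU a) = g (θ a) := congr($h2 a)
  -- Each element of `κ(x)` is a quotient of values of functions on `U`, and `f` sends those values
  -- into the image of `g`.
  have h4 (c) : f c ∈ g.range := by
    obtain ⟨a, b, rfl⟩ := DiffScheme.exists_eval_div hU hxU c
    refine ⟨θ a / θ b, ?_⟩
    exact (map_div₀ g _ _).trans
      ((congrArg₂ (· / ·) (h3 a) (h3 b)).symm.trans (map_div₀ f _ _).symm)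
  let e := AlgEquiv.ofInjectiveField g
  refine ⟨e.symm.toAlgHom.comp (f.codRestrict g.range h4), fun a => g.injective ?_⟩
  have h5 (a) : g (e.symm.toAlgHom.comp (f.codRestrict g.range h4) a) = f a :=
    congrArg Subtype.val (e.apply_symm_apply (f.codRestrict g.range h4 a))
  exact (h5 _).trans ((hf a).trans ((congrArg (fun c : M => c′) (h5 a)).symm.trans (hg _).symm))

end Embedding

/-! ### Solutions split automorphic systems -/

section Torsor

open scoped MonObj

variable {C L : Type u} [Field C] [Field L] [Algebra C L]

/-- A scheme over an extension field as a scheme over the base field. -/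
noncomputable abbrev overBase (C : Type u) {L : Type u} [Field C] [Field L] [Algebra C L]
    (Z : Over (Spec (.of L))) : Over (Spec (.of C)) := Over.mk (Z.hom ≫ specMap C L)

/-- The structure morphism of a scheme over an extension field. -/
noncomputable def overBaseHom (C : Type u) {L : Type u} [Field C] [Field L] [Algebra C L]
    (Z : Over (Spec (.of L))) : overBase C Z ⟶ specOver C L := Over.homMk Z.hom rfl

variable {G : Over (Spec (.of C))} [GrpObj G]

/-- Two base changes of a group are isomorphic by the left translation by a point. -/
theorem exists_iso_of_isPullback {Z Z' : Over (Spec (.of L))} {p : overBase C Z ⟶ G}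
    {p' : overBase C Z' ⟶ G} (H : IsPullback p.left Z.hom G.hom (specMap C L))
    (H' : IsPullback p'.left Z'.hom G.hom (specMap C L)) (h : specOver C L ⟶ G) :
    ∃ φ : Z ≅ Z', φ.hom.left ≫ p'.left = ((overBaseHom C Z ≫ h)⁻¹ * p).left := by
  have key {Z Z' : Over (Spec (.of L))} {p' : overBase C Z' ⟶ G}
      (H' : IsPullback p'.left Z'.hom G.hom (specMap C L)) (r : overBase C Z ⟶ G) :
      ∃ φ : Z ⟶ Z', φ.left ≫ p'.left = r.left :=
    ⟨Over.homMk (H'.lift r.left Z.hom (Over.w r)) (H'.lift_snd _ _ _), H'.lift_fst _ _ _⟩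
  -- Left multiplication by an `L`-point `ε` commutes with every morphism of `L`-schemes, because
  -- `ε` is pulled back from `Spec L`. This lets the two translations below be composed.
  have comp {Z Z' : Over (Spec (.of L))} {p' r' : overBase C Z' ⟶ G} {r t : overBase C Z ⟶ G}
      {φ : Z ⟶ Z'} (h₁ : φ.left ≫ p'.left = r.left) (ε : specOver C L ⟶ G)
      (h₂ : r' = (overBaseHom C Z' ≫ ε) * p') (h₃ : t = (overBaseHom C Z ≫ ε) * r) :
      φ.left ≫ r'.left = t.left := by
    let a : overBase C Z ⟶ overBase C Z' := Over.homMk φ.left (by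
      change φ.left ≫ Z'.hom ≫ specMap C L = Z.hom ≫ specMap C L
      rw [← Category.assoc, Over.w])
    have h₄ : a ≫ p' = r := by ext1; exact h₁
    have h₅ : a ≫ overBaseHom C Z' = overBaseHom C Z := by ext1; exact Over.w φ
    have h₆ : a ≫ r' = t := by
      rw [h₂, h₃, MonObj.comp_mul, h₄, ← Category.assoc, h₅]
    exact congr(($h₆).left)
  -- The two mutually inverse maps are `g ↦ h⁻¹ g` and `g ↦ h g`.
  obtain ⟨φ, hφ⟩ := key H' ((overBaseHom C Z ≫ h)⁻¹ * p)
  obtain ⟨ψ, hψ⟩ := key H ((overBaseHom C Z' ≫ h) * p')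
  refine ⟨⟨φ, ψ, ?_, ?_⟩, hφ⟩
  · ext1
    refine H.hom_ext ?_ ?_
    · rw [Over.comp_left, Category.assoc, hψ]
      refine (comp hφ h rfl (mul_inv_cancel_left _ _).symm).trans ?_
      exact (Category.id_comp _).symm
    · exact (Over.w (φ ≫ ψ)).trans (Category.id_comp _).symm
  · ext1
    refine H'.hom_ext ?_ ?_
    · rw [Over.comp_left, Category.assoc, hφ]
      refine (comp hψ h⁻¹ (by rw [GrpObj.comp_inv])
        (by rw [GrpObj.comp_inv, inv_mul_cancel_left])).trans ?_
      exact (Category.id_comp _).symm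
    · exact (Over.w (ψ ≫ φ)).trans (Category.id_comp _).symm

/-- A scheme over `C` as a scheme over an isomorphic base. -/
noncomputable abbrev changeBase {S T : Scheme.{u}} (Y : Over S) (m : S ≅ T) : Over T :=
  Over.mk (Y.hom ≫ m.hom)

/-- Splitting asks for a model over `constants L`, while `G` lives over the isomorphic field `C`.
Transporting the structure morphism along `m` leaves the base change to `L` a pullback of `G` over
`C`. -/
theorem isPullback_changeBase {C' : Type u} [Field C'] [Algebra C' L] (G : Over (Spec (.of C)))
    (m : Spec (.of C) ≅ Spec (.of C')) (hm : specMap C' L = specMap C L ≫ m.hom) :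
    IsPullback (proj L (changeBase G m)) (baseChange L (changeBase G m)).hom G.hom
      (specMap C L) := by
  have H : IsPullback (proj L (changeBase G m)) (baseChange L (changeBase G m)).hom
    (G.hom ≫ m.hom) (specMap C' L) := IsPullback.of_hasPullback _ _
  rw [hm] at H
  refine H.of_iso (Iso.refl _) (Iso.refl _) (Iso.refl _) m.symm ?_ ?_ ?_ ?_
  · exact (Category.comp_id _).trans (Category.id_comp _).symm
  · exact (Category.comp_id _).trans (Category.id_comp _).symm
  · rw [Category.assoc, Iso.symm_hom, m.hom_inv_id, Category.comp_id]
    exact (Category.id_comp _).symm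
  · rw [Category.assoc, Iso.symm_hom, m.hom_inv_id, Category.comp_id]
    exact (Category.id_comp _).symm

/-- Without new constants, `C` maps isomorphically onto `constants L`. -/
theorem exists_iso_constants [Differential L] [ConstantBase C L]
    (hc : ∀ c : L, c′ = 0 → ∃ a, algebraMap C L a = c) :
    ∃ m : Spec (.of C) ≅ Spec (.of (constants L)),
      specMap (constants L) L = specMap C L ≫ m.hom := by
  let f : C →+* constants L := (algebraMap C L).codRestrict (constants L)
    (fun a => ConstantBase.deriv_algebraMap_eq_zero a)
  have hf : Function.Bijective f := ⟨f.injective, fun ⟨c, hcc⟩ => by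
    obtain ⟨a, rfl⟩ := hc c hcc
    exact ⟨a, rfl⟩⟩
  let e : CommRingCat.of C ≅ CommRingCat.of (constants L) :=
    (RingEquiv.ofBijective f hf).toCommRingCatIso
  have he : CommRingCat.ofHom (algebraMap (constants L) L) =
      e.inv ≫ CommRingCat.ofHom (algebraMap C L) := by
    rw [Iso.eq_inv_comp]
    rfl
  refine ⟨Scheme.Spec.mapIso e.symm.op, ?_⟩
  rw [specMap, he, Spec.map_comp]
  rfl

end Torsor

/-! ### The splitting isomorphism `g ↦ h⁻¹ g` -/

section Splitting

open scoped MonObj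

variable {C K L : Type u} [Field C] [Field K] [Field L] [Algebra C K] [Algebra C L] [Algebra K L]
  [IsScalarTower C K L] [Differential L] [ConstantBase C L] [IsAlgClosed C]
  {G : Over (Spec (.of C))} [GrpObj G] [IsReduced G.left] [LocallyOfFiniteType G.hom]

/-- The projection of a base change as a morphism over the base field. -/
noncomputable def overProj (Y : Over (Spec (.of C))) : overBase C (baseChange L Y) ⟶ Y :=
  Over.homMk (proj L Y) pullback.condition

/-- The quotient of the generic point of `G` by a solution is constant. -/
theorem exists_deriv_inv_mul_eq_zero (A : AutomorphicField G K) {h : specOver C L ⟶ G}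
    (hh : IsSolution A (derivOver C L) h) (x : (baseChange L G).left) {V : G.left.Opens}
    (hV : IsAffineOpen V)
    (hx : x ∈ ((overBaseHom C (baseChange L G) ≫ h)⁻¹ * overProj G).left ⁻¹ᵁ V) :
    ∃ (W : (baseChange L G).left.Opens)
      (hW : W ≤ ((overBaseHom C (baseChange L G) ≫ h)⁻¹ * overProj G).left ⁻¹ᵁ V), x ∈ W ∧
      ∀ s, (automorphicSystem G (extendCoefficients G L A)).der.app W
        (((overBaseHom C (baseChange L G) ≫ h)⁻¹ * overProj G).left.appLE V W hW s) = 0 := by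
  let Z := baseChange L G
  let X := automorphicSystem G (extendCoefficients G L A)
  let π : overBase C Z ⟶ G := (overBaseHom C Z ≫ h)⁻¹ * overProj G
  obtain ⟨V', hV', hx', -⟩ := exists_isAffineOpen_mem_and_subset (X := G.left) (U := ⊤)
    (x := proj L G x) (TopologicalSpace.Opens.mem_top _)
  obtain ⟨W, hW, hxW, hWV⟩ := exists_isAffineOpen_mem_and_subset (X := Z.left)
    (U := π.left ⁻¹ᵁ V ⊓ proj L G ⁻¹ᵁ V') (x := x) ⟨hx, hx'⟩
  have hW₁ : W ≤ π.left ⁻¹ᵁ V := fun y hy => (hWV hy).1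
  have hW₂ : W ≤ proj L G ⁻¹ᵁ V' := fun y hy => (hWV hy).2
  refine ⟨W, hW₁, hxW, ?_⟩
  -- The coordinate ring of the affine piece `W` is treated as a differential algebra, so that the
  -- calculus of solutions applies to points with values in it.
  let R := Γ(Z.left, W)
  let : Algebra C R := ((algebraMap L R).comp (algebraMap C L)).toAlgebra
  let : Algebra K R := ((algebraMap L R).comp (algebraMap K L)).toAlgebra
  have : IsScalarTower C L R := IsScalarTower.of_algebraMap_eq fun _ => rfl
  have : IsScalarTower K L R := IsScalarTower.of_algebraMap_eq fun _ => rfl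
  have : IsScalarTower C K R := IsScalarTower.of_algebraMap_eq fun c =>
    congrArg (algebraMap L R) (IsScalarTower.algebraMap_apply C K L c)
  let D : Derivation ℤ R R := X.der.app W
  have hder (a : L) : D (algebraMap L R a) = algebraMap L R a′ := X.der_scalar W a
  let δ : Derivation C R R := Derivation.mk'
    { toFun := D
      map_add' := map_add _
      map_smul' := fun c r => by
        rw [Algebra.smul_def, Derivation.leibniz, IsScalarTower.algebraMap_apply C L R, hder,
          ConstantBase.deriv_algebraMap_eq_zero, map_zero, smul_zero, add_zero, RingHom.id_apply,
          smul_eq_mul, Algebra.smul_def, IsScalarTower.algebraMap_apply C L R] }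
    (fun a b => D.leibniz a b)
  -- The inclusion of `W` is a point of `G` with values in `R`. It is a solution because `R` carries
  -- the derivation `∂_A`.
  let w : specOver L R ⟶ Z := pointOf (Y := Z) hW (AlgHom.id L R)
  have hw : IsSolution A δ (projPoint w) := by
    have e : _ = w := pointOf_res (Y := Z) (isAffineOpen_preimage_proj hV') hW hW₂ (AlgHom.id L R)
    rw [← e]
    refine isSolution_extendCoefficients A δ hV' _ fun s => ?_
    exact X.der.app_res _ _ hW₂ _
  have hL : IsSolution A δ (specOverMap (IsScalarTower.toAlgHom C L R) ≫ h) :=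
    hh.map (IsScalarTower.toAlgHom K L R) fun a => (hder a).symm
  -- The given solution `h`, extended to `R`, and the tautological point are two solutions over the
  -- same ring, so their quotient is constant. This quotient is the restriction of `π` to `W`.
  have hc := hL.isConstantPoint hw
  let wC : specOver C R ⟶ overBase C Z := Over.homMk w.left (by
    change w.left ≫ Z.hom ≫ specMap C L = _
    rw [← Category.assoc, Over.w]
    exact specMap_comp_specMap C L R)
  have h₁ : wC ≫ overProj G = projPoint w := by ext1; rfl
  have h₂ : wC ≫ overBaseHom C Z = specOverMap (IsScalarTower.toAlgHom C L R) := by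
    ext1; exact Over.w w
  have h₃ : (specOverMap (IsScalarTower.toAlgHom C L R) ≫ h)⁻¹ * projPoint w = wC ≫ π := by
    rw [MonObj.comp_mul, GrpObj.comp_inv, ← Category.assoc, h₁, h₂]
  rw [h₃] at hc
  obtain ⟨φ, hφ⟩ := exists_pointOf hV (wC ≫ π) fun y => by
    have := pointOf_mem (Y := Z) hW (AlgHom.id L R) y
    exact hW₁ this
  have h₄ := congr(($hφ).left)
  -- The coordinates of this constant point are the pullbacks of functions along `π`, so the
  -- derivation kills these pullbacks.
  have h₅ : Spec.map (π.left.appLE V W hW₁) ≫ hV.fromSpec =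
      Spec.map (CommRingCat.ofHom φ.toRingHom) ≫ hV.fromSpec := by
    rw [IsAffineOpen.SpecMap_appLE_fromSpec π.left hV hW hW₁, ← pointOf_left, ← h₄]
    have h₆ : w.left = hW.fromSpec := by
      refine (pointOf_left (Y := Z) hW (AlgHom.id L R)).trans ?_
      exact (congrArg (· ≫ hW.fromSpec) (Spec.map_id _)).trans (Category.id_comp _)
    rw [← h₆]
    rfl
  rw [cancel_mono] at h₅
  have h₇ := Spec.map_injective h₅
  rw [hφ, isConstantPoint_pointOf_iff] at hc
  intro s
  exact (congrArg δ congr($h₇ s)).trans (hc s)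

theorem exists_stalk_inv_mul_eq_zero (A : AutomorphicField G K) {h : specOver C L ⟶ G}
    (hh : IsSolution A (derivOver C L) h) (x : (baseChange L G).left) :
    ∃ (V : G.left.Opens) (_ : IsAffineOpen V)
      (hx : x ∈ ((overBaseHom C (baseChange L G) ≫ h)⁻¹ * overProj G).left ⁻¹ᵁ V), ∀ s,
      (automorphicSystem G (extendCoefficients G L A)).der.stalk x
        ((baseChange L G).left.presheaf.germ _ x hx
          (((overBaseHom C (baseChange L G) ≫ h)⁻¹ * overProj G).left.app V s)) = 0 := by
  obtain ⟨V, hV, hx, -⟩ := exists_isAffineOpen_mem_and_subset (X := G.left) (U := ⊤)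
    (x := ((overBaseHom C (baseChange L G) ≫ h)⁻¹ * overProj G).left x)
    (TopologicalSpace.Opens.mem_top _)
  refine ⟨V, hV, hx, fun s => ?_⟩
  obtain ⟨W, hW, hxW, hs⟩ := exists_deriv_inv_mul_eq_zero A hh x hV hx
  refine (congrArg _
    ((baseChange L G).left.presheaf.germ_res_apply (homOfLE hW) x hxW _).symm).trans ?_
  refine ((automorphicSystem G (extendCoefficients G L A)).der.stalk_germ x W hxW _).trans ?_
  exact (congrArg _ (hs s)).trans (map_zero _)

/-- Left translation by `h⁻¹` identifies `G_L` with the base change of the model. Functions from the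
model pull back to functions killed by `∂_A`, in accordance with the zero field on the target. -/
theorem exists_iso_changeBase (A : AutomorphicField G K) {h : specOver C L ⟶ G}
    (hh : IsSolution A (derivOver C L) h) {C' : Type u} [Field C'] [Algebra C' L]
    [ConstantBase C' L] (m : Spec (.of C) ≅ Spec (.of C'))
    (hm : specMap C' L = specMap C L ≫ m.hom) :
    ∃ φ : (automorphicSystem G (extendCoefficients G L A)).toOver ≅
      (nonautonomous (changeBase G m) (0 : VectorField (changeBase G m) ⊗[C'] L)).toOver,
      DiffScheme.IsDifferential φ.hom := by
  have H' := isPullback_changeBase G m hm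
  let p' : overBase C (baseChange L (changeBase G m)) ⟶ G :=
    Over.homMk (proj L (changeBase G m)) H'.w
  have H : IsPullback (overProj (L := L) G).left (baseChange L G).hom G.hom (specMap C L) :=
    IsPullback.of_hasPullback G.hom (specMap C L)
  have key := exists_iso_of_isPullback (Z := baseChange L G)
    (Z' := baseChange L (changeBase G m)) (p := overProj G) (p' := p') H H' h
  obtain ⟨φ, hφ⟩ := key
  -- The composite `φ.hom.left ≫ p'.left` is kept intact so that `hφ` rewrites it as the translation
  -- by `h⁻¹`.
  have hP (x : (baseChange L G).left) : ∃ (V : G.left.Opens) (_ : IsAffineOpen V)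
      (hx : x ∈ (φ.hom.left ≫ p'.left) ⁻¹ᵁ V), ∀ s,
      (automorphicSystem G (extendCoefficients G L A)).der.stalk x
        ((baseChange L G).left.presheaf.germ _ x hx ((φ.hom.left ≫ p'.left).app V s)) = 0 := by
    rw [hφ]
    exact exists_stalk_inv_mul_eq_zero A hh x
  have hd := isDifferential_of_stalk (Y := changeBase G m)
    (A := (0 : VectorField (changeBase G m) ⊗[C'] L))
    (X := automorphicSystem G (extendCoefficients G L A)) φ.hom
  refine ⟨φ, hd fun x => ?_⟩
  clear hd
  exact (hP x).elim fun V hV => hV.elim fun hV hV' => hV'.elim fun hx hs => ⟨V, hV, hx, fun s => by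
    have h1 (t : Γ((baseChange L (changeBase G m)).left, proj L (changeBase G m) ⁻¹ᵁ V)) :
        φ.hom.left.stalkMap x ((baseChange L (changeBase G m)).left.presheaf.germ _
          (φ.hom.left x) hx t) =
        (baseChange L G).left.presheaf.germ _ x hx (φ.hom.left.app _ t) :=
      Scheme.Hom.germ_stalkMap_apply φ.hom.left _ x hx t
    have h2 := hs s
    refine (congrArg ((automorphicSystem G (extendCoefficients G L A)).der.stalk x) (h1 _)).trans ?_
    refine h2.trans ?_
    have hv : vectorFieldApply (K := L) (changeBase G m) V s 0 = 0 := map_zero _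
    refine Eq.symm ((h1 _).trans ?_)
    rw [hv]
    exact (congrArg _ (RingHom.map_zero _)).trans (RingHom.map_zero _)⟩

theorem splits_of_isSolution (A : AutomorphicField G K) {h : specOver C L ⟶ G}
    (hh : IsSolution A (derivOver C L) h) (hc : ∀ c : L, c′ = 0 → ∃ a, algebraMap C L a = c) :
    (automorphicSystem G (extendCoefficients G L A)).Splits := by
  obtain ⟨m, hm⟩ := exists_iso_constants hc
  obtain ⟨φ, hφ⟩ := exists_iso_changeBase A hh m hm
  exact ⟨_, φ, hφ⟩

end Splitting

end LieVessiot

/-! ### The theorem -/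

open CategoryTheory AlgebraicGeometry MonoidalCategory LieVessiot
open scoped Differential

theorem proposition4 {K : Type u} [Field K] [CharZero K] [Differential K]
    [IsAlgClosed (constants K)]
    (G : Over (Spec (.of (constants K)))) [GrpObj G] [IsReduced G.left] [IsSeparated G.hom]
    [LocallyOfFiniteType G.hom] [QuasiCompact G.hom]
    (A : AutomorphicField G K) :
    -- closed differential points exist
    (∃ x : (automorphicSystem G A).Diff, (automorphicSystem G A).IsClosedPoint x) ∧
    -- their residue fields have the same constants and are splitting extensions
    (∀ x : (automorphicSystem G A).Diff, (automorphicSystem G A).IsClosedPoint x →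
      constants ((automorphicSystem G A).kappa x) =
        (constants K).map (algebraMap K ((automorphicSystem G A).kappa x)) ∧
      IsSplittingExtension G A ((automorphicSystem G A).kappa x)) ∧
    -- right translation by `G(C)` acts on the closed differential points
    (∀ (σ : 𝟙_ (Over (Spec (.of (constants K)))) ⟶ G) (x : (automorphicSystem G A).Diff),
      (automorphicSystem G A).IsClosedPoint x →
      ∃ y : (automorphicSystem G A).Diff, (automorphicSystem G A).IsClosedPoint y ∧
        rightTranslate G A σ x.1 = y.1) ∧
    -- this action is transitive
    (∀ x y : (automorphicSystem G A).Diff, (automorphicSystem G A).IsClosedPoint x →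
      (automorphicSystem G A).IsClosedPoint y →
      ∃ σ : 𝟙_ (Over (Spec (.of (constants K)))) ⟶ G, rightTranslate G A σ x.1 = y.1) ∧
    -- uniqueness of the Galois extension
    (∀ x y : (automorphicSystem G A).Diff, (automorphicSystem G A).IsClosedPoint x →
      (automorphicSystem G A).IsClosedPoint y →
      ∃ e : (automorphicSystem G A).kappa x ≃ₐ[K] (automorphicSystem G A).kappa y,
        ∀ a, e a′ = (e a)′) ∧
    -- minimality of the Galois extension
    (∀ x : (automorphicSystem G A).Diff, (automorphicSystem G A).IsClosedPoint x →
      ∀ (S : Type u) [Field S] [Differential S] [Algebra K S] [DifferentialAlgebra K S]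
        [IsAlgClosed (constants S)], IsSplittingExtension G A S →
        ∃ f : (automorphicSystem G A).kappa x →ₐ[K] S, ∀ a, f a′ = (f a)′) := by
  have hft : LocallyOfFiniteType (automorphicSystem G A).toOver.hom :=
    inferInstanceAs (LocallyOfFiniteType (Limits.pullback.snd G.hom (specMap (constants K) K)))
  have hqc : QuasiCompact (automorphicSystem G A).toOver.hom :=
    inferInstanceAs (QuasiCompact (Limits.pullback.snd G.hom (specMap (constants K) K)))
  -- The identity of `G` supplies a `K`-point of `G_K`.
  have hne : Nonempty (automorphicSystem G A).toOver.left := by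
    obtain ⟨p, -⟩ := exists_projPoint_eq (K := K) (Y := G)
      (CartesianMonoidalCategory.toUnit (specOver (constants K) K) ≫ MonObj.one)
    exact ⟨p.left (IsLocalRing.closedPoint K)⟩
  refine ⟨DiffScheme.exists_isClosedPoint, fun x hx => ⟨hx.constants_eq, ?_⟩,
    fun σ x hx => exists_rightTranslate_isClosedPoint σ hx,
    fun x y hx hy => exists_rightTranslate_eq hx hy, fun x y hx hy => exists_algEquiv_kappa hx hy,
    fun x hx S _ _ _ _ _ h => exists_algHom_of_isSplittingExtension hx h⟩
  -- The tautological solution at `x` splits the system over `κ(x)`, whose constants all come from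
  -- `K` because `x` is closed.
  refine splits_of_isSolution A (isSolution_solutionAt x) fun c hc => ?_
  have hc' : c ∈ constants ((automorphicSystem G A).kappa x) := hc
  rw [hx.constants_eq] at hc'
  obtain ⟨a, ha, rfl⟩ := hc'
  exact ⟨⟨a, ha⟩, rfl⟩
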